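/- Let $(X,\mu)$ be a $\sigma$-finite measure space, $H$ a real Hilbert space and $\alpha\colon X\to H$ a map which is weakly measurable (that is, $x\mapsto\langle\alpha_x,h\rangle$ is measurable for every $h\in H$) and essentially separably valued (there is a separable subset of $H$ that contains $\alpha_x$ for almost every $x$; this is automatic if $H$ is separable). For $f\in L^2(X\times X)$ let $K_f$ be the Hilbert--Schmidt operator $(K_f\xi)(x)=\int_X f(x,y)\xi(y)\,dy$ on the complex Hilbert space $L^2(X)$. A weak* continuous operator $T$ on $B(L^2(X))$ is the measurable Schur multiplier with symbol $\varphi\in L^\infty(X\times X)$ if $T(K_f)=K_{\varphi f}$ for all $f\in L^2(X\times X)$; it is called selfadjoint if it restricts to a selfadjoint operator on the Hilbert space of Hilbert--Schmidt operators on $L^2(X)$. Then for every $t\ge 0$ the function $$\phi_t(x,y)=e^{-t\|\alpha_x-\alpha_y\|_H^2}$$ is the symbol of a measurable Schur multiplier $T_t$ on $B(L^2(X))$, and $(T_t)_{t\ge 0}$ is a weak* continuous semigroup of selfadjoint unital completely positive operators. Moreover, there are a probability space $(\Omega,P)$ such that the von Neumann algebra $M=L^\infty(\Omega)\,\overline{\otimes}\,B(L^2(X))$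 acting on $L^2(\Omega,L^2(X))$ is injective and $\tau=\int_\Omega\cdot\,\otimes\operatorname{tr}$ is a normal semifinite faithful trace on $M$, and a weak* continuous group $(U_t)_{t\in\mathbb R}$ of $\tau$-preserving $*$-automorphisms of $M$, such that $J\colon B(L^2(X))\to M$, $z\mapsto 1\otimes z$, is a unital trace preserving injective normal $*$-homomorphism, $\mathbb E=\int_\Omega\cdot\,\otimes\mathrm{Id}\colon M\to B(L^2(X))$ is the trace preserving normal faithful conditional expectation associated with $J$, and $$T_t=\mathbb E\,U_t\,J\qquad(t\ge 0).$$ The space $\Omega$ and the group can be chosen so that $\Omega$ carries an $L^2_{\mathbb R}(\mathbb R,H)$-isonormal process $W$ (a linear map from $L^2_{\mathbb R}(\mathbb R,H)$ to random variables on $\Omega$ such that each $W(g)$ is a centered Gaussian, $\int_\Omega W(g)W(g')\,dP=\langle g,g'\rangle$, and the span of the finite products of the $W(g)$ is dense in $L^2_{\mathbb R}(\Omega)$) for which, for every $t\in\mathbb R$: $U_t(e^{iW(g)}\otimes 1)=e^{iW(S_tg)}\otimes 1$ for all $g$, with the shift $(S_tg)(s)=g(s-t)$; and $U_t(1\otimes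 z)=V_t(1\otimes z)V_t^*$ for all $z\in B(L^2(X))$, where $V_t\in M$ is the unitary operator of multiplication by (a jointly measurable version of) $(\omega,x)\mapsto e^{\sqrt2\,i\,(W_t(\alpha_x))(\omega)}$, with $W_t(h)=W(1_{[0,t]}\otimes h)$ for $t\ge0$ and $W_t(h)=W(-1_{[t,0]}\otimes h)$ for $t<0$. -/

import Mathlib

open MeasureTheory ProbabilityTheory Topology
open scoped ENNReal NNReal InnerProductSpace

noncomputable section

namespace SchurDilation

/-! ### Operators on a complex Hilbert space -/

section Hilbert

/-- The algebra `B(K)` of bounded operators. -/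
abbrev Bd (K : Type*) [NormedAddCommGroup K] [InnerProductSpace ℂ K] : Type _ := K →L[ℂ] K

/-- The weak* (ultraweak) topology of `B(K)`: the coarsest topology for which all the functionals
`x ↦ ∑ₙ ⟪ηₙ, x ξₙ⟫` with `∑ ‖ξₙ‖² < ∞` and `∑ ‖ηₙ‖² < ∞` (the elements of the predual of `B(K)`)
are continuous. -/
@[reducible] def weakStar (K : Type*) [NormedAddCommGroup K] [InnerProductSpace ℂ K] :
    TopologicalSpace (Bd K) :=
  ⨅ p : lp (fun _ : ℕ => K) 2 × lp (fun _ : ℕ => K) 2,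
    TopologicalSpace.induced (fun x : Bd K => ∑' n, ⟪p.2 n, x (p.1 n)⟫_ℂ) inferInstance

variable (K : Type*) [NormedAddCommGroup K] [InnerProductSpace ℂ K] [CompleteSpace K]

/-- The index set of a fixed orthonormal (Hilbert) basis of `K`. -/
def basisIndex : Set K := (exists_hilbertBasis ℂ K).choose

/-- A fixed orthonormal (Hilbert) basis of `K`. -/
def basis : HilbertBasis (basisIndex K) ℂ K := (exists_hilbertBasis ℂ K).choose_spec.choose

variable {K}

/-- The canonical trace of a positive operator, with values in `[0, ∞]`. It is only used on
positive operators, where it does not depend on the orthonormal basis. -/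
def opTrace (z : Bd K) : ℝ≥0∞ :=
  ∑' i, ENNReal.ofReal (RCLike.re ⟪basis K i, z (basis K i)⟫_ℂ)

/-- Hilbert–Schmidt operators. -/
def IsHilbertSchmidt (a : Bd K) : Prop := Summable fun i => ‖a (basis K i)‖ ^ 2

/-- The Hilbert–Schmidt inner product `tr (a* b)`. -/
def hsInner (a b : Bd K) : ℂ := ∑' i, ⟪a (basis K i), b (basis K i)⟫_ℂ

/-- A map on `B(K)` is selfadjoint if it restricts to a selfadjoint operator of the Hilbert space
of Hilbert–Schmidt operators. -/
def IsSelfAdjointOnHS (T : Bd K →L[ℂ] Bd K) : Prop :=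
  ∀ a b : Bd K, IsHilbertSchmidt a → IsHilbertSchmidt b →
    IsHilbertSchmidt (T a) ∧ hsInner (T a) b = hsInner a (T b)

/-- Complete positivity, through Mathlib's notion. -/
def IsCompletelyPositive (T : Bd K →L[ℂ] Bd K) : Prop :=
  ∃ S : CompletelyPositiveMap (Bd K) (Bd K), ∀ z, S z = T z

/-- The von Neumann algebra generated by a set of operators (its bicommutant, the set being first
made stable under adjoints). -/
def generatedVN (s : Set (Bd K)) : VonNeumannAlgebra K where
  toStarSubalgebra := StarSubalgebra.centralizer ℂ (StarSubalgebra.centralizer ℂ s : Set (Bd K))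
  centralizer_centralizer' := by
    change Set.centralizer (Set.centralizer
      ((StarSubalgebra.centralizer ℂ (StarSubalgebra.centralizer ℂ s : Set (Bd K)) :
        StarSubalgebra ℂ (Bd K)) : Set (Bd K))) =
      ((StarSubalgebra.centralizer ℂ (StarSubalgebra.centralizer ℂ s : Set (Bd K)) :
        StarSubalgebra ℂ (Bd K)) : Set (Bd K))
    rw [StarSubalgebra.coe_centralizer_centralizer]
    simp

theorem subset_generatedVN (s : Set (Bd K)) {a : Bd K} (ha : a ∈ s) :
    a ∈ (generatedVN s).toStarSubalgebra :=
  StarAlgebra.adjoin_le_centralizer_centralizer ℂ s (StarAlgebra.subset_adjoin ℂ s ha)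

/-- The elements of a von Neumann algebra, as a *-algebra. -/
abbrev Elt (M : VonNeumannAlgebra K) : Type _ := M.toStarSubalgebra

/-- The weak* topology of a von Neumann algebra on `K`. -/
@[reducible] def weakStarVN (M : VonNeumannAlgebra K) : TopologicalSpace (Elt M) :=
  (weakStar K).induced Subtype.val

/-- A von Neumann algebra on `K` is injective if it is the range of a projection of norm at most
one defined on `B(K)`. -/
def IsInjectiveVN (M : VonNeumannAlgebra K) : Prop :=
  ∃ Φ : Bd K →L[ℂ] Bd K, (∀ x, ‖Φ x‖ ≤ ‖x‖) ∧ (∀ x, Φ x ∈ M.toStarSubalgebra) ∧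
    ∀ x ∈ M.toStarSubalgebra, Φ x = x

/-- Normal semifinite faithful traces. Only the values of `τ` on positive elements matter. -/
structure IsNSFTrace (M : VonNeumannAlgebra K) (τ : Elt M → ℝ≥0∞) : Prop where
  add : ∀ x y : Elt M, 0 ≤ (x : Bd K) → 0 ≤ (y : Bd K) → τ (x + y) = τ x + τ y
  smul : ∀ (c : ℝ≥0) (x : Elt M), 0 ≤ (x : Bd K) → τ ((c : ℂ) • x) = c * τ x
  trace : ∀ x : Elt M, τ (star x * x) = τ (x * star x)
  faithful : ∀ x : Elt M, 0 ≤ (x : Bd K) → τ x = 0 → x = 0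
  semifinite : ∀ x : Elt M, 0 ≤ (x : Bd K) → x ≠ 0 →
    ∃ y : Elt M, 0 ≤ (y : Bd K) ∧ (y : Bd K) ≤ x ∧ y ≠ 0 ∧ τ y < ∞
  normal : ∀ (s : Set (Elt M)) (x : Elt M), s.Nonempty → (∀ y ∈ s, 0 ≤ (y : Bd K)) →
    DirectedOn (· ≤ ·) s → IsLUB s x → τ x = ⨆ y ∈ s, τ y

variable {L : Type*} [NormedAddCommGroup L] [InnerProductSpace ℂ L] [CompleteSpace L]

/-- `J` is a normal, injective, trace preserving *-homomorphism from `B(L)` to `(M, τ)`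
(it is unital by its type). -/
structure IsTracePreservingEmbedding (M : VonNeumannAlgebra K) (τ : Elt M → ℝ≥0∞)
    (J : Bd L →⋆ₐ[ℂ] Elt M) : Prop where
  normal : Continuous[weakStar L, weakStarVN M] J
  injective : Function.Injective J
  trace : ∀ z : Bd L, 0 ≤ z → τ (J z) = opTrace z

/-- `E` is the trace preserving normal faithful conditional expectation from `M` onto `B(L)`,
where `B(L)` is seen inside `M` by means of `J`. -/
structure IsConditionalExpectation (M : VonNeumannAlgebra K) (τ : Elt M → ℝ≥0∞)
    (J : Bd L →⋆ₐ[ℂ] Elt M) (E : Elt M →ₗ[ℂ] Bd L) : Prop where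
  left_inv : ∀ z, E (J z) = z
  bimodule : ∀ (a b : Bd L) (m : Elt M), E (J a * m * J b) = a * E m * b
  pos : ∀ m : Elt M, 0 ≤ (m : Bd K) → 0 ≤ E m
  faithful : ∀ m : Elt M, 0 ≤ (m : Bd K) → E m = 0 → m = 0
  normal : Continuous[weakStarVN M, weakStar L] E
  trace : ∀ m : Elt M, 0 ≤ (m : Bd K) → opTrace (E m) = τ m

/-- A weak* continuous group of trace preserving *-automorphisms of `(M, τ)`. -/
structure IsTracePreservingGroup (M : VonNeumannAlgebra K) (τ : Elt M → ℝ≥0∞)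
    (U : ℝ → (Elt M ≃⋆ₐ[ℂ] Elt M)) : Prop where
  zero : ∀ m, U 0 m = m
  add : ∀ s t m, U (s + t) m = U s (U t m)
  normal : ∀ t, Continuous[weakStarVN M, weakStarVN M] (U t)
  continuous : ∀ m, Continuous[inferInstance, weakStarVN M] fun t => U t m
  trace : ∀ t (m : Elt M), 0 ≤ (m : Bd K) → τ (U t m) = τ m

/-- A weak* continuous semigroup of weak* continuous operators on `B(K)`. -/
structure IsWeakStarSemigroup (T : ℝ≥0 → (Bd K →L[ℂ] Bd K)) : Prop where
  zero : ∀ z, T 0 z = z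
  add : ∀ s t z, T (s + t) z = T s (T t z)
  normal : ∀ t, Continuous[weakStar K, weakStar K] (T t)
  continuous : ∀ z, Continuous[inferInstance, weakStar K] fun t => T t z

end Hilbert

/-! ### Hilbert–Schmidt operators with a kernel and measurable Schur multipliers -/

section Kernel

variable {X : Type*} [MeasurableSpace X] (μ : Measure X)

/-- The complex Hilbert space `L²(X)`. -/
abbrev L2 : Type _ := Lp ℂ 2 μ

variable {μ}

theorem lintegral_mul_le_L2 (f g : X → ℂ) (hf : AEStronglyMeasurable f μ)
    (hg : AEStronglyMeasurable g μ) :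
    ∫⁻ y, ‖f y * g y‖ₑ ∂μ ≤ (∫⁻ y, ‖f y‖ₑ ^ 2 ∂μ) ^ (1 / 2 : ℝ) * eLpNorm g 2 μ := by
  have h := ENNReal.lintegral_mul_le_Lp_mul_Lq μ Real.HolderConjugate.two_two hf.enorm hg.enorm
  have e : eLpNorm g 2 μ = (∫⁻ y, ‖g y‖ₑ ^ (2 : ℝ) ∂μ) ^ (1 / 2 : ℝ) := by
    rw [eLpNorm_eq_lintegral_rpow_enorm_toReal (by simp) (by simp)]; simp
  rw [e]
  simpa [enorm_mul] using h

variable [SFinite μ]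

theorem kernel_lintegral_lt_top (f : Lp ℂ 2 (μ.prod μ)) :
    ∫⁻ x, ∫⁻ y, ‖f (x, y)‖ₑ ^ 2 ∂μ ∂μ = eLpNorm f 2 (μ.prod μ) ^ 2 := by
  rw [eLpNorm_eq_lintegral_rpow_enorm_toReal (by simp) (by simp), ← ENNReal.rpow_natCast,
    ← ENNReal.rpow_mul]
  rw [lintegral_prod _ ((Lp.aestronglyMeasurable f).enorm.pow_const _)]
  simp

theorem kernel_ae_integrable (f : Lp ℂ 2 (μ.prod μ)) (ξ : L2 μ) :
    ∀ᵐ x ∂μ, Integrable (fun y => f (x, y) * ξ y) μ := by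
  have hlt : ∫⁻ x, ∫⁻ y, ‖f (x, y)‖ₑ ^ 2 ∂μ ∂μ ≠ ∞ := by
    rw [kernel_lintegral_lt_top]
    exact ENNReal.pow_ne_top (Lp.memLp f).2.ne
  have hm : AEMeasurable (fun x => ∫⁻ y, ‖f (x, y)‖ₑ ^ 2 ∂μ) μ :=
    ((Lp.aestronglyMeasurable f).enorm.pow_const _).lintegral_prod_right'
  filter_upwards [ae_lt_top' hm hlt, (Lp.aestronglyMeasurable f).prodMk_left] with x hx hfx
  refine ⟨hfx.mul (Lp.aestronglyMeasurable ξ), ?_⟩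
  refine (lintegral_mul_le_L2 _ _ hfx (Lp.aestronglyMeasurable ξ)).trans_lt ?_
  exact ENNReal.mul_lt_top (ENNReal.rpow_lt_top_of_nonneg (by norm_num) hx.ne) (Lp.memLp ξ).2

theorem kernel_eLpNorm_le (f : Lp ℂ 2 (μ.prod μ)) (ξ : L2 μ) :
    eLpNorm (fun x => ∫ y, f (x, y) * ξ y ∂μ) 2 μ ≤
      eLpNorm f 2 (μ.prod μ) * eLpNorm ξ 2 μ := by
  have key : ∫⁻ x, ‖∫ y, f (x, y) * ξ y ∂μ‖ₑ ^ 2 ∂μ ≤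
      (eLpNorm f 2 (μ.prod μ) * eLpNorm ξ 2 μ) ^ 2 := by
    rw [mul_pow, ← kernel_lintegral_lt_top, ← lintegral_mul_const'' _
      (((Lp.aestronglyMeasurable f).enorm.pow_const _).lintegral_prod_right')]
    refine lintegral_mono_ae ?_
    filter_upwards [(Lp.aestronglyMeasurable f).prodMk_left] with x hfx
    have h1 := (enorm_integral_le_lintegral_enorm (μ := μ) (fun y => f (x, y) * ξ y)).trans
      (lintegral_mul_le_L2 _ _ hfx (Lp.aestronglyMeasurable ξ))
    refine (pow_le_pow_left' h1 2).trans_eq ?_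
    rw [mul_pow, ← ENNReal.rpow_natCast, ← ENNReal.rpow_mul]
    simp
  rw [eLpNorm_eq_lintegral_rpow_enorm_toReal (by simp) (by simp)]
  refine (ENNReal.rpow_le_rpow (z := 1 / 2) (by simpa using key) (by norm_num)).trans_eq ?_
  rw [← ENNReal.rpow_natCast, ← ENNReal.rpow_mul]
  simp

theorem kernel_memLp (f : Lp ℂ 2 (μ.prod μ)) (ξ : L2 μ) :
    MemLp (fun x => ∫ y, f (x, y) * ξ y ∂μ) 2 μ :=
  ⟨((Lp.aestronglyMeasurable f).mul
      (Lp.aestronglyMeasurable ξ).comp_snd).integral_prod_right',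
    (kernel_eLpNorm_le f ξ).trans_lt (ENNReal.mul_lt_top (Lp.memLp f).2 (Lp.memLp ξ).2)⟩

/-- The Hilbert–Schmidt operator `K_f` on `L²(X)` with kernel `f ∈ L²(X × X)`, that is
`(K_f ξ)(x) = ∫ f(x, y) ξ(y) dy`. -/
def kernelOp (f : Lp ℂ 2 (μ.prod μ)) : Bd (L2 μ) :=
  LinearMap.mkContinuous
    { toFun := fun ξ => (kernel_memLp f ξ).toLp _
      map_add' := fun ξ η => by
        rw [← MemLp.toLp_add]
        refine MemLp.toLp_congr _ _ ?_
        filter_upwards [kernel_ae_integrable f ξ, kernel_ae_integrable f η] with x h1 h2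
        rw [Pi.add_apply, ← integral_add h1 h2]
        refine integral_congr_ae ?_
        filter_upwards [Lp.coeFn_add ξ η] with y hy
        rw [hy, Pi.add_apply, mul_add]
      map_smul' := fun c ξ => by
        rw [RingHom.id_apply, ← MemLp.toLp_const_smul]
        refine MemLp.toLp_congr _ _ (Filter.Eventually.of_forall fun x => ?_)
        change _ = c • ∫ y, f (x, y) * ξ y ∂μ
        rw [← integral_smul]
        refine integral_congr_ae ?_
        filter_upwards [Lp.coeFn_smul c ξ] with y hy
        rw [hy, Pi.smul_apply, smul_eq_mul, smul_eq_mul, mul_left_comm] }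
    ‖f‖ fun ξ => by
      change ‖(kernel_memLp f ξ).toLp _‖ ≤ _
      rw [Lp.norm_toLp, Lp.norm_def, Lp.norm_def, ← ENNReal.toReal_mul]
      exact ENNReal.toReal_mono
        (ENNReal.mul_ne_top (Lp.memLp f).2.ne (Lp.memLp ξ).2.ne) (kernel_eLpNorm_le f ξ)

theorem kernelOp_apply (f : Lp ℂ 2 (μ.prod μ)) (ξ : L2 μ) :
    kernelOp f ξ =ᵐ[μ] fun x => ∫ y, f (x, y) * ξ y ∂μ :=
  (kernel_memLp f ξ).coeFn_toLp

/-- `T` is the measurable Schur multiplier on `B(L²(X))` with symbol `φ`: the (class of the)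
function `φ` belongs to `L^∞(X × X)`, and `T` is the weak* continuous extension of the map
`K_f ↦ K_{φ f}`, `f ∈ L²(X × X)`. -/
structure IsSchurMultiplier (φ : X × X → ℂ) (T : Bd (L2 μ) →L[ℂ] Bd (L2 μ)) : Prop where
  memLp : MemLp φ ∞ (μ.prod μ)
  normal : Continuous[weakStar (L2 μ), weakStar (L2 μ)] T
  apply_kernelOp : ∀ f : Lp ℂ 2 (μ.prod μ),
    T (kernelOp f) = kernelOp ((memLp.toLp φ • f : Lp ℂ 2 (μ.prod μ)))

end Kernel

/-! ### The von Neumann algebra `L^∞(Ω) ⊗̄ B(L²(X))` -/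

section Tensor

variable {Ω : Type*} [MeasurableSpace Ω] (P : Measure Ω) {X : Type*} [MeasurableSpace X]
  (μ : Measure X)

/-- The Hilbert space `L²(Ω, L²(X))`. -/
abbrev L2L2 : Type _ := Lp (L2 μ) 2 P

variable {P}

/-- The operator `f ⊗ 1` of multiplication by `f ∈ L^∞(Ω)` on `L²(Ω, L²(X))`. -/
def mulOp (f : Lp ℂ ∞ P) : Bd (L2L2 P μ) :=
  (ContinuousLinearMap.lsmul ℂ ℂ).holderL P ∞ 2 2 f

variable (P) {μ}

/-- The operator `1 ⊗ z` on `L²(Ω, L²(X))`: `z` is applied pointwise. -/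
def ampOp (z : Bd (L2 μ)) : Bd (L2L2 P μ) := z.compLpL 2 P

variable (μ)

/-- The von Neumann algebra `L^∞(Ω) ⊗̄ B(L²(X))` acting on `L²(Ω, L²(X))`: it is generated by the
operators `f ⊗ 1` and `1 ⊗ z`. -/
def tensorVN : VonNeumannAlgebra (L2L2 P μ) :=
  generatedVN (Set.range (mulOp (P := P) μ) ∪ Set.range (ampOp P (μ := μ)))

variable {P}

/-- `f ⊗ 1` as an element of `L^∞(Ω) ⊗̄ B(L²(X))`. -/
def mulElt (f : Lp ℂ ∞ P) : Elt (tensorVN P μ) :=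
  ⟨mulOp μ f, subset_generatedVN _ (Or.inl ⟨f, rfl⟩)⟩

variable (P) [IsFiniteMeasure P]

/-- The embedding `ξ ↦ 1 ⊗ ξ` of `L²(X)` into `L²(Ω, L²(X))`. -/
def constEmb : L2 μ →L[ℂ] L2L2 P μ := Lp.constL 2 P ℂ

/-- The map `𝔼 = ∫_Ω ⊗ Id : L^∞(Ω) ⊗̄ B(L²(X)) → B(L²(X))`, given by
`⟪η, 𝔼(m) ξ⟫ = ⟪1 ⊗ η, m (1 ⊗ ξ)⟫`. -/
def meanExp : Elt (tensorVN P μ) →ₗ[ℂ] Bd (L2 μ) where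
  toFun m := (constEmb P μ).adjoint ∘L (m : Bd (L2L2 P μ)) ∘L constEmb P μ
  map_add' m n := by ext1 ξ; simp
  map_smul' c m := by ext1 ξ; simp

/-- The trace `∫_Ω ⊗ tr` on `L^∞(Ω) ⊗̄ B(L²(X))`. -/
def tensorTrace (m : Elt (tensorVN P μ)) : ℝ≥0∞ := opTrace (meanExp P μ m)

end Tensor

/-! ### Isonormal processes -/

section Gaussian

variable {Ω : Type*} [MeasurableSpace Ω] {P : Measure Ω}

/-- `W : G → L⁰(Ω)` is a `G`-isonormal process on the probability space `(Ω, P)`. -/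
structure IsIsonormal {G : Type*} [NormedAddCommGroup G] [InnerProductSpace ℝ G]
    (W : G →ₗ[ℝ] (Ω →ₘ[P] ℝ)) : Prop where
  gaussian : ∀ h : G, ∃ v : ℝ≥0, P.map (W h) = gaussianReal 0 v
  covariance : ∀ h₁ h₂ : G, ∫ ω, W h₁ ω * W h₂ ω ∂P = ⟪h₁, h₂⟫_ℝ
  dense : (Submodule.span ℝ
    {g : Lp ℝ 2 P | ∃ l : List G, (g : Ω →ₘ[P] ℝ) = (l.map W).prod}).topologicalClosure = ⊤

/-- The class in `L^∞(Ω)` of the function `exp(i Z)`, for a real random variable `Z`. -/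
def expI (Z : Ω →ₘ[P] ℝ) : Lp ℂ ∞ P :=
  MemLp.toLp (fun ω => Complex.exp (Complex.I * (Z ω : ℂ)))
    (memLp_top_of_bound
      (Complex.continuous_exp.comp_aestronglyMeasurable
        ((Complex.continuous_ofReal.comp_aestronglyMeasurable
          Z.aestronglyMeasurable).const_mul Complex.I)) 1
      (Filter.Eventually.of_forall fun ω => by
        rw [mul_comm, Complex.norm_exp_ofReal_mul_I]))

variable {H : Type*} [NormedAddCommGroup H]

/-- The vector `1_{[0,t]} ⊗ h` of `L²(ℝ, H)` if `t ≥ 0`, and `-1_{[t,0]} ⊗ h` if `t ≤ 0`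
(one of the two intervals below is always negligible). -/
def timeVec (t : ℝ) (h : H) : Lp H 2 (volume : Measure ℝ) :=
  indicatorConstLp 2 (measurableSet_Icc (a := (0 : ℝ)) (b := t)) measure_Icc_lt_top.ne h -
    indicatorConstLp 2 (measurableSet_Icc (a := t) (b := (0 : ℝ))) measure_Icc_lt_top.ne h

/-- The right shift `(S_t g)(s) = g(s - t)` on `L²(ℝ, H)`. -/
def shift (t : ℝ) (g : Lp H 2 (volume : Measure ℝ)) : Lp H 2 (volume : Measure ℝ) :=
  Lp.compMeasurePreserving (fun s : ℝ => s - t) (measurePreserving_sub_right volume t) g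

/-- `V` is the operator of multiplication by `(ω, x) ↦ exp(√2 i (W_t(α_x))(ω))` on
`L²(Ω, L²(X))`, where `W_t(h) = W(1_{[0,t]} ⊗ h)` if `t ≥ 0` and `W_t(h) = W(-1_{[t,0]} ⊗ h)`
if `t ≤ 0`. As `W_t(α_x)` is a class of functions for each `x`, a jointly measurable version `k` of
the multiplying function is used. -/
def IsGaussianMult [InnerProductSpace ℝ H] {X : Type*} [MeasurableSpace X] (μ : Measure X)
    (W : Lp H 2 (volume : Measure ℝ) →ₗ[ℝ] (Ω →ₘ[P] ℝ)) (α : X → H) (t : ℝ)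
    (V : Bd (L2L2 P μ)) : Prop :=
  ∃ k : Ω × X → ℂ, Measurable k ∧
    (∀ᵐ x ∂μ, ∀ᵐ ω ∂P,
      k (ω, x) = Complex.exp (Real.sqrt 2 * Complex.I * (W (timeVec t (α x)) ω : ℂ))) ∧
    ∀ F : L2L2 P μ, ∀ᵐ ω ∂P, ∀ᵐ x ∂μ, (V F) ω x = k (ω, x) * F ω x

end Gaussian

end SchurDilation

end

universe u v

open SchurDilation

noncomputable section

namespace SchurDilation

/-! ### The weak* topology -/

section WeakStar

variable {K L : Type*} [NormedAddCommGroup K] [InnerProductSpace ℂ K]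
  [NormedAddCommGroup L] [InnerProductSpace ℂ L]

/-! Let `W` be an isonormal process on `L²(ℝ, H)`. Since `1_{[0,t]} ⊗ h` has squared norm `t‖h‖²`,
the Gaussian characteristic function gives `∫ exp(√2 i (W_t(α_x) - W_t(α_y))) dP = exp(-t‖α_x -
α_y‖²)`. So the Schur multiplier with this symbol is an average of conjugations by random diagonal
unitaries: `T_t(z) = 𝔼(V_t (1 ⊗ z) V_t*)`, where `V_t` multiplies by `exp(√2 i W_t(α_x)(ω))`. Fubini
turns this into the kernel formula (`inner_expect_kernelOp`, `integral_phaseFun_mul_conj`).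
Unitality, normality and complete positivity are visible on the average. Selfadjointness and the
semigroup law are read on the symbols: every Hilbert–Schmidt operator is some `K_f`, on which `T_t`
multiplies `f` by a real function, and a weak* continuous map is determined by its values on rank
one operators (`eq_of_eq_rankOne`).

To obtain a group of automorphisms, the shift of `L²(ℝ, H)` is turned into a measure preserving flow
on `Ω`. The relation `1_{[0,s+t]} = 1_{[0,s]} + S_s 1_{[0,t]}` says that the phases form a cocycle
over this flow (`isCocycle`), so the operators "compose with the flow, then multiply by the phase"
form a one-parameter group of unitaries (`implOp_add`), strongly continuous by `continuous_implOp`.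
Conjugation by it is `U_t`. Composition with the flow commutes with every `1 ⊗ z`, so only the phase
is seen on `1 ⊗ z` (`auto_ampHom`).

The algebra `M` is handled through one fact, `mem_tensorVN_iff`: it is the commutant of `L^∞(Ω) ⊗
1`. Its elements thus behave as matrices with entries in functions on `Ω`, which gives the
properties of the trace. Stability of `M` under `U_t` follows because `L^∞(Ω) ⊗ 1` is normalised,
and injectivity follows by averaging over commuting symmetries.

Two measurability points remain. Pettis' theorem makes `α` almost everywhere strongly measurable
(`aestronglyMeasurable_of_inner`), and then `(ω, x) ↦ W_t(α_x)(ω)` has a jointly measurable version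
(`exists_jointVersion`). The space `Ω` is the path space `ℝ^G` with `G = L²(ℝ, H)`, so that the
shift acts on actual points. -/

theorem continuous_weakStar_rng {Z : Type*} {tZ : TopologicalSpace Z} {f : Z → Bd K} :
    Continuous[tZ, weakStar K] f ↔ ∀ p : lp (fun _ : ℕ => K) 2 × lp (fun _ : ℕ => K) 2,
      Continuous fun z => ∑' n, ⟪p.2 n, f z (p.1 n)⟫_ℂ := by
  simp only [continuous_iInf_rng, continuous_induced_rng]
  rfl

theorem tendsto_weakStar {Z : Type*} {l : Filter Z} {f : Z → Bd K} {x : Bd K} :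
    Filter.Tendsto f l (@nhds _ (weakStar K) x) ↔
      ∀ p : lp (fun _ : ℕ => K) 2 × lp (fun _ : ℕ => K) 2,
        Filter.Tendsto (fun z => ∑' n, ⟪p.2 n, f z (p.1 n)⟫_ℂ) l
          (𝓝 (∑' n, ⟪p.2 n, x (p.1 n)⟫_ℂ)) := by
  simp only [nhds_iInf, nhds_induced, Filter.tendsto_iInf, Filter.tendsto_comap_iff]
  rfl

theorem summable_norm_sq_lp {K : Type*} [NormedAddCommGroup K] (p : lp (fun _ : ℕ => K) 2) :
    Summable fun n => ‖p n‖ ^ 2 := by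
  simpa using (memℓp_gen_iff (p := 2) (by simp)).1 (lp.memℓp p)

theorem summable_mul_norm {ι : Type*} {a b : ι → ℝ} (ha : Summable fun i => a i ^ 2)
    (hb : Summable fun i => b i ^ 2) : Summable fun i => |a i| * |b i| := by
  refine Summable.of_nonneg_of_le (fun i => by positivity) (fun i => ?_) (ha.add hb)
  have := sq_nonneg (|a i| - |b i|)
  nlinarith [sq_abs (a i), sq_abs (b i), sq_nonneg (a i), sq_nonneg (b i)]

/-- The topology is defined with sequences, but any index type will do: a square-summable family has
countable support, so it can be moved into `ℕ` by an injection and extended by zero. -/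
theorem continuous_tsum_inner {ι : Type*} {ξ η : ι → K} (hξ : Summable fun i => ‖ξ i‖ ^ 2)
    (hη : Summable fun i => ‖η i‖ ^ 2) :
    Continuous[weakStar K, inferInstance] fun x : Bd K => ∑' i, ⟪η i, x (ξ i)⟫_ℂ := by
  classical
  set S : Set ι := Function.support fun i => ‖ξ i‖ ^ 2 with hS
  have hc : S.Countable := hξ.countable_support
  have := hc.to_subtype
  obtain ⟨e, he⟩ := exists_injective_nat S
  have key : ∀ ζ : ι → K, (Summable fun i => ‖ζ i‖ ^ 2) →
      Memℓp (Function.extend e (fun i : S => ζ i) 0) 2 := by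
    intro ζ hζ
    rw [memℓp_gen_iff (by simp)]
    have h1 : (fun n => ‖Function.extend e (fun i : S => ζ i) 0 n‖ ^ (2 : ℝ≥0∞).toReal) =
        Function.extend e (fun i : S => ‖ζ i‖ ^ 2) 0 := by
      funext n
      by_cases hn : ∃ i, e i = n
      · obtain ⟨i, rfl⟩ := hn
        simp [he.extend_apply]
      · simp [Function.extend_apply' _ _ _ hn]
    rw [h1]
    exact (summable_extend_zero he).2 (hζ.subtype _)
  let p : lp (fun _ : ℕ => K) 2 × lp (fun _ : ℕ => K) 2 :=
    (⟨_, key ξ hξ⟩, ⟨_, key η hη⟩)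
  have h2 : (fun x : Bd K => ∑' i, ⟪η i, x (ξ i)⟫_ℂ) =
      fun x : Bd K => ∑' n, ⟪p.2 n, x (p.1 n)⟫_ℂ := by
    funext x
    have h3 : (fun n => ⟪p.2 n, x (p.1 n)⟫_ℂ) =
        Function.extend e (fun i : S => ⟪η i, x (ξ i)⟫_ℂ) 0 := by
      funext n
      change ⟪Function.extend e (fun i : S => η i) 0 n,
        x (Function.extend e (fun i : S => ξ i) 0 n)⟫_ℂ = _
      by_cases hn : ∃ i, e i = n
      · obtain ⟨i, rfl⟩ := hn
        simp [he.extend_apply]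
      · simp [Function.extend_apply' _ _ _ hn]
    rw [h3, tsum_extend_zero he]
    -- Both families were cut down to the support of `ξ`. Nothing is lost, since the other terms
    -- contain `x 0 = 0`.
    refine (tsum_subtype_eq_of_support_subset (f := fun i => ⟪η i, x (ξ i)⟫_ℂ) ?_).symm
    intro i hi
    by_contra h
    have : ξ i = 0 := by simpa [hS] using h
    exact hi (by simp [this])
  rw [h2]
  exact continuous_weakStar_rng.1 (@continuous_id _ (weakStar K)) p

theorem continuous_inner_weakStar (ξ η : K) :
    Continuous[weakStar K, inferInstance] fun x : Bd K => ⟪η, x ξ⟫_ℂ := by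
  have := continuous_tsum_inner (K := K) (ι := Unit) (ξ := fun _ => ξ) (η := fun _ => η)
    (Summable.of_finite) (Summable.of_finite)
  simpa using this

/-- Normality of amplifications. If the maps `E j` decompose `K` into copies of `L` on which `π z`
acts as `z`, a functional given by two sequences pulls back to the one given by the doubly indexed
families `E j (p n)`, square-summable by Parseval. -/
theorem continuous_weakStar_of_hasSum [CompleteSpace K] {ι : Type*}
    (E : ι → K →L[ℂ] L) (hE : ∀ F, HasSum (fun j => ‖E j F‖ ^ 2) (‖F‖ ^ 2))
    (π : Bd L → Bd K) (hπ : ∀ z F G, HasSum (fun j => ⟪E j F, z (E j G)⟫_ℂ) ⟪F, π z G⟫_ℂ) :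
    Continuous[weakStar L, weakStar K] π := by
  refine continuous_weakStar_rng.2 fun p => ?_
  have hs : ∀ q : lp (fun _ : ℕ => K) 2, Summable fun i : ℕ × ι => ‖E i.2 (q i.1)‖ ^ 2 := by
    intro q
    rw [summable_prod_of_nonneg (fun _ => by positivity)]
    exact ⟨fun n => (hE (q n)).summable, by
      simpa only [(hE _).tsum_eq] using summable_norm_sq_lp q⟩
  have h2 : (fun z : Bd L => ∑' n, ⟪p.2 n, π z (p.1 n)⟫_ℂ) =
      fun z => ∑' i : ℕ × ι, ⟪E i.2 (p.2 i.1), z (E i.2 (p.1 i.1))⟫_ℂ := by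
    funext z
    have hsum : Summable fun i : ℕ × ι => ⟪E i.2 (p.2 i.1), z (E i.2 (p.1 i.1))⟫_ℂ := by
      refine Summable.of_norm_bounded (g := fun i : ℕ × ι =>
        ‖z‖ * (|‖E i.2 (p.2 i.1)‖| * |‖E i.2 (p.1 i.1)‖|))
        ((summable_mul_norm (hs p.2) (hs p.1)).mul_left _) fun i => ?_
      rw [abs_norm, abs_norm]
      calc _ ≤ ‖E i.2 (p.2 i.1)‖ * ‖z (E i.2 (p.1 i.1))‖ := norm_inner_le_norm _ _
        _ ≤ ‖E i.2 (p.2 i.1)‖ * (‖z‖ * ‖E i.2 (p.1 i.1)‖) := by gcongr; exact z.le_opNorm _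
        _ = _ := by ring
    rw [hsum.tsum_prod]
    exact tsum_congr fun n => ((hπ z _ _).tsum_eq).symm
  rw [h2]
  exact continuous_tsum_inner (hs p.1) (hs p.2)

theorem continuous_weakStar_comp [CompleteSpace K] [CompleteSpace L] (B : K →L[ℂ] L)
    (C : L →L[ℂ] K) :
    Continuous[weakStar K, weakStar L] fun z : Bd K => (B ∘L z ∘L C : Bd L) := by
  refine continuous_weakStar_rng.2 fun p => ?_
  have hs : ∀ (A : L →L[ℂ] K) (q : lp (fun _ : ℕ => L) 2), Summable fun n => ‖A (q n)‖ ^ 2 := by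
    intro A q
    refine Summable.of_nonneg_of_le (fun _ => by positivity) (fun n => ?_)
      ((summable_norm_sq_lp q).mul_left (‖A‖ ^ 2))
    rw [← mul_pow]
    gcongr
    exact A.le_opNorm _
  have h2 : (fun z : Bd K => ∑' n, ⟪p.2 n, (B ∘L z ∘L C) (p.1 n)⟫_ℂ) =
      fun z => ∑' n, ⟪B.adjoint (p.2 n), z (C (p.1 n))⟫_ℂ := by
    funext z
    refine tsum_congr fun n => ?_
    simp [ContinuousLinearMap.adjoint_inner_left]
  rw [h2]
  exact continuous_tsum_inner (hs C p.1) (hs B.adjoint p.2)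

/-- Each term depends continuously on `t` through the adjoints alone, and contractivity supplies a
summable bound independent of `t`. -/
theorem continuous_weakStar_conj [CompleteSpace K] {Z : Type*} [TopologicalSpace Z]
    {A : Z → Bd K} (hA : ∀ ξ, Continuous fun t => star (A t) ξ) (hn : ∀ t, ‖A t‖ ≤ 1) (m : Bd K) :
    Continuous[inferInstance, weakStar K] fun t => A t * m * star (A t) := by
  refine continuous_weakStar_rng.2 fun p => ?_
  have h1 : ∀ t n, ⟪p.2 n, (A t * m * star (A t)) (p.1 n)⟫_ℂ =
      ⟪star (A t) (p.2 n), m (star (A t) (p.1 n))⟫_ℂ := by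
    intro t n
    rw [ContinuousLinearMap.star_eq_adjoint, ContinuousLinearMap.adjoint_inner_left]
    rfl
  simp only [h1]
  refine continuous_tsum (u := fun n => ‖m‖ * (|‖p.2 n‖| * |‖p.1 n‖|)) (fun n => ?_)
    ((summable_mul_norm (summable_norm_sq_lp p.2) (summable_norm_sq_lp p.1)).mul_left _) ?_
  · exact (hA _).inner (m.continuous.comp (hA _))
  · intro n t
    have hb : ∀ ξ, ‖star (A t) ξ‖ ≤ ‖ξ‖ := fun ξ => by
      refine ((star (A t)).le_opNorm ξ).trans ?_
      rw [norm_star]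
      exact mul_le_of_le_one_left (norm_nonneg _) (hn t)
    rw [abs_norm, abs_norm]
    calc _ ≤ ‖star (A t) (p.2 n)‖ * ‖m (star (A t) (p.1 n))‖ := norm_inner_le_norm _ _
      _ ≤ ‖p.2 n‖ * (‖m‖ * ‖p.1 n‖) := by
        gcongr
        · exact hb _
        · exact (m.le_opNorm _).trans (by gcongr; exact hb _)
      _ = _ := by ring

/-- The partial sums are `z` composed with finite rank projections. They converge strongly and, by
Bessel, boundedly, so dominated convergence applies to every functional. -/
theorem tendsto_weakStar_basis {ι : Type*} (b : HilbertBasis ι ℂ K) (z : Bd K) :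
    Filter.Tendsto (fun s : Finset ι => ∑ i ∈ s, InnerProductSpace.rankOne ℂ (z (b i)) (b i))
      Filter.atTop (@nhds _ (weakStar K) z) := by
  refine tendsto_weakStar.2 fun p => ?_
  have happ : ∀ (s : Finset ι) (ξ : K), (∑ i ∈ s, InnerProductSpace.rankOne ℂ (z (b i)) (b i)) ξ =
      z (∑ i ∈ s, ⟪b i, ξ⟫_ℂ • b i) := by
    intro s ξ
    simp
  have hle : ∀ (s : Finset ι) (ξ : K), ‖∑ i ∈ s, ⟪b i, ξ⟫_ℂ • b i‖ ≤ ‖ξ‖ := by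
    intro s ξ
    refine abs_le_of_sq_le_sq' ?_ (norm_nonneg _) |>.2
    have h := b.orthonormal.sum_inner_products_le ξ (s := s)
    refine le_trans (le_of_eq ?_) h
    have h2 := b.orthonormal.inner_sum (fun i => ⟪b i, ξ⟫_ℂ) (fun i => ⟪b i, ξ⟫_ℂ) s
    rw [inner_self_eq_norm_sq_to_K] at h2
    have h3 : ((‖∑ i ∈ s, ⟪b i, ξ⟫_ℂ • b i‖ ^ 2 : ℝ) : ℂ) =
        ((∑ i ∈ s, ‖⟪b i, ξ⟫_ℂ‖ ^ 2 : ℝ) : ℂ) := by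
      push_cast
      refine h2.trans (Finset.sum_congr rfl fun i _ => ?_)
      rw [RCLike.conj_mul]
      rfl
    exact_mod_cast h3
  refine tendsto_tsum_of_dominated_convergence (bound := fun n => ‖z‖ * (|‖p.2 n‖| * |‖p.1 n‖|))
    ((summable_mul_norm (summable_norm_sq_lp p.2) (summable_norm_sq_lp p.1)).mul_left _) ?_ ?_
  · intro n
    simp only [happ]
    refine (tendsto_const_nhds.inner ((z.continuous.tendsto _).comp ?_))
    have := b.hasSum_repr (p.1 n)
    simpa only [HasSum, b.repr_apply_apply, SummationFilter.unconditional_filter] using this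
  · refine Filter.Eventually.of_forall fun s n => ?_
    rw [happ, abs_norm, abs_norm]
    calc _ ≤ ‖p.2 n‖ * ‖z (∑ i ∈ s, ⟪b i, p.1 n⟫_ℂ • b i)‖ := norm_inner_le_norm _ _
      _ ≤ ‖p.2 n‖ * (‖z‖ * ‖p.1 n‖) := by
        gcongr
        exact (z.le_opNorm _).trans (by gcongr; exact hle _ _)
      _ = _ := by ring

/-- Weak* continuous linear maps which agree on operators of rank one are equal. -/
theorem eq_of_eq_rankOne [CompleteSpace K] {S T : Bd K →ₗ[ℂ] Bd L}
    (hS : Continuous[weakStar K, weakStar L] S) (hT : Continuous[weakStar K, weakStar L] T)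
    (h : ∀ u v : K, S (InnerProductSpace.rankOne ℂ u v) = T (InnerProductSpace.rankOne ℂ u v)) :
    S = T := by
  refine LinearMap.ext fun z => ContinuousLinearMap.ext fun ξ => ext_inner_left ℂ fun η => ?_
  have key : ∀ R : Bd K →ₗ[ℂ] Bd L, Continuous[weakStar K, weakStar L] R →
      Filter.Tendsto (fun s : Finset (basisIndex K) =>
        ⟪η, R (∑ i ∈ s, InnerProductSpace.rankOne ℂ (z (basis K i)) (basis K i)) ξ⟫_ℂ)
        Filter.atTop (𝓝 ⟪η, R z ξ⟫_ℂ) := by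
    intro R hR
    have h1 : Continuous[weakStar K, inferInstance] fun x => ⟪η, R x ξ⟫_ℂ :=
      @Continuous.comp _ _ _ (weakStar K) (weakStar L) _ _ _ (continuous_inner_weakStar ξ η) hR
    have h2 := @Continuous.tendsto _ _ (weakStar K) _ _ h1 z
    exact h2.comp (tendsto_weakStar_basis (basis K) z)
  have h1 := key S hS
  have h2 := key T hT
  simp only [map_sum, h] at h1 h2
  exact tendsto_nhds_unique h1 h2

end WeakStar

/-! ### Positive operators -/

section Positive

variable {K : Type*} [NormedAddCommGroup K] [InnerProductSpace ℂ K]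

theorem re_inner_nonneg {x : Bd K} (hx : 0 ≤ x) (ξ : K) : 0 ≤ RCLike.re ⟪ξ, x ξ⟫_ℂ :=
  ((ContinuousLinearMap.nonneg_iff_isPositive x).1 hx).re_inner_nonneg_right ξ

theorem re_inner_mono {x y : Bd K} (h : x ≤ y) (ξ : K) :
    RCLike.re ⟪ξ, x ξ⟫_ℂ ≤ RCLike.re ⟪ξ, y ξ⟫_ℂ := by
  have := ((ContinuousLinearMap.le_def x y).1 h).re_inner_nonneg_right ξ
  simp only [sub_apply, inner_sub_right, map_sub] at this
  linarith

variable [CompleteSpace K]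

/-- The last clause keeps the square root inside any commutant that contains `x`, because the
functional calculus commutes with whatever commutes with `x`. -/
theorem exists_sqrt {x : Bd K} (hx : 0 ≤ x) :
    ∃ r : Bd K, 0 ≤ r ∧ star r = r ∧ r * r = x ∧ ∀ c, Commute x c → Commute r c := by
  refine ⟨CFC.sqrt x, CFC.sqrt_nonneg x, (CFC.sqrt_nonneg x).isSelfAdjoint,
    CFC.sqrt_mul_sqrt_self x hx, fun c hc => ?_⟩
  exact hc.cfcₙ_nnreal _

theorem nonneg_of_re_inner {x : Bd K} (hs : IsSelfAdjoint x)
    (h : ∀ ξ, 0 ≤ RCLike.re ⟪ξ, x ξ⟫_ℂ) : 0 ≤ x := by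
  rw [ContinuousLinearMap.nonneg_iff_isPositive, ContinuousLinearMap.isPositive_def']
  refine ⟨hs, fun ξ => ?_⟩
  rw [ContinuousLinearMap.reApplyInnerSelf_apply, ← inner_conj_symm, RCLike.conj_re]
  exact h ξ

/-- With `x = r²`, this is `‖r(rξ)‖² ≤ ‖r‖²‖rξ‖²`. It upgrades convergence of the quadratic forms of
a monotone net to strong convergence. -/
theorem norm_apply_sq_le {x : Bd K} (hx : 0 ≤ x) (ξ : K) :
    ‖x ξ‖ ^ 2 ≤ ‖x‖ * RCLike.re ⟪ξ, x ξ⟫_ℂ := by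
  obtain ⟨r, -, hr, hrr, -⟩ := exists_sqrt hx
  have h1 : RCLike.re ⟪ξ, x ξ⟫_ℂ = ‖r ξ‖ ^ 2 := by
    rw [← hrr]
    change RCLike.re ⟪ξ, r (r ξ)⟫_ℂ = _
    rw [← ContinuousLinearMap.adjoint_inner_left, ← ContinuousLinearMap.star_eq_adjoint, hr,
      inner_self_eq_norm_sq]
  have h2 : ‖x‖ = ‖r‖ ^ 2 := by
    rw [← hrr, sq, ← CStarRing.norm_star_mul_self, hr]
  have h3 : x ξ = r (r ξ) := by rw [← hrr]; rfl
  rw [h1, h2, h3, ← mul_pow]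
  gcongr
  exact r.le_opNorm _

/-- A directed set of positive operators which is bounded above has a supremum, which is its strong
limit. -/
theorem exists_isLUB_of_directedOn {s : Set (Bd K)} (hne : s.Nonempty) (hd : DirectedOn (· ≤ ·) s)
    (h0 : ∀ a ∈ s, 0 ≤ a) {x : Bd K} (hx : x ∈ upperBounds s) :
    ∃ y : Bd K, IsLUB s y ∧ (∀ c, (∀ a ∈ s, Commute a c) → Commute y c) ∧
      ∀ ξ, ENNReal.ofReal (RCLike.re ⟪ξ, y ξ⟫_ℂ) =
        ⨆ a : s, ENNReal.ofReal (RCLike.re ⟪ξ, (a : Bd K) ξ⟫_ℂ) := by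
  have : Nonempty s := hne.to_subtype
  have hd' : IsDirectedOrder s := directedOn_iff_isDirectedOrder.1 hd
  have hbd : ∀ a b : s, a ≤ b → ‖(b : Bd K) - a‖ ≤ ‖x‖ := by
    intro a b hab
    refine CStarAlgebra.norm_le_norm_of_nonneg_of_le (sub_nonneg.2 hab) ?_
    exact (sub_le_self _ (h0 a a.2)).trans (hx b.2)
  have hmono : ∀ ξ, Monotone fun a : s => RCLike.re ⟪ξ, (a : Bd K) ξ⟫_ℂ :=
    fun ξ a b hab => re_inner_mono hab ξ
  have hbdd : ∀ ξ, BddAbove (Set.range fun a : s => RCLike.re ⟪ξ, (a : Bd K) ξ⟫_ℂ) := by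
    intro ξ
    refine ⟨RCLike.re ⟪ξ, x ξ⟫_ℂ, ?_⟩
    rintro _ ⟨a, rfl⟩
    exact re_inner_mono (hx a.2) ξ
  have hq : ∀ ξ, Filter.Tendsto (fun a : s => RCLike.re ⟪ξ, (a : Bd K) ξ⟫_ℂ) Filter.atTop
      (𝓝 (⨆ a : s, RCLike.re ⟪ξ, (a : Bd K) ξ⟫_ℂ)) := fun ξ =>
    tendsto_atTop_ciSup (hmono ξ) (hbdd ξ)
  have hcau : ∀ ξ, ∃ v, Filter.Tendsto (fun a : s => (a : Bd K) ξ) Filter.atTop (𝓝 v) := by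
    intro ξ
    refine cauchy_map_iff_exists_tendsto.1 ?_
    have hc := (hq ξ).cauchy_map
    rw [Metric.cauchy_iff] at hc ⊢
    refine ⟨inferInstance, fun ε hε => ?_⟩
    -- The squared distance will be at most `‖x‖ + 1` times the increment of the quadratic form, so
    -- this threshold yields `(ε/2)²`; the `+ 1` only avoids dividing by zero.
    obtain ⟨t, ht, hte⟩ := hc.2 (ε ^ 2 / (4 * (‖x‖ + 1))) (by positivity)
    rw [Filter.mem_map, Filter.mem_atTop_sets] at ht
    obtain ⟨a, ha⟩ := ht
    refine ⟨(fun b : s => (b : Bd K) ξ) '' Set.Ici a, Filter.image_mem_map (Filter.mem_atTop a), ?_⟩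
    have key : ∀ b : s, a ≤ b → dist ((b : Bd K) ξ) ((a : Bd K) ξ) < ε / 2 := by
      intro b hab
      have h1 := norm_apply_sq_le (sub_nonneg.2 (show (a : Bd K) ≤ b from hab)) ξ
      have h2 := hte _ (ha b hab) _ (ha a le_rfl)
      rw [Real.dist_eq] at h2
      have h3 := le_abs_self (RCLike.re ⟪ξ, (b : Bd K) ξ⟫_ℂ - RCLike.re ⟪ξ, (a : Bd K) ξ⟫_ℂ)
      simp only [sub_apply, inner_sub_right, map_sub] at h1
      rw [dist_eq_norm]
      refine lt_of_pow_lt_pow_left₀ 2 (by positivity) (h1.trans_lt ?_)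
      have h4 : 0 ≤ RCLike.re ⟪ξ, (b : Bd K) ξ⟫_ℂ - RCLike.re ⟪ξ, (a : Bd K) ξ⟫_ℂ :=
        sub_nonneg.2 (hmono ξ hab)
      calc _ ≤ (‖x‖ + 1) * (RCLike.re ⟪ξ, (b : Bd K) ξ⟫_ℂ - RCLike.re ⟪ξ, (a : Bd K) ξ⟫_ℂ) := by
            gcongr
            linarith [hbd a b hab]
        _ < (‖x‖ + 1) * (ε ^ 2 / (4 * (‖x‖ + 1))) := by
            have : 0 < ‖x‖ + 1 := by positivity
            gcongr
            linarith
        _ = (ε / 2) ^ 2 := by field_simp; ring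
    rintro _ ⟨b, hb, rfl⟩ _ ⟨c, hc, rfl⟩
    calc _ ≤ dist ((b : Bd K) ξ) ((a : Bd K) ξ) + dist ((c : Bd K) ξ) ((a : Bd K) ξ) :=
          dist_triangle_right _ _ _
      _ < ε / 2 + ε / 2 := add_lt_add (key b hb) (key c hc)
      _ = ε := by ring
  choose f hf using hcau
  have hnorm : ∀ a : s, ‖(a : Bd K)‖ ≤ ‖x‖ := fun a =>
    CStarAlgebra.norm_le_norm_of_nonneg_of_le (h0 a a.2) (hx a.2)
  let y : Bd K := ContinuousLinearMap.ofTendstoOfBoundedRange f (fun a : s => (a : Bd K))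
    (tendsto_pi_nhds.2 hf)
    (isBounded_iff_forall_norm_le.2 ⟨‖x‖, by rintro _ ⟨a, rfl⟩; exact hnorm a⟩)
  have hy : ∀ ξ, Filter.Tendsto (fun a : s => (a : Bd K) ξ) Filter.atTop (𝓝 (y ξ)) := hf
  have hyq : ∀ ξ, RCLike.re ⟪ξ, y ξ⟫_ℂ = ⨆ a : s, RCLike.re ⟪ξ, (a : Bd K) ξ⟫_ℂ := fun ξ =>
    tendsto_nhds_unique ((RCLike.continuous_re.tendsto _).comp (tendsto_const_nhds.inner (hy ξ)))
      (hq ξ)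
  have hsa : IsSelfAdjoint y := by
    rw [ContinuousLinearMap.isSelfAdjoint_iff_isSymmetric]
    intro ξ η
    have h1 : Filter.Tendsto (fun a : s => ⟪(a : Bd K) ξ, η⟫_ℂ) Filter.atTop (𝓝 ⟪y ξ, η⟫_ℂ) :=
      (hy ξ).inner tendsto_const_nhds
    have h2 : Filter.Tendsto (fun a : s => ⟪ξ, (a : Bd K) η⟫_ℂ) Filter.atTop (𝓝 ⟪ξ, y η⟫_ℂ) :=
      tendsto_const_nhds.inner (hy η)
    refine tendsto_nhds_unique h1 (h2.congr fun a => ?_)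
    have := (h0 a a.2).isSelfAdjoint
    rw [ContinuousLinearMap.isSelfAdjoint_iff_isSymmetric] at this
    exact (this ξ η).symm
  refine ⟨y, ⟨fun a ha => ?_, fun b hb => ?_⟩, fun c hc => ?_, fun ξ => ?_⟩
  · rw [← sub_nonneg]
    refine nonneg_of_re_inner (hsa.sub (h0 a ha).isSelfAdjoint) fun ξ => ?_
    simp only [sub_apply, inner_sub_right, map_sub, hyq ξ]
    exact sub_nonneg.2 (le_ciSup (hbdd ξ) ⟨a, ha⟩)
  · have hbs : IsSelfAdjoint b := by
      obtain ⟨a, ha⟩ := hne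
      exact ((h0 a ha).trans (hb ha)).isSelfAdjoint
    rw [← sub_nonneg]
    refine nonneg_of_re_inner (hbs.sub hsa) fun ξ => ?_
    simp only [sub_apply, inner_sub_right, map_sub, hyq ξ]
    exact sub_nonneg.2 (ciSup_le fun a => re_inner_mono (hb a.2) ξ)
  · refine ContinuousLinearMap.ext fun ξ => ?_
    refine tendsto_nhds_unique (hy (c ξ)) ?_
    refine ((c.continuous.tendsto _).comp (hy ξ)).congr fun a => ?_
    exact (DFunLike.congr_fun (hc a a.2) ξ).symm
  · rw [hyq]
    have h1 := (ENNReal.continuous_ofReal.tendsto _).comp (hq ξ)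
    refine tendsto_nhds_unique h1 (tendsto_atTop_iSup fun a b hab => ?_)
    exact ENNReal.ofReal_le_ofReal (hmono ξ hab)

end Positive

/-! ### Hilbert sums -/

section HilbertSum

variable {K : Type*} [NormedAddCommGroup K] [InnerProductSpace ℂ K] [CompleteSpace K]
  {G : Type*} [NormedAddCommGroup G] [InnerProductSpace ℂ G] [CompleteSpace G]

/-- The `V i` are isometries with orthogonal ranges spanning a dense subspace, so `K` is the Hilbert
sum of copies of `G`, with the adjoints as coordinate maps. -/
theorem hasSum_inner_adjoint {ι : Type*} [DecidableEq ι] (V : ι → G →L[ℂ] K)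
    (hV : ∀ i j x y, ⟪V i x, V j y⟫_ℂ = if i = j then ⟪x, y⟫_ℂ else 0)
    (htot : ∀ F, (∀ i x, ⟪V i x, F⟫_ℂ = 0) → F = 0) (F F' : K) :
    HasSum (fun i => ⟪(V i).adjoint F, (V i).adjoint F'⟫_ℂ) ⟪F, F'⟫_ℂ := by
  let V' : ι → G →ₗᵢ[ℂ] K := fun i => (V i).toLinearMap.isometryOfInner fun x y => by
    have := hV i i x y
    simpa using this
  have ho : OrthogonalFamily ℂ (fun _ => G) V' := fun i j hij x y => by
    have := hV i j x y
    rwa [if_neg hij] at this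
  have hs : IsHilbertSum ℂ (fun _ => G) V' := by
    refine IsHilbertSum.mk ho ?_
    rw [top_le_iff, Submodule.topologicalClosure_eq_top_iff, Submodule.eq_bot_iff]
    intro F hF
    refine htot F fun i x => ?_
    exact (Submodule.mem_orthogonal _ _).1 hF _
      (Submodule.mem_iSup_of_mem i (LinearMap.mem_range_self (V' i).toLinearMap x))
  have hcomp : ∀ (F : K) (i : ι), (V i).adjoint F = hs.linearIsometryEquiv F i := by
    intro F i
    refine ext_inner_left ℂ fun x => ?_
    rw [ContinuousLinearMap.adjoint_inner_right]
    have h1 : V i x = hs.linearIsometryEquiv.symm (lp.single 2 i x) :=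
      (hs.linearIsometryEquiv_symm_apply_single x).symm
    rw [h1, ← LinearIsometryEquiv.inner_map_map hs.linearIsometryEquiv,
      LinearIsometryEquiv.apply_symm_apply, lp.inner_single_left]
  simp only [hcomp]
  rw [← LinearIsometryEquiv.inner_map_map hs.linearIsometryEquiv F F']
  exact lp.hasSum_inner _ _

theorem hasSum_norm_sq_adjoint {ι : Type*} [DecidableEq ι] (V : ι → G →L[ℂ] K)
    (hV : ∀ i j x y, ⟪V i x, V j y⟫_ℂ = if i = j then ⟪x, y⟫_ℂ else 0)
    (htot : ∀ F, (∀ i x, ⟪V i x, F⟫_ℂ = 0) → F = 0) (F : K) :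
    HasSum (fun i => ‖(V i).adjoint F‖ ^ 2) (‖F‖ ^ 2) := by
  have h := hasSum_inner_adjoint V hV htot F F
  simp only [inner_self_eq_norm_sq_to_K] at h
  exact_mod_cast h

end HilbertSum

/-! ### Elementary operators on `L²(Ω, L²(X))` -/

section Elementary

variable {Ω : Type*} [MeasurableSpace Ω] {P : Measure Ω} {X : Type*} [MeasurableSpace X]
  {μ : Measure X}

theorem mulOp_apply (f : Lp ℂ ∞ P) (F : L2L2 P μ) :
    mulOp μ f F =ᵐ[P] fun ω => f ω • F ω :=
  ContinuousLinearMap.coeFn_holder _ _ _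

theorem ampOp_apply (z : Bd (L2 μ)) (F : L2L2 P μ) : ampOp P z F =ᵐ[P] fun ω => z (F ω) :=
  ContinuousLinearMap.coeFn_compLpL _ _

theorem constEmb_apply [IsFiniteMeasure P] (ξ : L2 μ) : constEmb P μ ξ =ᵐ[P] fun _ => ξ :=
  Lp.coeFn_const _ _ _

variable (P μ) in
/-- The elementary tensor `f ⊗ ξ`. -/
def tens : L2 μ →L[ℂ] Lp ℂ 2 P →L[ℂ] L2L2 P μ :=
  LinearMap.mkContinuous₂
    (LinearMap.mk₂ ℂ (fun ξ f => (ContinuousLinearMap.toSpanSingleton ℂ ξ).compLpL 2 P f)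
      (fun ξ η f => by
        refine Lp.ext ?_
        filter_upwards [ContinuousLinearMap.coeFn_compLpL
            (ContinuousLinearMap.toSpanSingleton ℂ (ξ + η)) f,
          ContinuousLinearMap.coeFn_compLpL (ContinuousLinearMap.toSpanSingleton ℂ ξ) f,
          ContinuousLinearMap.coeFn_compLpL (ContinuousLinearMap.toSpanSingleton ℂ η) f,
          Lp.coeFn_add ((ContinuousLinearMap.toSpanSingleton ℂ ξ).compLpL 2 P f)
            ((ContinuousLinearMap.toSpanSingleton ℂ η).compLpL 2 P f)] with ω h1 h2 h3 h4
        rw [h1, h4, Pi.add_apply, h2, h3]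
        simp)
      (fun c ξ f => by
        refine Lp.ext ?_
        filter_upwards [ContinuousLinearMap.coeFn_compLpL
            (ContinuousLinearMap.toSpanSingleton ℂ (c • ξ)) f,
          ContinuousLinearMap.coeFn_compLpL (ContinuousLinearMap.toSpanSingleton ℂ ξ) f,
          Lp.coeFn_smul c ((ContinuousLinearMap.toSpanSingleton ℂ ξ).compLpL 2 P f)]
          with ω h1 h2 h4
        rw [h1, h4, Pi.smul_apply, h2]
        simp only [ContinuousLinearMap.toSpanSingleton_apply]
        exact smul_comm _ _ _)
      (fun ξ f g => map_add _ _ _) (fun c ξ f => map_smul _ _ _)) 1 fun ξ f => by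
        rw [one_mul]
        refine (ContinuousLinearMap.le_opNorm _ _).trans ?_
        gcongr
        refine (ContinuousLinearMap.norm_compLpL_le _).trans ?_
        simp

theorem tens_apply (ξ : L2 μ) (f : Lp ℂ 2 P) : tens P μ ξ f =ᵐ[P] fun ω => f ω • ξ :=
  ContinuousLinearMap.coeFn_compLpL (ContinuousLinearMap.toSpanSingleton ℂ ξ) f

theorem inner_tens_tens (ξ η : L2 μ) (f g : Lp ℂ 2 P) :
    ⟪tens P μ ξ f, tens P μ η g⟫_ℂ = ⟪ξ, η⟫_ℂ * ⟪f, g⟫_ℂ := by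
  rw [L2.inner_def (𝕜 := ℂ) (tens P μ ξ f), L2.inner_def (𝕜 := ℂ) f, ← integral_const_mul]
  refine integral_congr_ae ?_
  filter_upwards [tens_apply ξ f, tens_apply η g] with ω h1 h2
  rw [h1, h2, inner_smul_left, inner_smul_right, RCLike.inner_apply]
  ring

section Finite

variable [IsFiniteMeasure P]

variable (P) in
/-- The indicator function of a set, in `L^∞(Ω)`. -/
def indTop {s : Set Ω} (hs : MeasurableSet s) : Lp ℂ ∞ P :=
  indicatorConstLp ∞ hs (measure_ne_top P s) 1

variable (P) in
/-- The indicator function of a set, in `L²(Ω)`. -/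
def indTwo {s : Set Ω} (hs : MeasurableSet s) : Lp ℂ 2 P :=
  indicatorConstLp 2 hs (measure_ne_top P s) 1

/-- Because of this identity, an operator commuting with `L^∞(Ω) ⊗ 1` is determined by its values on
the constant functions `1 ⊗ ξ`. -/
theorem mulOp_indTop_constEmb {s : Set Ω} (hs : MeasurableSet s) (ξ : L2 μ) :
    mulOp μ (indTop P hs) (constEmb P μ ξ) = tens P μ ξ (indTwo P hs) := by
  refine Lp.ext ?_
  filter_upwards [mulOp_apply (indTop P hs) (constEmb P μ ξ), constEmb_apply (P := P) ξ,
    tens_apply ξ (indTwo P hs),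
    indicatorConstLp_coeFn (p := ∞) (hs := hs) (hμs := measure_ne_top P s) (c := (1 : ℂ)),
    indicatorConstLp_coeFn (p := 2) (hs := hs) (hμs := measure_ne_top P s) (c := (1 : ℂ))]
    with ω h1 h2 h3 h4 h5
  rw [h1, h2, h3, indTop, indTwo, h4, h5]

theorem L2L2_induction {motive : L2L2 P μ → Prop}
    (hind : ∀ (ξ : L2 μ) (s : Set Ω) (hs : MeasurableSet s), motive (tens P μ ξ (indTwo P hs)))
    (hadd : ∀ F G, motive F → motive G → motive (F + G)) (hcl : IsClosed {F | motive F})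
    (F : L2L2 P μ) : motive F := by
  refine Lp.induction (by simp) motive (fun ξ s hs hμs => ?_) (fun f g hf hg _ h1 h2 =>
    hadd _ _ h1 h2) hcl F
  convert hind ξ s hs using 1
  refine Lp.ext ?_
  have : ((Lp.simpleFunc.indicatorConst 2 hs hμs.ne ξ : Lp.simpleFunc (L2 μ) 2 P) :
      L2L2 P μ) = indicatorConstLp 2 hs hμs.ne ξ :=
    Lp.simpleFunc.coe_indicatorConst (p := 2) hs hμs.ne ξ
  rw [this]
  filter_upwards [tens_apply ξ (indTwo P hs),
    indicatorConstLp_coeFn (p := 2) (hs := hs) (hμs := hμs.ne) (c := ξ),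
    indicatorConstLp_coeFn (p := 2) (hs := hs) (hμs := measure_ne_top P s) (c := (1 : ℂ))]
    with ω h1 h2 h3
  rw [h1, h2, indTwo, h3]
  by_cases h : ω ∈ s <;> simp [h]

theorem clm_ext_tens {E : Type*} [NormedAddCommGroup E] [NormedSpace ℂ E]
    {A B : L2L2 P μ →L[ℂ] E}
    (h : ∀ (ξ : L2 μ) (s : Set Ω) (hs : MeasurableSet s),
      A (tens P μ ξ (indTwo P hs)) = B (tens P μ ξ (indTwo P hs))) : A = B :=
  ContinuousLinearMap.ext fun F => L2L2_induction (motive := fun F => A F = B F) h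
    (fun F G h1 h2 => by rw [map_add, map_add, h1, h2]) (isClosed_eq A.continuous B.continuous) F

theorem eq_zero_of_inner_tens {F : L2L2 P μ} (h : ∀ ξ f, ⟪tens P μ ξ f, F⟫_ℂ = 0) : F = 0 := by
  have h1 : innerSL ℂ F = 0 := clm_ext_tens fun ξ s hs => by
    rw [innerSL_apply_apply, ← inner_conj_symm, h]
    simp
  have h2 := DFunLike.congr_fun h1 F
  simpa using h2

theorem constEmb_eq_tens (ξ : L2 μ) :
    constEmb P μ ξ = tens P μ ξ (indTwo P MeasurableSet.univ) := by
  refine Lp.ext ?_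
  filter_upwards [constEmb_apply (P := P) ξ, tens_apply ξ (indTwo P MeasurableSet.univ),
    indicatorConstLp_coeFn (p := 2) (hs := MeasurableSet.univ)
      (hμs := measure_ne_top P Set.univ) (c := (1 : ℂ))] with ω h1 h2 h3
  rw [h1, h2, indTwo, h3]
  simp

theorem inner_constEmb [IsProbabilityMeasure P] (ξ η : L2 μ) :
    ⟪constEmb P μ ξ, constEmb P μ η⟫_ℂ = ⟪ξ, η⟫_ℂ := by
  rw [L2.inner_def]
  have : ∀ᵐ ω ∂P, ⟪constEmb P μ ξ ω, constEmb P μ η ω⟫_ℂ = ⟪ξ, η⟫_ℂ := by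
    filter_upwards [constEmb_apply (P := P) ξ, constEmb_apply (P := P) η] with ω h1 h2
    rw [h1, h2]
  rw [integral_congr_ae this]
  simp

theorem adjoint_constEmb_comp [IsProbabilityMeasure P] (ξ : L2 μ) :
    (constEmb P μ).adjoint (constEmb P μ ξ) = ξ :=
  ext_inner_left ℂ fun η => by
    rw [ContinuousLinearMap.adjoint_inner_right, inner_constEmb]

end Finite

theorem mulOp_comm_mulOp (f g : Lp ℂ ∞ P) : Commute (mulOp μ f) (mulOp μ g) := by
  refine ContinuousLinearMap.ext fun F => Lp.ext ?_
  filter_upwards [mulOp_apply f (mulOp μ g F), mulOp_apply g F, mulOp_apply g (mulOp μ f F),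
    mulOp_apply f F] with ω h1 h2 h3 h4
  change mulOp μ f (mulOp μ g F) ω = mulOp μ g (mulOp μ f F) ω
  rw [h1, h2, h3, h4, smul_comm]

theorem mulOp_comm_ampOp (f : Lp ℂ ∞ P) (z : Bd (L2 μ)) : Commute (mulOp μ f) (ampOp P z) := by
  refine ContinuousLinearMap.ext fun F => Lp.ext ?_
  filter_upwards [mulOp_apply f (ampOp P z F), ampOp_apply z F, ampOp_apply z (mulOp μ f F),
    mulOp_apply f F] with ω h1 h2 h3 h4
  change mulOp μ f (ampOp P z F) ω = ampOp P z (mulOp μ f F) ω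
  rw [h1, h2, h3, h4, map_smul]

theorem star_mulOp (f : Lp ℂ ∞ P) : star (mulOp μ f) = mulOp μ (star f) := by
  rw [ContinuousLinearMap.star_eq_adjoint]
  symm
  rw [ContinuousLinearMap.eq_adjoint_iff]
  intro F G
  rw [L2.inner_def, L2.inner_def]
  refine integral_congr_ae ?_
  filter_upwards [mulOp_apply f G, mulOp_apply (star f) F, Lp.coeFn_star f] with ω h1 h2 h3
  rw [h1, h2, inner_smul_left, inner_smul_right, h3]
  simp

theorem star_ampOp (z : Bd (L2 μ)) : star (ampOp P z) = ampOp P (star z) := by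
  rw [ContinuousLinearMap.star_eq_adjoint]
  symm
  rw [ContinuousLinearMap.eq_adjoint_iff]
  intro F G
  rw [L2.inner_def, L2.inner_def]
  refine integral_congr_ae ?_
  filter_upwards [ampOp_apply z G, ampOp_apply (star z) F] with ω h1 h2
  rw [h1, h2, ContinuousLinearMap.star_eq_adjoint, ContinuousLinearMap.adjoint_inner_left]

theorem ampOp_tens (z : Bd (L2 μ)) (ξ : L2 μ) (f : Lp ℂ 2 P) :
    ampOp P z (tens P μ ξ f) = tens P μ (z ξ) f := by
  refine Lp.ext ?_
  filter_upwards [ampOp_apply z (tens P μ ξ f), tens_apply ξ f, tens_apply (z ξ) f] with ω h1 h2 h3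
  rw [h1, h2, h3, map_smul]

theorem ampOp_constEmb [IsFiniteMeasure P] (z : Bd (L2 μ)) (ξ : L2 μ) :
    ampOp P z (constEmb P μ ξ) = constEmb P μ (z ξ) := by
  rw [constEmb_eq_tens, ampOp_tens, ← constEmb_eq_tens]

/-- The elements of the commutant of `{f ⊗ 1, 1 ⊗ z}` are multiplication operators. -/
theorem exists_eq_mulOp [IsFiniteMeasure P] {c : Bd (L2L2 P μ)}
    (hm : ∀ f : Lp ℂ ∞ P, Commute (mulOp μ f) c) (ha : ∀ z : Bd (L2 μ), Commute (ampOp P z) c) :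
    ∃ g : Lp ℂ ∞ P, c = mulOp μ g := by
  rcases subsingleton_or_nontrivial (L2 μ) with hsub | hnt
  · refine ⟨0, clm_ext_tens fun ξ s hs => ?_⟩
    rw [Subsingleton.elim ξ 0]
    simp
  obtain ⟨ξ₀, hξ₀⟩ := exists_norm_eq (L2 μ) (zero_le_one (α := ℝ))
  have hξ₀' : ⟪ξ₀, ξ₀⟫_ℂ = 1 := by rw [inner_self_eq_norm_sq_to_K, hξ₀]; simp
  let g₀ : Lp ℂ 2 P := (innerSL ℂ ξ₀).compLpL 2 P (c (constEmb P μ ξ₀))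
  have hg₀ : g₀ =ᵐ[P] fun ω => ⟪ξ₀, c (constEmb P μ ξ₀) ω⟫_ℂ :=
    ContinuousLinearMap.coeFn_compLpL _ _
  -- Write `1 ⊗ ξ` as the amplified rank one operator `ξ₀ ↦ ξ` applied to `1 ⊗ ξ₀`, and commute it
  -- past `c`: all information on `c` sits in the single function `g₀`.
  have hc : ∀ ξ, c (constEmb P μ ξ) = tens P μ ξ g₀ := by
    intro ξ
    have h1 : constEmb P μ ξ = ampOp P (InnerProductSpace.rankOne ℂ ξ ξ₀) (constEmb P μ ξ₀) := by
      rw [ampOp_constEmb]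
      simp [hξ₀]
    have h2 := DFunLike.congr_fun (ha (InnerProductSpace.rankOne ℂ ξ ξ₀)) (constEmb P μ ξ₀)
    change ampOp P _ (c _) = c (ampOp P _ _) at h2
    rw [h1, ← h2]
    refine Lp.ext ?_
    filter_upwards [ampOp_apply (InnerProductSpace.rankOne ℂ ξ ξ₀) (c (constEmb P μ ξ₀)),
      tens_apply ξ g₀, hg₀] with ω h3 h4 h5
    rw [h3, h4, h5]
    simp
  have hcs : ∀ ξ (s : Set Ω) (hs : MeasurableSet s), c (tens P μ ξ (indTwo P hs)) =
      mulOp μ (indTop P hs) (tens P μ ξ g₀) := by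
    intro ξ s hs
    rw [← mulOp_indTop_constEmb, ← hc]
    exact (DFunLike.congr_fun (hm (indTop P hs)) (constEmb P μ ξ)).symm
  -- Evaluating `c` at `1_s ⊗ ξ₀` gives `∫_s |g₀|² ≤ ‖c‖² P(s)` for every measurable `s`, hence the
  -- pointwise bound.
  have hbound : ∀ᵐ ω ∂P, ‖g₀ ω‖ ≤ ‖c‖ := by
    have h1 : (fun ω => ‖g₀ ω‖ₑ ^ 2) ≤ᵐ[P] fun _ => ‖c‖ₑ ^ 2 := by
      refine ae_le_of_forall_setLIntegral_le_of_sigmaFinite₀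
        ((Lp.aestronglyMeasurable g₀).enorm.pow_const _) fun s hs _ => ?_
      have h2 := c.le_opENorm (tens P μ ξ₀ (indTwo P hs))
      rw [hcs] at h2
      have h3 : ∀ F : L2L2 P μ, ‖F‖ₑ ^ 2 = ∫⁻ ω, ‖F ω‖ₑ ^ 2 ∂P := by
        intro F
        rw [Lp.enorm_def, eLpNorm_eq_lintegral_rpow_enorm_toReal (by simp) (by simp),
          ← ENNReal.rpow_natCast, ← ENNReal.rpow_mul]
        simp
      have h4 := pow_le_pow_left' h2 2
      rw [mul_pow, h3, h3] at h4
      have hn : ‖ξ₀‖ₑ = 1 := by rw [← ofReal_norm, hξ₀]; simp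
      have e1 : ∫⁻ ω, ‖mulOp μ (indTop P hs) (tens P μ ξ₀ g₀) ω‖ₑ ^ 2 ∂P =
          ∫⁻ ω in s, ‖g₀ ω‖ₑ ^ 2 ∂P := by
        rw [← lintegral_indicator hs]
        refine lintegral_congr_ae ?_
        filter_upwards [mulOp_apply (indTop P hs) (tens P μ ξ₀ g₀), tens_apply ξ₀ g₀,
          indicatorConstLp_coeFn (p := ∞) (hs := hs) (hμs := measure_ne_top P s) (c := (1 : ℂ))]
          with ω h5 h6 h7
        rw [h5, h6, indTop, h7]
        by_cases h : ω ∈ s <;> simp [h, enorm_smul, hn]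
      have e2 : ∫⁻ ω, ‖tens P μ ξ₀ (indTwo P hs) ω‖ₑ ^ 2 ∂P = P s := by
        rw [← setLIntegral_one, ← lintegral_indicator hs]
        refine lintegral_congr_ae ?_
        filter_upwards [tens_apply ξ₀ (indTwo P hs),
          indicatorConstLp_coeFn (p := 2) (hs := hs) (hμs := measure_ne_top P s) (c := (1 : ℂ))]
          with ω h6 h7
        rw [h6, indTwo, h7]
        by_cases h : ω ∈ s <;> simp [h, hn]
      rw [e1, e2] at h4
      simpa using h4
    filter_upwards [h1] with ω h
    have h2 := (ENNReal.pow_le_pow_left_iff (by norm_num)).1 h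
    rwa [enorm_le_iff_norm_le] at h2
  have hmem : MemLp g₀ ∞ P := memLp_top_of_bound (Lp.aestronglyMeasurable g₀) _ hbound
  refine ⟨hmem.toLp g₀, clm_ext_tens fun ξ s hs => ?_⟩
  rw [hcs]
  refine Lp.ext ?_
  filter_upwards [mulOp_apply (indTop P hs) (tens P μ ξ g₀), tens_apply ξ g₀,
    mulOp_apply (hmem.toLp g₀) (tens P μ ξ (indTwo P hs)), tens_apply ξ (indTwo P hs),
    hmem.coeFn_toLp,
    indicatorConstLp_coeFn (p := ∞) (hs := hs) (hμs := measure_ne_top P s) (c := (1 : ℂ)),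
    indicatorConstLp_coeFn (p := 2) (hs := hs) (hμs := measure_ne_top P s) (c := (1 : ℂ))]
    with ω h1 h2 h3 h4 h5 h6 h7
  rw [h1, h2, h3, h4, h5, indTop, indTwo, h6, h7, smul_comm]

/-- `L^∞(Ω) ⊗̄ B(L²(X))` is the commutant of `L^∞(Ω) ⊗ 1`. -/
theorem mem_tensorVN_iff [IsFiniteMeasure P] {a : Bd (L2L2 P μ)} :
    a ∈ (tensorVN P μ).toStarSubalgebra ↔ ∀ f : Lp ℂ ∞ P, Commute (mulOp μ f) a := by
  change a ∈ StarSubalgebra.centralizer ℂ (SetLike.coe (StarSubalgebra.centralizer ℂ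
    (Set.range (mulOp (P := P) μ) ∪ Set.range (ampOp P (μ := μ))))) ↔ _
  simp only [StarSubalgebra.mem_centralizer_iff, SetLike.mem_coe]
  constructor
  · intro h f
    refine (h _ fun g hg => ?_).1
    rcases hg with ⟨g, rfl⟩ | ⟨z, rfl⟩
    · rw [star_mulOp]
      exact ⟨mulOp_comm_mulOp _ _, mulOp_comm_mulOp _ _⟩
    · rw [star_ampOp]
      exact ⟨(mulOp_comm_ampOp _ _).symm, (mulOp_comm_ampOp _ _).symm⟩
  -- The bicommutant half: anything commuting with all generators is a multiplication operator, and
  -- those commute with `a` by assumption.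
  · intro h c hc
    obtain ⟨g, rfl⟩ := exists_eq_mulOp (c := c) (fun f => (hc _ (Or.inl ⟨f, rfl⟩)).1)
      fun z => (hc _ (Or.inr ⟨z, rfl⟩)).1
    rw [star_mulOp]
    exact ⟨h _, h _⟩

end Elementary

/-! ### The trace, the embedding and the conditional expectation -/

section Trace

variable {Ω : Type*} [MeasurableSpace Ω] {P : Measure Ω} {X : Type*} [MeasurableSpace X]
  {μ : Measure X}

theorem hilbertBasis_eq_zero {ι K : Type*} [NormedAddCommGroup K] [InnerProductSpace ℂ K]
    (b : HilbertBasis ι ℂ K) {v : K} (h : ∀ i, ⟪b i, v⟫_ℂ = 0) : v = 0 := by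
  have : b.repr v = 0 := lp.ext (funext fun i => by rw [b.repr_apply_apply, h]; rfl)
  simpa using this

theorem hilbertBasis_inner {ι K : Type*} [NormedAddCommGroup K] [InnerProductSpace ℂ K]
    [DecidableEq ι] (b : HilbertBasis ι ℂ K) (i j : ι) :
    ⟪b i, b j⟫_ℂ = if i = j then 1 else 0 :=
  orthonormal_iff_ite.1 b.orthonormal i j

section Finite

variable [IsFiniteMeasure P]

theorem eq_zero_of_inner_tens_basis {ι : Type*} (b : HilbertBasis ι ℂ (L2 μ)) {F : L2L2 P μ}
    (h : ∀ i f, ⟪tens P μ (b i) f, F⟫_ℂ = 0) : F = 0 := by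
  refine eq_zero_of_inner_tens fun ξ f => ?_
  have h1 : ((tens P μ).flip f).adjoint F = 0 := hilbertBasis_eq_zero b fun i => by
    rw [ContinuousLinearMap.adjoint_inner_right]
    exact h i f
  have h2 := ContinuousLinearMap.adjoint_inner_right ((tens P μ).flip f) ξ F
  rw [h1, inner_zero_right] at h2
  exact h2.symm

theorem eq_zero_of_inner_tens_basis' {ι : Type*} (b : HilbertBasis ι ℂ (Lp ℂ 2 P))
    {F : L2L2 P μ} (h : ∀ i ξ, ⟪tens P μ ξ (b i), F⟫_ℂ = 0) : F = 0 := by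
  refine eq_zero_of_inner_tens fun ξ f => ?_
  have h1 : (tens P μ ξ).adjoint F = 0 := hilbertBasis_eq_zero b fun i => by
    rw [ContinuousLinearMap.adjoint_inner_right]
    exact h i ξ
  rw [← ContinuousLinearMap.adjoint_inner_right, h1, inner_zero_right]

/-- Parseval with coefficients in `L²(Ω)`: `F` is the sum of its components `f_i ⊗ b_i`. -/
theorem hasSum_norm_sq_coef {ι : Type*} (b : HilbertBasis ι ℂ (L2 μ)) (F : L2L2 P μ) :
    HasSum (fun i => ‖(tens P μ (b i)).adjoint F‖ ^ 2) (‖F‖ ^ 2) := by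
  classical
  refine hasSum_norm_sq_adjoint (fun i => tens P μ (b i)) (fun i j f g => ?_)
    (fun F h => eq_zero_of_inner_tens_basis b h) F
  rw [inner_tens_tens, hilbertBasis_inner]
  split_ifs <;> simp

/-- An orthonormal basis of `L²(Ω)` splits `L²(Ω, L²(X))` into copies of `L²(X)`, and `1 ⊗ z` acts
as `z` on each. -/
theorem continuous_ampOp :
    Continuous[weakStar (L2 μ), weakStar (L2L2 P μ)] (ampOp P : Bd (L2 μ) → Bd (L2L2 P μ)) := by
  classical
  let b := basis (Lp ℂ 2 P)
  have hV : ∀ i j ξ η, ⟪(tens P μ).flip (b i) ξ, (tens P μ).flip (b j) η⟫_ℂ =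
      if i = j then ⟪ξ, η⟫_ℂ else 0 := by
    intro i j ξ η
    change ⟪tens P μ ξ (b i), tens P μ η (b j)⟫_ℂ = _
    rw [inner_tens_tens, hilbertBasis_inner]
    split_ifs <;> simp
  have ht : ∀ F : L2L2 P μ, (∀ i ξ, ⟪(tens P μ).flip (b i) ξ, F⟫_ℂ = 0) → F = 0 :=
    fun F h => eq_zero_of_inner_tens_basis' b h
  refine continuous_weakStar_of_hasSum (fun i => ((tens P μ).flip (b i)).adjoint)
    (hasSum_norm_sq_adjoint _ hV ht) _ fun z F G => ?_
  have h1 := hasSum_inner_adjoint _ hV ht F (ampOp P z G)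
  convert h1 using 3 with i
  refine ext_inner_left ℂ fun ξ => ?_
  rw [ContinuousLinearMap.adjoint_inner_right]
  change _ = ⟪tens P μ ξ (b i), ampOp P z G⟫_ℂ
  rw [← ContinuousLinearMap.adjoint_inner_left, ContinuousLinearMap.adjoint_inner_right,
    ← ContinuousLinearMap.adjoint_inner_left (ampOp P z), ← ContinuousLinearMap.star_eq_adjoint,
    ← ContinuousLinearMap.star_eq_adjoint, star_ampOp, ampOp_tens]
  rfl

end Finite

theorem ampOp_mul (z w : Bd (L2 μ)) : ampOp P (z * w) = ampOp P z * ampOp P w := by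
  refine ContinuousLinearMap.ext fun F => Lp.ext ?_
  filter_upwards [ampOp_apply (z * w) F, ampOp_apply z (ampOp P w F), ampOp_apply w F]
    with ω h1 h2 h3
  change ampOp P (z * w) F ω = ampOp P z (ampOp P w F) ω
  rw [h1, h2, h3]
  rfl

theorem ampOp_add (z w : Bd (L2 μ)) : ampOp P (z + w) = ampOp P z + ampOp P w := by
  refine ContinuousLinearMap.ext fun F => Lp.ext ?_
  filter_upwards [ampOp_apply (z + w) F, ampOp_apply z F, ampOp_apply w F,
    Lp.coeFn_add (ampOp P z F) (ampOp P w F)] with ω h1 h2 h3 h4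
  change ampOp P (z + w) F ω = (ampOp P z F + ampOp P w F : L2L2 P μ) ω
  rw [h1, h4, Pi.add_apply, h2, h3]
  rfl

theorem ampOp_algebraMap (c : ℂ) :
    ampOp P (algebraMap ℂ (Bd (L2 μ)) c) = algebraMap ℂ (Bd (L2L2 P μ)) c := by
  refine ContinuousLinearMap.ext fun F => Lp.ext ?_
  filter_upwards [ampOp_apply (algebraMap ℂ (Bd (L2 μ)) c) F, Lp.coeFn_smul c F] with ω h1 h2
  change ampOp P (algebraMap ℂ (Bd (L2 μ)) c) F ω = (c • F : L2L2 P μ) ω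
  rw [h1, h2]
  rfl

variable (P μ) in
/-- The *-homomorphism `z ↦ 1 ⊗ z`. -/
def ampHom [IsFiniteMeasure P] : Bd (L2 μ) →⋆ₐ[ℂ] Elt (tensorVN P μ) where
  toFun z := ⟨ampOp P z, subset_generatedVN _ (Or.inr ⟨z, rfl⟩)⟩
  map_one' := Subtype.ext (by simpa using ampOp_algebraMap (P := P) (μ := μ) 1)
  map_mul' z w := Subtype.ext (ampOp_mul z w)
  map_zero' := Subtype.ext (by simpa using ampOp_algebraMap (P := P) (μ := μ) 0)
  map_add' z w := Subtype.ext (ampOp_add z w)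
  commutes' c := Subtype.ext (ampOp_algebraMap c)
  map_star' z := Subtype.ext (star_ampOp z).symm

theorem coe_ampHom [IsFiniteMeasure P] (z : Bd (L2 μ)) :
    (ampHom P μ z : Bd (L2L2 P μ)) = ampOp P z := rfl

theorem mulOp_comm [IsFiniteMeasure P] (x : Elt (tensorVN P μ)) (f : Lp ℂ ∞ P) :
    Commute (mulOp μ f) (x : Bd (L2L2 P μ)) :=
  mem_tensorVN_iff.1 x.2 f

theorem meanExp_apply [IsFiniteMeasure P] (m : Elt (tensorVN P μ)) (ξ η : L2 μ) :
    ⟪η, meanExp P μ m ξ⟫_ℂ = ⟪constEmb P μ η, (m : Bd (L2L2 P μ)) (constEmb P μ ξ)⟫_ℂ := by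
  change ⟪η, (constEmb P μ).adjoint _⟫_ℂ = _
  rw [ContinuousLinearMap.adjoint_inner_right]
  rfl

theorem tensorTrace_eq [IsFiniteMeasure P] (m : Elt (tensorVN P μ)) :
    tensorTrace P μ m = ∑' i, ENNReal.ofReal (RCLike.re
      ⟪constEmb P μ (basis (L2 μ) i),
        (m : Bd (L2L2 P μ)) (constEmb P μ (basis (L2 μ) i))⟫_ℂ) := by
  simp only [tensorTrace, opTrace, meanExp_apply]

theorem inner_star_mul_self {K : Type*} [NormedAddCommGroup K] [InnerProductSpace ℂ K]
    [CompleteSpace K] (x : Bd K) (ξ : K) :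
    RCLike.re ⟪ξ, (star x * x) ξ⟫_ℂ = ‖x ξ‖ ^ 2 := by
  change RCLike.re ⟪ξ, star x (x ξ)⟫_ℂ = _
  rw [ContinuousLinearMap.star_eq_adjoint, ContinuousLinearMap.adjoint_inner_right,
    inner_self_eq_norm_sq]

/-! ### The weight `∫ ⊗ tr` is a normal semifinite faithful trace. -/

section Finite

variable [IsFiniteMeasure P]

/-- The matrix coefficients of `x*` are the conjugates of those of `x`. -/
theorem norm_coef_star (x : Elt (tensorVN P μ)) (ξ η : L2 μ) :
    ‖(tens P μ η).adjoint ((x : Bd (L2L2 P μ)) (constEmb P μ ξ))‖ =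
      ‖(tens P μ ξ).adjoint ((star x : Bd (L2L2 P μ)) (constEmb P μ η))‖ := by
  set u := (tens P μ η).adjoint ((x : Bd (L2L2 P μ)) (constEmb P μ ξ)) with hu
  set v := (tens P μ ξ).adjoint ((star x : Bd (L2L2 P μ)) (constEmb P μ η)) with hv
  -- The indicator of `s` commutes with `x` and can be carried to the other side of the inner
  -- product. Letting `s` vary identifies `v` with the conjugate of `u` almost everywhere.
  have key : ∀ (s : Set Ω) (hs : MeasurableSet s),
      ⟪indTwo P hs, v⟫_ℂ = (starRingEnd ℂ) ⟪indTwo P hs, u⟫_ℂ := by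
    intro s hs
    have hstar : star (indTop P hs) = indTop P hs := by
      refine Lp.ext ?_
      filter_upwards [Lp.coeFn_star (indTop P hs),
        indicatorConstLp_coeFn (p := ∞) (hs := hs) (hμs := measure_ne_top P s) (c := (1 : ℂ))]
        with ω h1 h2
      rw [h1, Pi.star_apply, indTop, h2]
      by_cases h : ω ∈ s <;> simp [h]
    have hc := DFunLike.congr_fun (mulOp_comm x (indTop P hs)) (constEmb P μ ξ)
    change mulOp μ _ ((x : Bd (L2L2 P μ)) _) = (x : Bd (L2L2 P μ)) (mulOp μ _ _) at hc
    rw [hv, hu, ContinuousLinearMap.adjoint_inner_right, ContinuousLinearMap.adjoint_inner_right,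
      inner_conj_symm, ContinuousLinearMap.star_eq_adjoint, ContinuousLinearMap.adjoint_inner_right,
      ← mulOp_indTop_constEmb, ← mulOp_indTop_constEmb, ← hc,
      ← ContinuousLinearMap.adjoint_inner_right, ← ContinuousLinearMap.star_eq_adjoint, star_mulOp,
      hstar]
  have h2 : v =ᵐ[P] fun ω => (starRingEnd ℂ) (u ω) := by
    have hi : ∀ w : Lp ℂ 2 P, Integrable w P := fun w => (Lp.memLp w).integrable (by norm_num)
    refine Integrable.ae_eq_of_forall_setIntegral_eq _ _ (hi v)
      ((Complex.conjCLE : ℂ →L[ℝ] ℂ).integrable_comp (hi u)) fun s hs _ => ?_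
    have h3 := key s hs
    rw [indTwo, L2.inner_indicatorConstLp_one, L2.inner_indicatorConstLp_one] at h3
    rw [h3, integral_conj]
  rw [Lp.norm_def, Lp.norm_def]
  congr 1
  refine eLpNorm_congr_norm_ae ?_
  filter_upwards [h2] with ω h
  rw [h, RCLike.norm_conj]

/-- Regard `x` as a matrix of functions `x_{ji}` on `Ω`: expanding each column by Parseval leaves
the sum of the squared `L²(Ω)` norms of the entries. -/
theorem tensorTrace_star_mul_self (x : Elt (tensorVN P μ)) :
    tensorTrace P μ (star x * x) = ∑' i, ∑' j, ENNReal.ofReal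
      (‖(tens P μ (basis (L2 μ) j)).adjoint
        ((x : Bd (L2L2 P μ)) (constEmb P μ (basis (L2 μ) i)))‖ ^ 2) := by
  rw [tensorTrace_eq]
  refine tsum_congr fun i => ?_
  have h := hasSum_norm_sq_coef (basis (L2 μ)) ((x : Bd (L2L2 P μ)) (constEmb P μ (basis (L2 μ) i)))
  have h1 : ((star x * x : Elt (tensorVN P μ)) : Bd (L2L2 P μ)) = star (x : Bd (L2L2 P μ)) * x :=
    rfl
  rw [h1, inner_star_mul_self, ← h.tsum_eq,
    ENNReal.ofReal_tsum_of_nonneg (fun _ => by positivity) h.summable]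

/-- Passing to `x*` transposes and conjugates the matrix of functions, which does not change the
double sum of squared norms. -/
theorem tensorTrace_comm (x : Elt (tensorVN P μ)) :
    tensorTrace P μ (star x * x) = tensorTrace P μ (x * star x) := by
  have h := tensorTrace_star_mul_self (star x)
  rw [star_star] at h
  rw [h, tensorTrace_star_mul_self, ENNReal.tsum_comm]
  refine tsum_congr fun j => tsum_congr fun i => ?_
  rw [norm_coef_star]
  rfl

theorem mem_tensorVN_of_commute {x r : Bd (L2L2 P μ)} (hx : x ∈ (tensorVN P μ).toStarSubalgebra)
    (h : ∀ c, Commute x c → Commute r c) : r ∈ (tensorVN P μ).toStarSubalgebra :=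
  mem_tensorVN_iff.2 fun f => (h _ (mem_tensorVN_iff.1 hx f).symm).symm

/-- The constants are separating for `M`: an element killing `1 ⊗ ξ` also kills `1_s ⊗ ξ`, because
it commutes with the indicator of `s`. -/
theorem eq_zero_of_constEmb (x : Elt (tensorVN P μ))
    (h : ∀ i, (x : Bd (L2L2 P μ)) (constEmb P μ (basis (L2 μ) i)) = 0) : x = 0 := by
  have h0 : ∀ ξ, (x : Bd (L2L2 P μ)) (constEmb P μ ξ) = 0 := by
    intro ξ
    have h1 : ((x : Bd (L2L2 P μ)) ∘L constEmb P μ).adjoint = 0 := by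
      refine ContinuousLinearMap.ext fun F => hilbertBasis_eq_zero (basis (L2 μ)) fun i => ?_
      rw [ContinuousLinearMap.adjoint_inner_right]
      change ⟪(x : Bd (L2L2 P μ)) (constEmb P μ (basis (L2 μ) i)), F⟫_ℂ = 0
      rw [h i, inner_zero_left]
    have h2 : (x : Bd (L2L2 P μ)) ∘L constEmb P μ = 0 := by
      rw [← ContinuousLinearMap.adjoint_adjoint ((x : Bd (L2L2 P μ)) ∘L constEmb P μ), h1, map_zero]
    exact DFunLike.congr_fun h2 ξ
  refine Subtype.ext (clm_ext_tens fun ξ s hs => ?_)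
  have hc := DFunLike.congr_fun (mulOp_comm x (indTop P hs)) (constEmb P μ ξ)
  change mulOp μ _ ((x : Bd (L2L2 P μ)) _) = (x : Bd (L2L2 P μ)) (mulOp μ _ _) at hc
  rw [← mulOp_indTop_constEmb, ← hc, h0, map_zero]
  rfl

/-- For `r = √x` the trace is `∑ ‖r(1 ⊗ e_i)‖²`; if it vanishes, `r` kills separating vectors. -/
theorem tensorTrace_faithful (x : Elt (tensorVN P μ)) (hx : 0 ≤ (x : Bd (L2L2 P μ)))
    (h : tensorTrace P μ x = 0) : x = 0 := by
  obtain ⟨r, -, hr, hrr, hrc⟩ := exists_sqrt hx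
  let r' : Elt (tensorVN P μ) := ⟨r, mem_tensorVN_of_commute x.2 hrc⟩
  have hx' : star r' * r' = x := Subtype.ext (by change star r * r = _; rw [hr, hrr])
  have hr0 : r' = 0 := by
    refine eq_zero_of_constEmb r' fun i => ?_
    rw [tensorTrace_eq, ENNReal.tsum_eq_zero] at h
    have h1 := ENNReal.ofReal_eq_zero.1 (h i)
    rw [← hx'] at h1
    change RCLike.re ⟪_, (star r * r) _⟫_ℂ ≤ 0 at h1
    rw [inner_star_mul_self] at h1
    have h2 : ‖r (constEmb P μ (basis (L2 μ) i))‖ = 0 := by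
      nlinarith [norm_nonneg (r (constEmb P μ (basis (L2 μ) i)))]
    exact norm_eq_zero.1 h2
  rw [← hx', hr0, mul_zero]

theorem tensorTrace_add (x y : Elt (tensorVN P μ)) (hx : 0 ≤ (x : Bd (L2L2 P μ)))
    (hy : 0 ≤ (y : Bd (L2L2 P μ))) :
    tensorTrace P μ (x + y) = tensorTrace P μ x + tensorTrace P μ y := by
  simp only [tensorTrace_eq]
  rw [← ENNReal.tsum_add]
  refine tsum_congr fun i => ?_
  rw [← ENNReal.ofReal_add (re_inner_nonneg hx _) (re_inner_nonneg hy _), ← map_add,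
    ← inner_add_right]
  rfl

theorem tensorTrace_smul (c : ℝ≥0) (x : Elt (tensorVN P μ)) :
    tensorTrace P μ ((c : ℂ) • x) = c * tensorTrace P μ x := by
  simp only [tensorTrace_eq]
  rw [← ENNReal.tsum_mul_left]
  refine tsum_congr fun i => ?_
  change ENNReal.ofReal (RCLike.re ⟪_, (c : ℂ) • ((x : Bd (L2L2 P μ)) _)⟫_ℂ) = _
  rw [inner_smul_right]
  have : RCLike.re ((c : ℂ) * ⟪constEmb P μ (basis (L2 μ) i),
      (x : Bd (L2L2 P μ)) (constEmb P μ (basis (L2 μ) i))⟫_ℂ) =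
      (c : ℝ) * RCLike.re ⟪constEmb P μ (basis (L2 μ) i),
      (x : Bd (L2L2 P μ)) (constEmb P μ (basis (L2 μ) i))⟫_ℂ := by
    simp
  rw [this, ENNReal.ofReal_mul c.coe_nonneg]
  simp

/-- Cut `√x` by `p = 1 ⊗ p_i`, with `p_i` the projection onto a basis vector. Then `√x p √x ≤ x`,
and by the trace property its trace is that of `p x p`, a single finite term. Some `i` gives a
nonzero element, since otherwise `√x = 0`. -/
theorem tensorTrace_semifinite (x : Elt (tensorVN P μ)) (hx : 0 ≤ (x : Bd (L2L2 P μ)))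
    (hx0 : x ≠ 0) : ∃ y : Elt (tensorVN P μ), 0 ≤ (y : Bd (L2L2 P μ)) ∧
      (y : Bd (L2L2 P μ)) ≤ x ∧ y ≠ 0 ∧ tensorTrace P μ y < ∞ := by
  classical
  obtain ⟨r, -, hr, hrr, hrc⟩ := exists_sqrt hx
  let r' : Elt (tensorVN P μ) := ⟨r, mem_tensorVN_of_commute x.2 hrc⟩
  have hr' : star r' = r' := Subtype.ext hr
  have hx' : r' * r' = x := Subtype.ext hrr
  let e := basis (L2 μ)
  let p : basisIndex (L2 μ) → Bd (L2 μ) := fun i => InnerProductSpace.rankOne ℂ (e i) (e i)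
  have hnorm : ∀ i, ‖e i‖ = 1 := e.orthonormal.1
  have hps : ∀ i, star (p i) = p i := fun i => by
    rw [ContinuousLinearMap.star_eq_adjoint]
    exact InnerProductSpace.adjoint_rankOne _ _
  have hpp : ∀ i, p i * p i = p i := fun i => ContinuousLinearMap.ext fun ξ => by
    change p i (p i ξ) = p i ξ
    simp [p, hnorm]
  let J := ampHom P μ
  have hex : ∃ i, J (p i) * r' ≠ 0 := by
    by_contra! hcon
    refine hx0 ?_
    have h1 : r' = 0 := by
      refine Subtype.ext (ContinuousLinearMap.ext fun F => ?_)
      refine eq_zero_of_inner_tens_basis e fun i f => ?_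
      have h2 : tens P μ (e i) f = ampOp P (p i) (tens P μ (e i) f) := by
        rw [ampOp_tens]
        simp [p, hnorm]
      rw [h2, ← ContinuousLinearMap.adjoint_inner_right, ← ContinuousLinearMap.star_eq_adjoint,
        star_ampOp, hps]
      have h3 := DFunLike.congr_fun (congrArg Subtype.val (hcon i)) F
      change ampOp P (p i) (r F) = 0 at h3
      change ⟪_, ampOp P (p i) (r F)⟫_ℂ = 0
      rw [h3, inner_zero_right]
    rw [← hx', h1, mul_zero]
  obtain ⟨i, hi⟩ := hex
  have hJs : star (J (p i)) = J (p i) := by rw [← map_star, hps]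
  have hJJ : J (p i) * J (p i) = J (p i) := by rw [← map_mul, hpp]
  let w : Elt (tensorVN P μ) := J (p i) * r'
  have hw : star w = r' * J (p i) := by rw [star_mul, hr', hJs]
  have hpos : ∀ m : Elt (tensorVN P μ), 0 ≤ ((star m * m : Elt (tensorVN P μ)) : Bd (L2L2 P μ)) :=
    fun m => star_mul_self_nonneg (m : Bd (L2L2 P μ))
  refine ⟨star w * w, hpos w, ?_, ?_, ?_⟩
  · rw [← sub_nonneg]
    -- The difference is `√x (1 - p) √x`, a square because `1 - p` is a projection.
    have h1 : (x - star w * w : Elt (tensorVN P μ)) =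
        star ((1 - J (p i)) * r') * ((1 - J (p i)) * r') := by
      rw [hw, star_mul, star_sub, star_one, hJs, hr', ← hx']
      have : (1 - J (p i)) * (1 - J (p i)) = 1 - J (p i) := by
        rw [mul_sub, mul_one, sub_mul, one_mul, hJJ, sub_self, sub_zero]
      calc r' * r' - r' * J (p i) * w = r' * r' - r' * (J (p i) * J (p i)) * r' := by
            simp only [w, mul_assoc]
        _ = r' * (1 - J (p i)) * r' := by rw [hJJ]; noncomm_ring
        _ = r' * ((1 - J (p i)) * (1 - J (p i))) * r' := by rw [this]
        _ = _ := by simp only [mul_assoc]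
    have h2 := hpos ((1 - J (p i)) * r')
    rw [← h1] at h2
    exact h2
  · intro h0
    refine hi ?_
    have h1 : star (w : Bd (L2L2 P μ)) * (w : Bd (L2L2 P μ)) = 0 := congrArg Subtype.val h0
    exact Subtype.ext (CStarRing.star_mul_self_eq_zero_iff _ |>.1 h1)
  · rw [tensorTrace_comm, tensorTrace_eq, tsum_eq_single i]
    · exact ENNReal.ofReal_lt_top
    · intro j hj
      have h1 : w * star w = J (p i) * (x * J (p i)) := by
        rw [hw, ← hx']
        simp only [w, mul_assoc]
      rw [h1]
      change ENNReal.ofReal (RCLike.re ⟪_, ampOp P (p i) ((x : Bd (L2L2 P μ))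
        (ampOp P (p i) (constEmb P μ (e j))))⟫_ℂ) = 0
      rw [ampOp_constEmb]
      have h2 : p i (e j) = 0 := by
        have := hilbertBasis_inner e i j
        rw [if_neg (Ne.symm hj)] at this
        simp [p, this]
      rw [h2]
      simp

/-- The supremum taken in `M` is the one taken in `B(K)`: the latter is a strong limit, so it still
commutes with `L^∞(Ω) ⊗ 1`. The trace is a sum of quadratic forms, each continuous along the net,
and suprema of directed families pass through sums in `[0, ∞]`. -/
theorem tensorTrace_normal (s : Set (Elt (tensorVN P μ))) (x : Elt (tensorVN P μ))
    (hne : s.Nonempty) (h0 : ∀ y ∈ s, 0 ≤ (y : Bd (L2L2 P μ))) (hd : DirectedOn (· ≤ ·) s)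
    (hx : IsLUB s x) : tensorTrace P μ x = ⨆ y ∈ s, tensorTrace P μ y := by
  obtain ⟨y, hy, hyc, hyq⟩ := exists_isLUB_of_directedOn (s := Subtype.val '' s)
    (hne.image _) (by
      rintro _ ⟨a, ha, rfl⟩ _ ⟨b, hb, rfl⟩
      obtain ⟨c, hc, hac, hbc⟩ := hd a ha b hb
      exact ⟨c, ⟨c, hc, rfl⟩, hac, hbc⟩)
    (by rintro _ ⟨a, ha, rfl⟩; exact h0 a ha) (x := (x : Bd (L2L2 P μ)))
    (by rintro _ ⟨a, ha, rfl⟩; exact hx.1 ha)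
  have hyM : y ∈ (tensorVN P μ).toStarSubalgebra := mem_tensorVN_iff.2 fun f =>
    (hyc _ (by rintro _ ⟨a, ha, rfl⟩; exact (mulOp_comm a f).symm)).symm
  have hxy : x = ⟨y, hyM⟩ := by
    refine hx.unique ⟨fun a ha => hy.1 ⟨a, ha, rfl⟩, fun b hb => ?_⟩
    exact hy.2 (by rintro _ ⟨a, ha, rfl⟩; exact hb ha)
  have := hne.to_subtype
  rw [hxy, tensorTrace_eq]
  have h1 : ∀ ξ, ENNReal.ofReal (RCLike.re ⟪ξ, y ξ⟫_ℂ) =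
      ⨆ a : s, ENNReal.ofReal (RCLike.re ⟪ξ, ((a : Elt (tensorVN P μ)) : Bd (L2L2 P μ)) ξ⟫_ℂ) := by
    intro ξ
    rw [hyq]
    refine le_antisymm (iSup_le ?_) (iSup_le fun a => ?_)
    · rintro ⟨_, a, ha, rfl⟩
      exact le_iSup (fun a : s => ENNReal.ofReal
        (RCLike.re ⟪ξ, ((a : Elt (tensorVN P μ)) : Bd (L2L2 P μ)) ξ⟫_ℂ)) ⟨a, ha⟩
    · exact le_iSup (fun a : (Subtype.val '' s : Set (Bd (L2L2 P μ))) => ENNReal.ofReal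
        (RCLike.re ⟪ξ, (a : Bd (L2L2 P μ)) ξ⟫_ℂ)) ⟨_, a, a.2, rfl⟩
  simp only [h1]
  rw [ENNReal.tsum_eq_iSup_sum, iSup_subtype']
  have h2 : ∀ t : Finset (basisIndex (L2 μ)), ∑ i ∈ t, ⨆ a : s, ENNReal.ofReal (RCLike.re
      ⟪constEmb P μ (basis (L2 μ) i), ((a : Elt (tensorVN P μ)) : Bd (L2L2 P μ))
        (constEmb P μ (basis (L2 μ) i))⟫_ℂ) = ⨆ a : s, ∑ i ∈ t, ENNReal.ofReal (RCLike.re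
      ⟪constEmb P μ (basis (L2 μ) i), ((a : Elt (tensorVN P μ)) : Bd (L2L2 P μ))
        (constEmb P μ (basis (L2 μ) i))⟫_ℂ) := by
    intro t
    refine ENNReal.finsetSum_iSup fun a b => ?_
    obtain ⟨c, hc, hac, hbc⟩ := hd a a.2 b b.2
    exact ⟨⟨c, hc⟩, fun i => ⟨ENNReal.ofReal_le_ofReal (re_inner_mono hac _),
      ENNReal.ofReal_le_ofReal (re_inner_mono hbc _)⟩⟩
  simp only [h2]
  rw [iSup_comm]
  refine iSup_congr fun a => ?_
  rw [tensorTrace_eq, ENNReal.tsum_eq_iSup_sum]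

variable (P μ) in
theorem isNSFTrace_tensorTrace : IsNSFTrace (tensorVN P μ) (tensorTrace P μ) where
  add := tensorTrace_add
  smul c x _ := tensorTrace_smul c x
  trace := tensorTrace_comm
  faithful := tensorTrace_faithful
  semifinite := tensorTrace_semifinite
  normal := tensorTrace_normal

/-- With `r = √m`, one has `V m V* = (Vr)(Vr)*` and `(Vr)*(Vr) = m`, so the trace property suffices.
-/
theorem tensorTrace_conj (V m : Elt (tensorVN P μ)) (hV : star V * V = 1)
    (hm : 0 ≤ (m : Bd (L2L2 P μ))) : tensorTrace P μ (V * m * star V) = tensorTrace P μ m := by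
  obtain ⟨r, -, hr, hrr, hrc⟩ := exists_sqrt hm
  let r' : Elt (tensorVN P μ) := ⟨r, mem_tensorVN_of_commute m.2 hrc⟩
  have hr' : star r' = r' := Subtype.ext hr
  have hm' : r' * r' = m := Subtype.ext hrr
  have h1 : V * m * star V = (V * r') * star (V * r') := by
    rw [star_mul, hr', ← hm']
    simp only [mul_assoc]
  have h2 : star (V * r') * (V * r') = m := by
    rw [star_mul, hr', ← hm']
    calc r' * star V * (V * r') = r' * (star V * V) * r' := by simp only [mul_assoc]
      _ = _ := by rw [hV, mul_one]
  rw [h1, ← tensorTrace_comm, h2]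

end Finite

/-! ### The embedding `z ↦ 1 ⊗ z` and the expectation onto its range. -/

section Probability

variable [IsProbabilityMeasure P]

theorem meanExp_ampHom (z : Bd (L2 μ)) : meanExp P μ (ampHom P μ z) = z := by
  refine ContinuousLinearMap.ext fun ξ => ext_inner_left ℂ fun η => ?_
  rw [meanExp_apply, coe_ampHom, ampOp_constEmb, inner_constEmb]

theorem continuous_ampHom : Continuous[weakStar (L2 μ), weakStarVN (tensorVN P μ)] (ampHom P μ) :=
  continuous_induced_rng.2 continuous_ampOp

theorem continuous_meanExp : Continuous[weakStarVN (tensorVN P μ), weakStar (L2 μ)] (meanExp P μ) :=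
  @Continuous.comp _ _ _ (weakStarVN _) (weakStar _) (weakStar _) _ _
    (continuous_weakStar_comp (constEmb P μ).adjoint (constEmb P μ)) continuous_induced_dom

variable (P μ) in
theorem isTracePreservingEmbedding_ampHom :
    IsTracePreservingEmbedding (tensorVN P μ) (tensorTrace P μ) (ampHom P μ) where
  normal := continuous_ampHom
  injective := Function.LeftInverse.injective meanExp_ampHom
  trace z _ := by rw [tensorTrace, meanExp_ampHom]

variable (P μ) in
theorem isConditionalExpectation_meanExp :
    IsConditionalExpectation (tensorVN P μ) (tensorTrace P μ) (ampHom P μ) (meanExp P μ) where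
  left_inv := meanExp_ampHom
  bimodule a b m := by
    refine ContinuousLinearMap.ext fun ξ => ext_inner_left ℂ fun η => ?_
    rw [meanExp_apply]
    change ⟪_, ampOp P a ((m : Bd (L2L2 P μ)) (ampOp P b (constEmb P μ ξ)))⟫_ℂ =
      ⟪η, a (meanExp P μ m (b ξ))⟫_ℂ
    rw [ampOp_constEmb, ← ContinuousLinearMap.adjoint_inner_left,
      ← ContinuousLinearMap.adjoint_inner_left a, ← ContinuousLinearMap.star_eq_adjoint, star_ampOp,
      ampOp_constEmb, meanExp_apply, ContinuousLinearMap.star_eq_adjoint]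
  pos m hm := by
    rw [ContinuousLinearMap.nonneg_iff_isPositive] at hm ⊢
    exact hm.adjoint_conj _
  faithful m hm h := tensorTrace_faithful m hm (by
    rw [tensorTrace, h]
    simp [opTrace])
  normal := continuous_meanExp
  trace _ _ := rfl

end Probability

end Trace

/-! ### Injectivity -/

section Injective

variable {K : Type*} [NormedAddCommGroup K] [InnerProductSpace ℂ K] [CompleteSpace K]

theorem exists_tendsto_ultrafilter {β : Type*} (𝒰 : Ultrafilter β) {a : β → ℂ} {C : ℝ}
    (h : ∀ s, ‖a s‖ ≤ C) : ∃ c, Filter.Tendsto a 𝒰 (𝓝 c) ∧ ‖c‖ ≤ C := by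
  obtain ⟨c, hc, hle⟩ := (isCompact_closedBall (0 : ℂ) C).ultrafilter_le_nhds (𝒰.map a)
    (by
      rw [Filter.le_principal_iff, Ultrafilter.coe_map, Filter.mem_map]
      exact Filter.Eventually.of_forall fun s => by simpa using h s)
  exact ⟨c, hle, by simpa using hc⟩

/-- Bounded families of operators converge weakly along ultrafilters. -/
theorem exists_weak_limit {β : Type*} (𝒰 : Ultrafilter β) {x : β → Bd K} {C : ℝ}
    (h : ∀ s, ‖x s‖ ≤ C) : ∃ y : Bd K, ‖y‖ ≤ C ∧
      ∀ ξ η, Filter.Tendsto (fun s => ⟪η, x s ξ⟫_ℂ) 𝒰 (𝓝 ⟪η, y ξ⟫_ℂ) := by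
  have hb : ∀ ξ η s, ‖⟪x s ξ, η⟫_ℂ‖ ≤ C * ‖ξ‖ * ‖η‖ := fun ξ η s =>
    (norm_inner_le_norm _ _).trans (by gcongr; exact (x s).le_of_opNorm_le (h s) ξ)
  choose B hB hBn using fun ξ η => exists_tendsto_ultrafilter 𝒰 (hb ξ η)
  let B' : K →L⋆[ℂ] K →L[ℂ] ℂ := LinearMap.mkContinuous₂
    (LinearMap.mk₂'ₛₗ (starRingEnd ℂ) (RingHom.id ℂ) B
      (fun ξ ξ' η => tendsto_nhds_unique (hB _ _) (((hB ξ η).add (hB ξ' η)).congr fun s => by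
        rw [map_add, inner_add_left]))
      (fun c ξ η => tendsto_nhds_unique (hB _ _) (((hB ξ η).const_mul _).congr fun s => by
        rw [map_smul, inner_smul_left]))
      (fun ξ η η' => tendsto_nhds_unique (hB _ _) (((hB ξ η).add (hB ξ η')).congr fun s => by
        rw [inner_add_right]))
      (fun c ξ η => tendsto_nhds_unique (hB _ _) (((hB ξ η).const_mul _).congr fun s => by
        rw [inner_smul_right, RingHom.id_apply]))) C hBn
  let y : Bd K := InnerProductSpace.continuousLinearMapOfBilin B'
  have hy : ∀ ξ η, ⟪y ξ, η⟫_ℂ = B ξ η := fun ξ η =>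
    InnerProductSpace.continuousLinearMapOfBilin_apply B' ξ η
  refine ⟨y, ?_, fun ξ η => ?_⟩
  · obtain ⟨s⟩ := 𝒰.nonempty_of_mem Filter.univ_mem |>.to_type
    refine y.opNorm_le_bound ((norm_nonneg _).trans (h s)) fun ξ => ?_
    have h1 := hBn ξ (y ξ)
    rw [← hy, inner_self_eq_norm_sq_to_K] at h1
    have h2 : ‖y ξ‖ * ‖y ξ‖ ≤ C * ‖ξ‖ * ‖y ξ‖ := by
      rw [← sq]
      simpa using h1
    rcases (norm_nonneg (y ξ)).eq_or_lt with h0 | h0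
    · rw [← h0]
      exact mul_nonneg ((norm_nonneg _).trans (h s)) (norm_nonneg _)
    · exact le_of_mul_le_mul_right h2 h0
  · have h1 := (Complex.continuous_conj.tendsto _).comp (hB ξ η)
    rw [← hy, inner_conj_symm] at h1
    refine h1.congr fun s => ?_
    exact inner_conj_symm _ _

/-- There is a projection of norm one onto the commutant of a commuting family of symmetries. -/
theorem exists_projection_commutant {ι : Type*} (u : ι → Bd K) (hu : ∀ i, star (u i) = u i)
    (huu : ∀ i, u i * u i = 1) (hc : ∀ i j, Commute (u i) (u j)) :
    ∃ Φ : Bd K →L[ℂ] Bd K, (∀ x, ‖Φ x‖ ≤ ‖x‖) ∧ (∀ x i, Commute (u i) (Φ x)) ∧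
      ∀ x, (∀ i, Commute (u i) x) → Φ x = x := by
  classical
  have hun : ∀ i, ‖u i‖ ≤ 1 := fun i => by
    have h1 : ‖u i‖ * ‖u i‖ ≤ 1 := by
      rw [← CStarRing.norm_star_mul_self, hu, huu]
      exact ContinuousLinearMap.norm_id_le
    nlinarith [norm_nonneg (u i)]
  -- Average over the two-element group generated by conjugation with `u i`: this projects
  -- contractively onto the commutant of `u i`.
  let Ψ : ι → (Bd K →L[ℂ] Bd K) := fun i =>
    (2⁻¹ : ℂ) • (1 + ContinuousLinearMap.mulLeftRight ℂ (Bd K) (u i) (u i))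
  have hΨ : ∀ i x, Ψ i x = (2⁻¹ : ℂ) • (x + u i * x * u i) := fun i x => rfl
  have hcomm : ∀ i j, Commute (Ψ i) (Ψ j) := by
    intro i j
    refine ContinuousLinearMap.ext fun x => ?_
    change Ψ i (Ψ j x) = Ψ j (Ψ i x)
    have h1 : u i * (u j * x * u j) * u i = u j * (u i * x * u i) * u j := by
      have h2 := hc i j
      calc u i * (u j * x * u j) * u i = (u i * u j) * x * (u j * u i) := by simp only [mul_assoc]
        _ = (u j * u i) * x * (u i * u j) := by rw [h2.eq]
        _ = _ := by simp only [mul_assoc]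
    simp only [hΨ, mul_smul_comm, smul_mul_assoc, mul_add, add_mul, smul_add, h1]
    abel
  have hΨn : ∀ i x, ‖Ψ i x‖ ≤ ‖x‖ := by
    intro i x
    rw [hΨ, norm_smul]
    have h1 : ‖u i * x * u i‖ ≤ ‖x‖ := by
      calc _ ≤ ‖u i‖ * ‖x‖ * ‖u i‖ := (norm_mul_le _ _).trans (by gcongr; exact norm_mul_le _ _)
        _ ≤ 1 * ‖x‖ * 1 := by gcongr <;> exact hun i
        _ = _ := by ring
    have h2 := norm_add_le x (u i * x * u i)
    simp only [norm_inv, RCLike.norm_ofNat]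
    linarith
  have hΨc : ∀ i x, Commute (u i) (Ψ i x) := by
    intro i x
    change u i * Ψ i x = Ψ i x * u i
    simp only [hΨ, mul_smul_comm, smul_mul_assoc, mul_add, add_mul]
    have h1 : u i * (u i * x * u i) = x * u i := by
      calc _ = (u i * u i) * x * u i := by simp only [mul_assoc]
        _ = _ := by rw [huu, one_mul]
    have h2 : u i * x * u i * u i = u i * x := by rw [mul_assoc, huu, mul_one]
    rw [h1, h2, add_comm]
  have hΨf : ∀ i x, Commute (u i) x → Ψ i x = x := by
    intro i x h
    rw [hΨ, h.eq, mul_assoc, huu, mul_one, ← two_smul ℂ x, smul_smul]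
    norm_num
  let Φ : Finset ι → (Bd K →L[ℂ] Bd K) := fun s =>
    s.noncommProd Ψ fun i _ j _ _ => hcomm i j
  have hΦn : ∀ s x, ‖Φ s x‖ ≤ ‖x‖ := by
    intro s
    refine Finset.noncommProd_induction s Ψ _ (fun T => ∀ x, ‖T x‖ ≤ ‖x‖) ?_ ?_ ?_
    · exact fun S T hS hT x => (hS _).trans (hT x)
    · exact fun x => le_rfl
    · exact fun i _ => hΨn i
  have hΦf : ∀ s x, (∀ i, Commute (u i) x) → Φ s x = x := by
    intro s x hx
    refine Finset.noncommProd_induction s Ψ _ (fun T => T x = x) ?_ ?_ ?_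
    · intro S T hS hT
      change S (T x) = x
      rw [hT, hS]
    · rfl
    · exact fun i _ => hΨf i x (hx i)
  -- The averages commute, so the one for `i` may be performed last, and its range commutes with `u
  -- i`.
  have hΦc : ∀ s i x, i ∈ s → Commute (u i) (Φ s x) := by
    intro s i x hi
    have h1 := Finset.mul_noncommProd_erase s hi Ψ (fun i _ j _ _ => hcomm i j)
    have h2 : Φ s x = Ψ i ((s.erase i).noncommProd Ψ (fun i _ j _ _ => hcomm i j) x) := by
      change s.noncommProd Ψ _ x = _
      rw [← h1]
      rfl
    rw [h2]
    exact hΨc i _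
  -- Along an ultrafilter finer than `atTop`, each `i` eventually lies in `s`; the weak limit
  -- therefore commutes with every `u i`.
  let 𝒰 : Ultrafilter (Finset ι) := Ultrafilter.of Filter.atTop
  have h𝒰 : (𝒰 : Filter (Finset ι)) ≤ Filter.atTop := Ultrafilter.of_le _
  choose Λ hΛn hΛ using fun x : Bd K => exists_weak_limit 𝒰 (fun s => hΦn s x)
  let Λ' : Bd K →L[ℂ] Bd K := LinearMap.mkContinuous
    { toFun := Λ
      map_add' := fun x y => ContinuousLinearMap.ext fun ξ => ext_inner_left ℂ fun η =>
        tendsto_nhds_unique (hΛ (x + y) ξ η) (by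
          have h := (hΛ x ξ η).add (hΛ y ξ η)
          rw [← inner_add_right] at h
          refine h.congr fun s => ?_
          rw [map_add, add_apply, inner_add_right])
      map_smul' := fun c x => ContinuousLinearMap.ext fun ξ => ext_inner_left ℂ fun η =>
        tendsto_nhds_unique (hΛ (c • x) ξ η) (by
          have h := (hΛ x ξ η).const_mul c
          rw [← inner_smul_right] at h
          refine h.congr fun s => ?_
          rw [map_smul, smul_apply, inner_smul_right]) } 1
    fun x => by rw [one_mul]; exact hΛn x
  refine ⟨Λ', hΛn, fun x i => ?_, fun x hx => ?_⟩
  · refine ContinuousLinearMap.ext fun ξ => ext_inner_left ℂ fun η => ?_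
    change ⟪η, u i (Λ x ξ)⟫_ℂ = ⟪η, Λ x (u i ξ)⟫_ℂ
    rw [← ContinuousLinearMap.adjoint_inner_left]
    refine tendsto_nhds_unique_of_eventuallyEq (hΛ x ξ _) (hΛ x (u i ξ) η) ?_
    filter_upwards [h𝒰 (Filter.mem_atTop {i})] with s hs
    rw [ContinuousLinearMap.adjoint_inner_left]
    have := DFunLike.congr_fun (hΦc s i x (hs (Finset.mem_singleton_self i))) ξ
    change u i (Φ s x ξ) = Φ s x (u i ξ) at this
    rw [this]
  · refine ContinuousLinearMap.ext fun ξ => ext_inner_left ℂ fun η => ?_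
    refine tendsto_nhds_unique (hΛ x ξ η) ?_
    simp only [hΦf _ x hx]
    exact tendsto_const_nhds

variable {Ω : Type*} [MeasurableSpace Ω] {P : Measure Ω} {X : Type*} [MeasurableSpace X]
  {μ : Measure X} [IsFiniteMeasure P]

theorem mulOp_indTop_apply {s : Set Ω} (hs : MeasurableSet s) (F : L2L2 P μ) :
    mulOp μ (indTop P hs) F =ᵐ[P] s.indicator F := by
  filter_upwards [mulOp_apply (indTop P hs) F,
    indicatorConstLp_coeFn (p := ∞) (hs := hs) (hμs := measure_ne_top P s) (c := (1 : ℂ))]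
    with ω h1 h2
  rw [h1, indTop, h2]
  by_cases h : ω ∈ s <;> simp [h]

/-- The functions `ω ↦ ⟪a* G(ω), F(ω)⟫` and `ω ↦ ⟪G(ω), (aF)(ω)⟫` have the same integral over every
measurable set, so they agree almost everywhere and can be multiplied by any bounded `f`. -/
theorem mem_tensorVN_of_commute_indTop {a : Bd (L2L2 P μ)}
    (h : ∀ (s : Set Ω) (hs : MeasurableSet s), Commute (mulOp μ (indTop P hs)) a) :
    a ∈ (tensorVN P μ).toStarSubalgebra := by
  refine mem_tensorVN_iff.2 fun f => ContinuousLinearMap.ext fun F => ext_inner_left ℂ fun G => ?_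
  change ⟪G, mulOp μ f (a F)⟫_ℂ = ⟪G, a (mulOp μ f F)⟫_ℂ
  rw [← ContinuousLinearMap.adjoint_inner_left a]
  have h1 : (fun ω => ⟪a.adjoint G ω, F ω⟫_ℂ) =ᵐ[P] fun ω => ⟪G ω, a F ω⟫_ℂ := by
    refine Integrable.ae_eq_of_forall_setIntegral_eq _ _ (L2.integrable_inner (𝕜 := ℂ) _ _)
      (L2.integrable_inner (𝕜 := ℂ) _ _) fun s hs _ => ?_
    have h2 := congrArg (fun v => ⟪G, v⟫_ℂ) (DFunLike.congr_fun (h s hs) F)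
    change ⟪G, mulOp μ _ (a F)⟫_ℂ = ⟪G, a (mulOp μ _ F)⟫_ℂ at h2
    rw [← ContinuousLinearMap.adjoint_inner_left a, L2.inner_def, L2.inner_def] at h2
    have e : ∀ G F : L2L2 P μ, ∫ ω, ⟪G ω, mulOp μ (indTop P hs) F ω⟫_ℂ ∂P =
        ∫ ω in s, ⟪G ω, F ω⟫_ℂ ∂P := by
      intro G F
      rw [← integral_indicator hs]
      refine integral_congr_ae ?_
      filter_upwards [mulOp_indTop_apply hs F] with ω h3
      rw [h3]
      by_cases h : ω ∈ s <;> simp [h]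
    rw [e, e] at h2
    exact h2.symm
  rw [L2.inner_def, L2.inner_def]
  refine integral_congr_ae ?_
  filter_upwards [h1, mulOp_apply f (a F), mulOp_apply f F] with ω h2 h3 h4
  rw [h3, h4, inner_smul_right, inner_smul_right, h2]

variable (P μ) in
-- `M` is the commutant of the indicators of measurable sets, hence of the commuting symmetries
-- `2·1_s - 1`, and one averages over these.
theorem isInjectiveVN_tensorVN : IsInjectiveVN (tensorVN P μ) := by
  let p : {s : Set Ω // MeasurableSet s} → Bd (L2L2 P μ) := fun s => mulOp μ (indTop P s.2)
  have hpp : ∀ s, p s * p s = p s := fun s => ContinuousLinearMap.ext fun F => Lp.ext <| by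
    filter_upwards [mulOp_indTop_apply s.2 F, mulOp_indTop_apply s.2 (p s F)] with ω h1 h2
    change mulOp μ (indTop P s.2) (p s F) ω = mulOp μ (indTop P s.2) F ω
    rw [h2, h1]
    by_cases h : ω ∈ s.1
    · rw [Set.indicator_of_mem h, ← h1]
    · simp [h]
  have hps : ∀ s, star (p s) = p s := fun s => by
    change star (mulOp μ (indTop P s.2)) = mulOp μ (indTop P s.2)
    rw [star_mulOp]
    congr 1
    refine Lp.ext ?_
    filter_upwards [Lp.coeFn_star (indTop P s.2), indicatorConstLp_coeFn (p := ∞) (hs := s.2)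
      (hμs := measure_ne_top P s.1) (c := (1 : ℂ))] with ω h1 h2
    rw [h1, Pi.star_apply, indTop, h2]
    by_cases h : ω ∈ s.1 <;> simp [h]
  let u : {s : Set Ω // MeasurableSet s} → Bd (L2L2 P μ) := fun s => (2 : ℂ) • p s - 1
  have hiff : ∀ s a, Commute (u s) a ↔ Commute (p s) a := by
    intro s a
    constructor
    · intro h
      have h1 : p s = (2⁻¹ : ℂ) • (u s + 1) := by
        simp only [u, sub_add_cancel, smul_smul]
        norm_num
      rw [h1]
      exact (h.add_left (Commute.one_left a)).smul_left _
    · exact fun h => (h.smul_left _).sub_left (Commute.one_left a)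
  obtain ⟨Φ, h1, h2, h3⟩ := exists_projection_commutant u
    (fun s => by simp [u, hps]) (fun s => by
      simp only [u, mul_sub, sub_mul, mul_smul_comm, smul_mul_assoc, hpp, one_mul, mul_one]
      rw [two_smul ℂ (p s), add_sub_cancel_right, two_smul ℂ (p s), sub_sub_cancel])
    (fun s t => (hiff s _).2 ((hiff t _).2 (mulOp_comm_mulOp _ _)).symm)
  refine ⟨Φ, h1, fun x => mem_tensorVN_of_commute_indTop fun s hs => ?_,
    fun x hx => h3 x fun s => ?_⟩
  · exact (hiff ⟨s, hs⟩ _).1 (h2 x _)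
  · exact (hiff s _).2 (mem_tensorVN_iff.1 hx _)

end Injective

/-! ### The isonormal process on a real Hilbert space -/

section Isonormal

variable {G : Type*} [NormedAddCommGroup G] [InnerProductSpace ℝ G]

/-- The measure `ν` on `ℝ^G` gives full mass to linearity at any given vectors. -/
structure AELinear (ν : Measure (G → ℝ)) : Prop where
  add : ∀ g g' : G, ∀ᵐ ω ∂ν, ω (g + g') = ω g + ω g'
  smul : ∀ (c : ℝ) (g : G), ∀ᵐ ω ∂ν, ω (c • g) = c * ω g

namespace AELinear

variable {ν ν' : Measure (G → ℝ)}

theorem zero (h : AELinear ν) : ∀ᵐ ω ∂ν, ω (0 : G) = 0 := by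
  filter_upwards [h.smul 0 0] with ω hω
  simpa using hω

theorem neg (h : AELinear ν) (g : G) : ∀ᵐ ω ∂ν, ω (-g) = -ω g := by
  filter_upwards [h.smul (-1) g] with ω hω
  simpa using hω

theorem sub (h : AELinear ν) (g g' : G) : ∀ᵐ ω ∂ν, ω (g - g') = ω g - ω g' := by
  filter_upwards [h.add g (-g'), h.neg g'] with ω h1 h2
  rw [sub_eq_add_neg, h1, h2, sub_eq_add_neg]

theorem sum (h : AELinear ν) {ι : Type*} (s : Finset ι) (c : ι → ℝ) (g : ι → G) :
    ∀ᵐ ω ∂ν, ω (∑ i ∈ s, c i • g i) = ∑ i ∈ s, c i * ω (g i) := by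
  classical
  induction s using Finset.induction_on with
  | empty => simpa using h.zero
  | insert i s hi ih =>
    filter_upwards [ih, h.add (c i • g i) (∑ i ∈ s, c i • g i), h.smul (c i) (g i)]
      with ω h1 h2 h3
    rw [Finset.sum_insert hi, Finset.sum_insert hi, h2, h1, h3]

/-- An almost everywhere linear finite measure on `ℝ^G` is determined by its Fourier transform. -/
theorem ext_of_integral_exp (h : AELinear ν) (h' : AELinear ν') [IsFiniteMeasure ν]
    [IsFiniteMeasure ν']
    (heq : ∀ g : G, ∫ ω, Complex.exp (Complex.I * (ω g : ℂ)) ∂ν =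
      ∫ ω, Complex.exp (Complex.I * (ω g : ℂ)) ∂ν') : ν = ν' := by
  classical
  have key : ∀ I : Finset G, ν.map I.restrict = ν'.map I.restrict := by
    intro I
    have hI : Measurable (I.restrict : (G → ℝ) → (I → ℝ)) := Finset.measurable_restrict I
    -- A functional `L` on `ℝ^I` has coefficients `c_i`, and almost everywhere linearity gives `∑
    -- c_i ω(i) = ω(∑ c_i i)`. The characteristic function of the marginal at `L` is thus the
    -- Fourier transform at one vector.
    refine Measure.ext_of_charFunDual (funext fun L => ?_)
    have h1 : ∀ y : I → ℝ, L y = ∑ i : I, L (Pi.single i 1) * y i := by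
      intro y
      conv_lhs => rw [← Finset.univ_sum_single y, map_sum]
      refine Finset.sum_congr rfl fun i _ => ?_
      have h2 : Pi.single i (y i) = y i • (Pi.single i 1 : I → ℝ) := by
        rw [← Pi.single_smul, smul_eq_mul, mul_one]
      rw [h2, map_smul, smul_eq_mul, mul_comm]
    have h3 : ∀ ρ : Measure (G → ℝ), AELinear ρ → charFunDual (ρ.map I.restrict) L =
        ∫ ω, Complex.exp (Complex.I *
          (ω (∑ i : I, L (Pi.single i 1) • (i : G)) : ℂ)) ∂ρ := by
      intro ρ hρ
      rw [charFunDual_apply, integral_map hI.aemeasurable]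
      · refine integral_congr_ae ?_
        filter_upwards [hρ.sum Finset.univ (fun i : I => L (Pi.single i 1)) (fun i => (i : G))]
          with ω hω
        rw [hω, h1, mul_comm]
        rfl
      · have : Continuous fun v : I → ℝ => Complex.exp ((L v : ℂ) * Complex.I) := by fun_prop
        exact this.aestronglyMeasurable
    rw [h3 ν h, h3 ν' h', heq]
  have hp : IsProjectiveLimit ν' fun I => ν.map I.restrict := fun I => (key I).symm
  have hp' : IsProjectiveLimit ν fun I => ν.map I.restrict := fun I => rfl
  exact hp'.unique hp

end AELinear

/-- The law on `ℝ^G` of an isonormal process. -/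
structure IsIsonormalLaw (P : Measure (G → ℝ)) : Prop where
  aelinear : AELinear P
  memLp : ∀ g : G, MemLp (fun ω : G → ℝ => ω g) 2 P
  integral_mul : ∀ g g' : G, ∫ ω, ω g * ω g' ∂P = ⟪g, g'⟫_ℝ
  integral_exp : ∀ g : G, ∫ ω, Complex.exp (Complex.I * (ω g : ℂ)) ∂P =
    Complex.exp (-(‖g‖ ^ 2 / 2 : ℝ))

theorem measurable_exp_I_eval {G : Type*} (g : G) :
    Measurable fun ω : G → ℝ => Complex.exp (Complex.I * (ω g : ℂ)) :=
  Complex.measurable_exp.comp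
    ((Complex.measurable_ofReal.comp (measurable_pi_apply g)).const_mul Complex.I)

theorem norm_exp_I_sub_le (a b : ℝ) :
    ‖Complex.exp (Complex.I * a) - Complex.exp (Complex.I * b)‖ ≤ |a - b| := by
  have h1 : Complex.exp (Complex.I * a) - Complex.exp (Complex.I * b) =
      Complex.exp (Complex.I * b) * (Complex.exp (Complex.I * ((a - b : ℝ) : ℂ)) - 1) := by
    rw [mul_sub, ← Complex.exp_add, mul_one]
    congr 2
    push_cast
    ring
  rw [h1, norm_mul, mul_comm Complex.I (b : ℂ), Complex.norm_exp_ofReal_mul_I, one_mul]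
  exact Real.norm_exp_I_mul_ofReal_sub_one_le

/-! ### Existence of an isonormal law, from independent standard Gaussian variables. -/

section Construction

variable (ι : Type*)

/-- The countable or uncountable product of standard Gaussian measures. -/
def stdProd : Measure (ι → ℝ) := Measure.infinitePi fun _ => gaussianReal 0 1

instance : IsProbabilityMeasure (stdProd ι) := by
  unfold stdProd
  infer_instance

variable {ι}

theorem memLp_eval_stdProd (i : ι) : MemLp (fun ω : ι → ℝ => ω i) 2 (stdProd ι) :=
  (memLp_id_gaussianReal' (μ := 0) (v := 1) 2 (by simp)).comp_measurePreserving
    (measurePreserving_eval_infinitePi _ i)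

theorem integral_eval_mul_eval_stdProd [DecidableEq ι] (i j : ι) :
    ∫ ω, ω i * ω j ∂(stdProd ι) = if i = j then 1 else 0 := by
  have hmean : ∀ i : ι, ∫ ω, ω i ∂(stdProd ι) = 0 := fun i => by
    have := (measurePreserving_eval_infinitePi (fun _ : ι => gaussianReal 0 1) i)
    have h2 := integral_map (μ := stdProd ι) (φ := fun ω : ι → ℝ => ω i) (f := fun x : ℝ => x)
      (measurable_pi_apply i).aemeasurable aestronglyMeasurable_id
    rw [← h2, stdProd, Measure.infinitePi_map_eval, integral_id_gaussianReal]
  split_ifs with h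
  · subst h
    have h2 := integral_map (μ := stdProd ι) (φ := fun ω : ι → ℝ => ω i)
      (f := fun x : ℝ => x * x) (measurable_pi_apply i).aemeasurable
      (by fun_prop)
    rw [← h2, stdProd, Measure.infinitePi_map_eval]
    have h3 := variance_of_integral_eq_zero (μ := gaussianReal 0 1) (X := id)
      aemeasurable_id (by simp)
    rw [variance_id_gaussianReal] at h3
    simpa [sq] using h3.symm
  · have hind : IndepFun (fun ω : ι → ℝ => ω i) (fun ω => ω j) (stdProd ι) :=
      (iIndepFun_infinitePi (P := fun _ : ι => gaussianReal 0 1) (X := fun _ x => x)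
        (by fun_prop)).indepFun h
    rw [hind.integral_fun_mul_eq_mul_integral (measurable_pi_apply i).aestronglyMeasurable
      (measurable_pi_apply j).aestronglyMeasurable, hmean, zero_mul]

theorem integral_exp_sum_stdProd (s : Finset ι) (c : ι → ℝ) :
    ∫ ω, Complex.exp (Complex.I * ((∑ i ∈ s, c i * ω i : ℝ) : ℂ)) ∂(stdProd ι) =
      Complex.exp (-((∑ i ∈ s, c i ^ 2) / 2 : ℝ)) := by
  obtain ⟨f, hf⟩ : ∃ f : (s → ℝ) → ℂ, f = fun y => ∏ i : s, Complex.exp (c i * y i * Complex.I) :=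
    ⟨_, rfl⟩
  have h1 : ∀ ω : ι → ℝ, Complex.exp (Complex.I * ((∑ i ∈ s, c i * ω i : ℝ) : ℂ)) =
      f (s.restrict ω) := by
    intro ω
    rw [hf]
    change _ = ∏ i : s, Complex.exp (c i * ω i * Complex.I)
    rw [← Complex.exp_sum, ← Finset.sum_mul, mul_comm, ← Finset.sum_coe_sort s]
    push_cast
    rfl
  simp only [h1]
  have hm : Continuous f := by
    rw [hf]
    fun_prop
  refine (integral_restrict_infinitePi (μ := fun _ : ι => gaussianReal 0 1) (s := s) (f := f)
    hm.aestronglyMeasurable).trans ?_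
  rw [hf, integral_fintype_prod_eq_prod (fun (i : s) (y : ℝ) => Complex.exp (c i * y * Complex.I))]
  have h2 : ∀ i : s, ∫ y, Complex.exp (c i * y * Complex.I) ∂(gaussianReal 0 1) =
      Complex.exp (-((c i) ^ 2 / 2 : ℝ)) := by
    intro i
    rw [← charFun_apply_real, charFun_gaussianReal]
    congr 1
    push_cast
    simp
  simp only [h2]
  rw [← Complex.exp_sum, Finset.sum_coe_sort s fun i => (-((c i ^ 2 / 2 : ℝ) : ℂ))]
  congr 1
  push_cast
  rw [Finset.sum_neg_distrib, Finset.sum_div]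

end Construction

/-- The map `Z ↦ ∫ exp(iZ)` is 1-Lipschitz on `L²`, so the Gaussian formula passes from finite
linear combinations to their `L²` limits. -/
theorem norm_integral_exp_sub_le {Ω : Type*} [MeasurableSpace Ω] {Q : Measure Ω}
    [IsProbabilityMeasure Q] (Z Z' : Lp ℝ 2 Q) :
    ‖∫ ω, Complex.exp (Complex.I * (Z ω : ℂ)) ∂Q - ∫ ω, Complex.exp (Complex.I * (Z' ω : ℂ)) ∂Q‖ ≤
      ‖Z - Z'‖ := by
  have hintg : ∀ Z : Lp ℝ 2 Q, Integrable (fun ω => Complex.exp (Complex.I * (Z ω : ℂ))) Q := by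
    intro Z
    refine Integrable.of_bound (Complex.continuous_exp.comp_aestronglyMeasurable
        ((Complex.continuous_ofReal.comp_aestronglyMeasurable
          (Lp.aestronglyMeasurable Z)).const_mul Complex.I)) 1
      (Filter.Eventually.of_forall fun ω => ?_)
    rw [mul_comm, Complex.norm_exp_ofReal_mul_I]
  rw [← integral_sub (hintg Z) (hintg Z')]
  have h1 : Integrable (fun ω => ‖(Z - Z') ω‖) Q :=
    ((Lp.memLp (Z - Z')).integrable (by norm_num)).norm
  refine (norm_integral_le_integral_norm _).trans ?_
  calc _ ≤ ∫ ω, ‖(Z - Z') ω‖ ∂Q := by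
        refine integral_mono_ae ((hintg Z).sub (hintg Z')).norm h1 ?_
        filter_upwards [Lp.coeFn_sub Z Z'] with ω hω
        rw [hω]
        exact norm_exp_I_sub_le _ _
    _ = (eLpNorm (Z - Z') 1 Q).toReal := by
        rw [eLpNorm_one_eq_lintegral_enorm, ← integral_norm_eq_lintegral_enorm
          (Lp.aestronglyMeasurable _)]
    _ ≤ (eLpNorm (Z - Z') 2 Q).toReal := ENNReal.toReal_mono (Lp.memLp (Z - Z')).2.ne
        (eLpNorm_le_eLpNorm_of_exponent_le (by norm_num) (Lp.aestronglyMeasurable _))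
    _ = ‖Z - Z'‖ := (Lp.norm_def _).symm

theorem coeFn_sum_smul {Ω ι : Type*} [MeasurableSpace Ω] {Q : Measure Ω} (s : Finset ι) (c : ι → ℝ)
    (Y : ι → Lp ℝ 2 Q) :
    (∑ i ∈ s, c i • Y i : Lp ℝ 2 Q) =ᵐ[Q] fun ω => ∑ i ∈ s, c i * Y i ω := by
  classical
  induction s using Finset.induction_on with
  | empty =>
    filter_upwards [Lp.coeFn_zero ℝ 2 Q] with ω hω
    simpa using hω
  | insert i s hi ih =>
    rw [Finset.sum_insert hi]
    filter_upwards [ih, Lp.coeFn_add (c i • Y i) (∑ i ∈ s, c i • Y i), Lp.coeFn_smul (c i) (Y i)]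
      with ω h1 h2 h3
    rw [h2, Pi.add_apply, h1, h3, Pi.smul_apply, smul_eq_mul, Finset.sum_insert hi]

variable (G) in
-- Sending a Hilbert basis of `G` to independent standard Gaussian variables extends to an isometry
-- `W₀` from `G` into `L²`. The law is its joint distribution, a measure on `ℝ^G`.
theorem exists_isIsonormalLaw [CompleteSpace G] :
    ∃ P : Measure (G → ℝ), IsProbabilityMeasure P ∧ IsIsonormalLaw P := by
  classical
  obtain ⟨w, b, -⟩ := exists_hilbertBasis ℝ G
  let Q := stdProd w
  let Y : w → Lp ℝ 2 Q := fun i => (memLp_eval_stdProd i).toLp _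
  have hY : ∀ i, Y i =ᵐ[Q] fun ω => ω i := fun i => (memLp_eval_stdProd i).coeFn_toLp
  have hon : Orthonormal ℝ Y := by
    rw [orthonormal_iff_ite]
    intro i j
    rw [L2.inner_def, ← integral_eval_mul_eval_stdProd i j]
    refine integral_congr_ae ?_
    filter_upwards [hY i, hY j] with ω h1 h2
    rw [h1, h2]
    simp [mul_comm]
  let W₀ : G →ₗᵢ[ℝ] Lp ℝ 2 Q :=
    hon.orthogonalFamily.linearIsometry.comp b.repr.toLinearIsometry
  have hW₀ : ∀ g, HasSum (fun i => b.repr g i • Y i) (W₀ g) := fun g =>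
    hon.orthogonalFamily.hasSum_linearIsometry (b.repr g)
  have hexp : ∀ g, ∫ ω, Complex.exp (Complex.I * (W₀ g ω : ℂ)) ∂Q =
      Complex.exp (-(‖g‖ ^ 2 / 2 : ℝ)) := by
    intro g
    obtain ⟨c, hc⟩ : ∃ c : w → ℝ, ∀ i, c i = b.repr g i := ⟨fun i => b.repr g i, fun i => rfl⟩
    have hsum := hW₀ g
    simp only [← hc] at hsum
    have hcont : Continuous fun Z : Lp ℝ 2 Q => ∫ ω, Complex.exp (Complex.I * (Z ω : ℂ)) ∂Q :=
      (LipschitzWith.of_dist_le_mul (K := 1) fun Z Z' => by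
        rw [dist_eq_norm, dist_eq_norm, NNReal.coe_one, one_mul]
        exact norm_integral_exp_sub_le Z Z').continuous
    have h1 : Filter.Tendsto (fun s : Finset w => ∫ ω, Complex.exp (Complex.I *
        ((∑ i ∈ s, c i • Y i : Lp ℝ 2 Q) ω : ℂ)) ∂Q) Filter.atTop
        (𝓝 (∫ ω, Complex.exp (Complex.I * (W₀ g ω : ℂ)) ∂Q)) :=
      (hcont.tendsto _).comp hsum
    have h2 : ∀ s : Finset w, ∫ ω, Complex.exp (Complex.I *
        ((∑ i ∈ s, c i • Y i : Lp ℝ 2 Q) ω : ℂ)) ∂Q =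
        Complex.exp (-((∑ i ∈ s, c i ^ 2) / 2 : ℝ)) := by
      intro s
      rw [← integral_exp_sum_stdProd s c]
      refine integral_congr_ae ?_
      have h4 : ∀ᵐ ω ∂Q, ∀ i ∈ s, Y i ω = ω i := by
        rw [Filter.eventually_all_finset]
        exact fun i _ => hY i
      filter_upwards [coeFn_sum_smul s c Y, h4] with ω h5 h6
      rw [h5, Finset.sum_congr rfl fun i hi => by rw [h6 i hi]]
    have h3 : HasSum (fun i => c i ^ 2) (‖g‖ ^ 2) := by
      have h4 := b.hasSum_inner_mul_inner g g
      rw [real_inner_self_eq_norm_sq] at h4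
      have h5 : (fun i => c i ^ 2) = fun i => ⟪g, b i⟫_ℝ * ⟪b i, g⟫_ℝ := funext fun i => by
        rw [hc, b.repr_apply_apply, sq, real_inner_comm]
      rw [h5]
      exact h4
    simp only [h2] at h1
    refine tendsto_nhds_unique h1 ?_
    have hc : Continuous fun x : ℝ => Complex.exp (-(x / 2 : ℝ)) := by fun_prop
    exact (hc.tendsto _).comp h3
  -- A representative of `W₀ g` is fixed for each `g` separately. Linearity then holds only almost
  -- surely for given vectors, which is all that is required of the law.
  let Θ : (w → ℝ) → (G → ℝ) := fun ω g => W₀ g ω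
  have hΘ : Measurable Θ := measurable_pi_iff.2 fun g => (Lp.stronglyMeasurable (W₀ g)).measurable
  refine ⟨Q.map Θ, Measure.isProbabilityMeasure_map hΘ.aemeasurable, ⟨⟨fun g g' => ?_,
    fun c g => ?_⟩, fun g => ?_, fun g g' => ?_, fun g => ?_⟩⟩
  · rw [ae_map_iff hΘ.aemeasurable (measurableSet_eq_fun (by fun_prop) (by fun_prop))]
    filter_upwards [Lp.coeFn_add (W₀ g) (W₀ g')] with ω hω
    change W₀ (g + g') ω = W₀ g ω + W₀ g' ω
    rw [map_add, hω, Pi.add_apply]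
  · rw [ae_map_iff hΘ.aemeasurable (measurableSet_eq_fun (by fun_prop) (by fun_prop))]
    filter_upwards [Lp.coeFn_smul c (W₀ g)] with ω hω
    change W₀ (c • g) ω = c * W₀ g ω
    rw [map_smul, hω, Pi.smul_apply, smul_eq_mul]
  · rw [memLp_map_measure_iff (measurable_pi_apply g).aestronglyMeasurable hΘ.aemeasurable]
    exact Lp.memLp (W₀ g)
  · rw [integral_map hΘ.aemeasurable (by fun_prop), ← W₀.inner_map_map, L2.inner_def]
    refine integral_congr_ae (Filter.Eventually.of_forall fun ω => ?_)
    exact mul_comm _ _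
  · rw [integral_map hΘ.aemeasurable (measurable_exp_I_eval g).aestronglyMeasurable]
    exact hexp g

end Isonormal

/-! ### Consequences: Gaussian marginals, totality of exponentials and of products, invariance. -/

section Isonormal

variable {G : Type*} [NormedAddCommGroup G] [InnerProductSpace ℝ G] {P : Measure (G → ℝ)}

namespace IsIsonormalLaw

theorem aelinear_withDensity (hP : IsIsonormalLaw P) (f : (G → ℝ) → ℝ≥0∞) :
    AELinear (P.withDensity f) where
  add g g' := (withDensity_absolutelyContinuous P f).ae_le (hP.aelinear.add g g')
  smul c g := (withDensity_absolutelyContinuous P f).ae_le (hP.aelinear.smul c g)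

/-- The coordinate process. -/
def coord {G : Type*} (P : Measure (G → ℝ)) (g : G) : (G → ℝ) →ₘ[P] ℝ :=
  AEEqFun.mk (fun ω => ω g) (measurable_pi_apply g).aestronglyMeasurable

theorem coeFn_coord {G : Type*} {P : Measure (G → ℝ)} (g : G) :
    coord P g =ᵐ[P] fun ω => ω g :=
  AEEqFun.coeFn_mk _ _

/-- The coordinate process, as a linear map. -/
def process (hP : IsIsonormalLaw P) : G →ₗ[ℝ] ((G → ℝ) →ₘ[P] ℝ) where
  toFun := coord P
  map_add' g g' := AEEqFun.ext <| by
    filter_upwards [coeFn_coord (P := P) (g + g'), coeFn_coord (P := P) g, coeFn_coord (P := P) g',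
      AEEqFun.coeFn_add (coord P g) (coord P g'), hP.aelinear.add g g'] with ω h1 h2 h3 h4 h5
    rw [h1, h4, Pi.add_apply, h2, h3, h5]
  map_smul' c g := AEEqFun.ext <| by
    filter_upwards [coeFn_coord (P := P) (c • g), coeFn_coord (P := P) g,
      AEEqFun.coeFn_smul c (coord P g), hP.aelinear.smul c g] with ω h1 h2 h3 h4
    rw [h1, RingHom.id_apply, h3, Pi.smul_apply, h2, h4, smul_eq_mul]

theorem coeFn_process (hP : IsIsonormalLaw P) (g : G) : hP.process g =ᵐ[P] fun ω => ω g :=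
  coeFn_coord g

variable [IsProbabilityMeasure P]

theorem map_eval (hP : IsIsonormalLaw P) (g : G) :
    P.map (fun ω => ω g) = gaussianReal 0 (‖g‖₊ ^ 2) := by
  have hm : Measurable fun ω : G → ℝ => ω g := measurable_pi_apply g
  have : IsProbabilityMeasure (P.map fun ω => ω g) :=
    Measure.isProbabilityMeasure_map hm.aemeasurable
  refine Measure.ext_of_charFun (funext fun t => ?_)
  rw [charFun_apply_real, charFun_gaussianReal, integral_map hm.aemeasurable (by fun_prop)]
  have h1 := hP.integral_exp (t • g)
  have h2 : ∫ ω, Complex.exp (t * (ω g : ℂ) * Complex.I) ∂P =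
      ∫ ω, Complex.exp (Complex.I * (ω (t • g) : ℂ)) ∂P := by
    refine integral_congr_ae ?_
    filter_upwards [hP.aelinear.smul t g] with ω hω
    rw [hω]
    push_cast
    congr 1
    ring
  rw [h2, h1]
  congr 1
  rw [norm_smul, mul_pow, Real.norm_eq_abs, sq_abs]
  push_cast
  ring

theorem integrable_exp_mul (hP : IsIsonormalLaw P) (g : G) (t : ℝ) :
    Integrable (fun ω : G → ℝ => Real.exp (t * ω g)) P := by
  have h := integrable_exp_mul_gaussianReal (μ := 0) (v := ‖g‖₊ ^ 2) t
  rw [← hP.map_eval g] at h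
  exact h.comp_measurable (measurable_pi_apply g)

/-- A square-integrable majorant for the powers `W(g)^n` (up to `n!`) and for the exponential series
of `i W(g)`. -/
theorem memLp_exp_abs (hP : IsIsonormalLaw P) (g : G) :
    MemLp (fun ω : G → ℝ => Real.exp |ω g|) 2 P := by
  have hm : Measurable fun ω : G → ℝ => Real.exp |ω g| :=
    Real.measurable_exp.comp (measurable_pi_apply g).abs
  rw [memLp_two_iff_integrable_sq hm.aestronglyMeasurable]
  refine ((hP.integrable_exp_mul g 2).add (hP.integrable_exp_mul g (-2))).mono'
    (hm.pow_const 2).aestronglyMeasurable (Filter.Eventually.of_forall fun ω => ?_)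
  rw [Real.norm_of_nonneg (by positivity), ← Real.exp_nat_mul]
  change _ ≤ Real.exp (2 * ω g) + Real.exp (-2 * ω g)
  rcases abs_cases (ω g) with ⟨h, -⟩ | ⟨h, -⟩ <;> rw [h]
  · push_cast
    linarith [Real.exp_pos (-2 * ω g)]
  · rw [show ((2 : ℕ) : ℝ) * -ω g = -2 * ω g by push_cast; ring]
    linarith [Real.exp_pos (2 * ω g)]

theorem integrable_mul_exp_I {G : Type*} {P : Measure (G → ℝ)} {f : (G → ℝ) → ℂ}
    (hf : Integrable f P) (g : G) :
    Integrable (fun ω => f ω * Complex.exp (Complex.I * (ω g : ℂ))) P :=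
  hf.mul_bdd (c := 1) (measurable_exp_I_eval g).aestronglyMeasurable
    (Filter.Eventually.of_forall fun ω => by rw [mul_comm, Complex.norm_exp_ofReal_mul_I])

/-- The exponentials separate the integrable real functions. -/
theorem ae_eq_zero_of_integral_exp_real (hP : IsIsonormalLaw P) {f : (G → ℝ) → ℝ}
    (hf : Integrable f P)
    (h : ∀ g : G, ∫ ω, (f ω : ℂ) * Complex.exp (Complex.I * (ω g : ℂ)) ∂P = 0) : f =ᵐ[P] 0 := by
  have hfin : ∀ f : (G → ℝ) → ℝ, Integrable f P →
      IsFiniteMeasure (P.withDensity fun ω => ENNReal.ofReal (f ω)) := fun f hf =>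
    isFiniteMeasure_withDensity_ofReal hf.2
  have := hfin f hf
  have := hfin (-f) hf.neg
  have hintg : ∀ f : (G → ℝ) → ℝ, Integrable f P → ∀ g : G,
      ∫ ω, Complex.exp (Complex.I * (ω g : ℂ)) ∂(P.withDensity fun ω => ENNReal.ofReal (f ω)) =
        ∫ ω, ((max (f ω) 0 : ℝ) : ℂ) * Complex.exp (Complex.I * (ω g : ℂ)) ∂P := by
    intro f hf g
    rw [integral_withDensity_eq_integral_toReal_smul₀ hf.1.aemeasurable.ennreal_ofReal
      (Filter.Eventually.of_forall fun _ => ENNReal.ofReal_lt_top)]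
    refine integral_congr_ae (Filter.Eventually.of_forall fun ω => ?_)
    simp [ENNReal.toReal_ofReal']
  -- The measures with densities `f⁺` and `f⁻` are finite and almost everywhere linear. The
  -- hypothesis says that their Fourier transforms agree, so they coincide.
  have heq : (P.withDensity fun ω => ENNReal.ofReal (f ω)) =
      P.withDensity fun ω => ENNReal.ofReal ((-f) ω) := by
    refine (hP.aelinear_withDensity _).ext_of_integral_exp (hP.aelinear_withDensity _) fun g => ?_
    rw [hintg f hf, hintg (-f) hf.neg, ← sub_eq_zero, ← integral_sub, ← h g]
    · refine integral_congr_ae (Filter.Eventually.of_forall fun ω => ?_)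
      change ((max (f ω) 0 : ℝ) : ℂ) * _ - ((max (-f ω) 0 : ℝ) : ℂ) * _ = (f ω : ℂ) * _
      rw [← sub_mul, ← Complex.ofReal_sub, max_zero_sub_max_neg_zero_eq_self]
    · exact integrable_mul_exp_I hf.pos_part.ofReal g
    · exact integrable_mul_exp_I hf.neg.pos_part.ofReal g
  have h1 := (withDensity_eq_iff hf.1.aemeasurable.ennreal_ofReal
    hf.neg.1.aemeasurable.ennreal_ofReal hf.lintegral_lt_top.ne).1 heq
  filter_upwards [h1] with ω hω
  change ENNReal.ofReal (f ω) = ENNReal.ofReal (-f ω) at hω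
  rcases le_total 0 (f ω) with h0 | h0
  · rw [ENNReal.ofReal_of_nonpos (neg_nonpos.2 h0), ENNReal.ofReal_eq_zero] at hω
    exact le_antisymm hω h0
  · rw [ENNReal.ofReal_of_nonpos h0, eq_comm, ENNReal.ofReal_eq_zero] at hω
    exact le_antisymm h0 (neg_nonpos.1 hω)

/-- The exponentials separate the integrable functions. -/
theorem ae_eq_zero_of_integral_exp (hP : IsIsonormalLaw P) {f : (G → ℝ) → ℂ}
    (hf : Integrable f P)
    (h : ∀ g : G, ∫ ω, f ω * Complex.exp (Complex.I * (ω g : ℂ)) ∂P = 0) : f =ᵐ[P] 0 := by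
  have hcf : Integrable (fun ω => (starRingEnd ℂ) (f ω)) P :=
    (Complex.conjCLE : ℂ →L[ℝ] ℂ).integrable_comp hf
  -- Replacing `g` by `-g` conjugates the exponential, so the hypothesis passes to the conjugate of
  -- `f`, hence to its real and imaginary parts.
  have hconj : ∀ g : G,
      ∫ ω, (starRingEnd ℂ) (f ω) * Complex.exp (Complex.I * (ω g : ℂ)) ∂P = 0 := by
    intro g
    have h1 := congrArg (starRingEnd ℂ) (h (-g))
    rw [← integral_conj, map_zero] at h1
    rw [← h1]
    refine integral_congr_ae ?_
    filter_upwards [hP.aelinear.neg g] with ω hω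
    rw [map_mul, ← Complex.exp_conj, hω]
    simp
  have hre : (fun ω => (f ω).re) =ᵐ[P] 0 := by
    refine hP.ae_eq_zero_of_integral_exp_real hf.re fun g => ?_
    have : ∀ ω : G → ℝ, ((f ω).re : ℂ) * Complex.exp (Complex.I * (ω g : ℂ)) =
        (2⁻¹ : ℂ) * (f ω * Complex.exp (Complex.I * (ω g : ℂ)) +
          (starRingEnd ℂ) (f ω) * Complex.exp (Complex.I * (ω g : ℂ))) := by
      intro ω
      rw [Complex.re_eq_add_conj]
      ring
    simp only [this]
    rw [integral_const_mul, integral_add (integrable_mul_exp_I hf g) (integrable_mul_exp_I hcf g),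
      h, hconj]
    simp
  have him : (fun ω => (f ω).im) =ᵐ[P] 0 := by
    refine hP.ae_eq_zero_of_integral_exp_real hf.im fun g => ?_
    have : ∀ ω : G → ℝ, ((f ω).im : ℂ) * Complex.exp (Complex.I * (ω g : ℂ)) =
        ((2 * Complex.I)⁻¹ : ℂ) * (f ω * Complex.exp (Complex.I * (ω g : ℂ)) -
          (starRingEnd ℂ) (f ω) * Complex.exp (Complex.I * (ω g : ℂ))) := by
      intro ω
      rw [Complex.im_eq_sub_conj]
      ring
    simp only [this]
    rw [integral_const_mul, integral_sub (integrable_mul_exp_I hf g) (integrable_mul_exp_I hcf g),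
      h, hconj]
    simp
  filter_upwards [hre, him] with ω h1 h2
  exact Complex.ext h1 h2

theorem memLp_eval_pow (hP : IsIsonormalLaw P) (g : G) (n : ℕ) :
    MemLp (fun ω : G → ℝ => ω g ^ n) 2 P := by
  refine ((hP.memLp_exp_abs g).const_mul (n.factorial : ℝ)).mono
    ((measurable_pi_apply g).pow_const n).aestronglyMeasurable
    (Filter.Eventually.of_forall fun ω => ?_)
  rw [norm_pow, Real.norm_eq_abs, Real.norm_of_nonneg (by positivity)]
  have h := Real.pow_div_factorial_le_exp |ω g| (abs_nonneg _) n
  rwa [div_le_iff₀' (by positivity)] at h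

/-- For density, the powers `W(g)^n` suffice among the products. A function `f` orthogonal to them
is orthogonal to all `exp(i W(g))`, by expanding the exponential with the majorant `|f| exp|W(g)|`,
and exponentials separate functions. -/
theorem isIsonormal_process (hP : IsIsonormalLaw P) : IsIsonormal hP.process where
  gaussian g := ⟨‖g‖₊ ^ 2, by rw [Measure.map_congr (hP.coeFn_process g), hP.map_eval g]⟩
  covariance g g' := by
    rw [← hP.integral_mul g g']
    refine integral_congr_ae ?_
    filter_upwards [hP.coeFn_process g, hP.coeFn_process g'] with ω h1 h2
    rw [h1, h2]
  dense := by
    rw [Submodule.topologicalClosure_eq_top_iff, Submodule.eq_bot_iff]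
    intro f hf
    have hf2 : MemLp f 2 P := Lp.memLp f
    have hfi : Integrable f P := hf2.integrable (by norm_num)
    have hpow : ∀ (g : G) (n : ℕ), ∫ ω, f ω * ω g ^ n ∂P = 0 := by
      intro g n
      let v : Lp ℝ 2 P := (hP.memLp_eval_pow g n).toLp _
      have hv : v ∈ {g : Lp ℝ 2 P | ∃ l : List G, (g : (G → ℝ) →ₘ[P] ℝ) =
          (l.map hP.process).prod} := by
        refine ⟨List.replicate n g, ?_⟩
        rw [List.map_replicate, List.prod_replicate]
        refine AEEqFun.ext ?_
        filter_upwards [(hP.memLp_eval_pow g n).coeFn_toLp, AEEqFun.coeFn_pow (hP.process g) n,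
          hP.coeFn_process g] with ω h1 h2 h3
        rw [h2, Pi.pow_apply, h3]
        exact h1
      have h1 := (Submodule.mem_orthogonal _ _).1 hf v (Submodule.subset_span hv)
      rw [L2.inner_def] at h1
      rw [← h1]
      refine integral_congr_ae ?_
      filter_upwards [(hP.memLp_eval_pow g n).coeFn_toLp] with ω h2
      change _ = ⟪v ω, f ω⟫_ℝ
      rw [show v ω = ω g ^ n from h2]
      rfl
    have hzero : (f : (G → ℝ) → ℝ) =ᵐ[P] 0 := by
      refine hP.ae_eq_zero_of_integral_exp_real hfi fun g => ?_
      let F : ℕ → (G → ℝ) → ℂ := fun n ω =>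
        (Complex.I ^ n / n.factorial) * ((f ω * ω g ^ n : ℝ) : ℂ)
      have hF : ∀ n, ∫ ω, F n ω ∂P = 0 := by
        intro n
        simp only [F]
        rw [integral_const_mul, integral_complex_ofReal, hpow]
        simp
      have hFn : ∀ n ω, ‖F n ω‖ = |f ω| * (|ω g| ^ n / n.factorial) := by
        intro n ω
        simp only [F, norm_mul, norm_div, norm_pow, Complex.norm_I, one_pow, Complex.norm_real,
          Real.norm_eq_abs, Complex.norm_natCast]
        ring
      have hs : ∀ ω : G → ℝ, HasSum (fun n => |f ω| * (|ω g| ^ n / n.factorial))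
          (|f ω| * Real.exp |ω g|) := by
        intro ω
        refine HasSum.mul_left _ ?_
        rw [Real.exp_eq_exp_ℝ]
        exact NormedSpace.expSeries_div_hasSum_exp (|ω g|)
      have key := hasSum_integral_of_dominated_convergence (μ := P) (F := F)
        (f := fun ω => (f ω : ℂ) * Complex.exp (Complex.I * (ω g : ℂ)))
        (fun n ω => |f ω| * (|ω g| ^ n / n.factorial))
        (fun n => by
          refine AEStronglyMeasurable.const_mul ?_ _
          exact Complex.continuous_ofReal.comp_aestronglyMeasurable
            (hfi.1.mul ((measurable_pi_apply g).pow_const n).aestronglyMeasurable))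
        (fun n => Filter.Eventually.of_forall fun ω => (hFn n ω).le)
        (Filter.Eventually.of_forall fun ω => (hs ω).summable)
        (by
          simp only [(hs _).tsum_eq]
          exact hf2.norm.integrable_mul (hP.memLp_exp_abs g))
        (Filter.Eventually.of_forall fun ω => by
          have h2 : HasSum (fun n => (Complex.I * (ω g : ℂ)) ^ n / n.factorial)
              (Complex.exp (Complex.I * (ω g : ℂ))) := by
            rw [Complex.exp_eq_exp_ℂ]
            exact NormedSpace.expSeries_div_hasSum_exp _
          have h3 := h2.mul_left (f ω : ℂ)
          refine h3.congr_fun ?_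
          intro n
          simp only [F]
          push_cast
          rw [mul_pow]
          ring)
      simp only [hF] at key
      exact (key.unique hasSum_zero)
    exact Lp.ext (hzero.trans (Lp.coeFn_zero ℝ 2 P).symm)

/-- Precomposition with a linear isometry preserves the law. -/
theorem measurePreserving_comp (hP : IsIsonormalLaw P) (S : G →ₗᵢ[ℝ] G) :
    MeasurePreserving (fun (ω : G → ℝ) g => ω (S g)) P P := by
  have hm : Measurable fun (ω : G → ℝ) g => ω (S g) :=
    measurable_pi_iff.2 fun g => measurable_pi_apply (S g)
  refine ⟨hm, ?_⟩
  have : IsProbabilityMeasure (P.map fun (ω : G → ℝ) g => ω (S g)) :=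
    Measure.isProbabilityMeasure_map hm.aemeasurable
  refine AELinear.ext_of_integral_exp ⟨fun g g' => ?_, fun c g => ?_⟩ hP.aelinear fun g => ?_
  · rw [ae_map_iff hm.aemeasurable (measurableSet_eq_fun (by fun_prop) (by fun_prop))]
    simpa using hP.aelinear.add (S g) (S g')
  · rw [ae_map_iff hm.aemeasurable (measurableSet_eq_fun (by fun_prop) (by fun_prop))]
    simpa using hP.aelinear.smul c (S g)
  · rw [integral_map hm.aemeasurable (measurable_exp_I_eval g).aestronglyMeasurable,
      hP.integral_exp, hP.integral_exp, S.norm_map]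

end IsIsonormalLaw

end Isonormal

/-! ### Multiplication by bounded functions on `Ω × X` -/

section Mult

variable {Ω : Type*} [MeasurableSpace Ω] {P : Measure Ω} {X : Type*} [MeasurableSpace X]
  {μ : Measure X}

/-- Bounded measurable functions. -/
structure BddMeas {Z : Type*} [MeasurableSpace Z] (k : Z → ℂ) : Prop where
  measurable : Measurable k
  bounded : ∃ C : ℝ, ∀ p, ‖k p‖ ≤ C

theorem BddMeas.slice {k : Ω × X → ℂ} (hk : BddMeas k) (ω : Ω) : BddMeas fun x => k (ω, x) :=
  ⟨hk.measurable.comp measurable_prodMk_left, hk.bounded.imp fun _ h _ => h _⟩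

theorem BddMeas.memLp_mul {k : X → ℂ} (hk : BddMeas k) (ξ : L2 μ) :
    MemLp (fun x => k x * ξ x) 2 μ := by
  obtain ⟨C, hC⟩ := hk.bounded
  refine (Lp.memLp ξ).of_le_mul (c := C)
    (hk.measurable.aestronglyMeasurable.mul (Lp.aestronglyMeasurable ξ))
    (Filter.Eventually.of_forall fun x => ?_)
  rw [norm_mul]
  gcongr
  exact hC x

/-- Multiplication by a bounded measurable function on `L²(X)` (and `0` for other functions). -/
def mulVec (k : X → ℂ) (ξ : L2 μ) : L2 μ :=
  open Classical in if h : BddMeas k then (h.memLp_mul ξ).toLp _ else 0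

theorem mulVec_apply {k : X → ℂ} (hk : BddMeas k) (ξ : L2 μ) :
    mulVec k ξ =ᵐ[μ] fun x => k x * ξ x := by
  rw [mulVec, dif_pos hk]
  exact MemLp.coeFn_toLp _

theorem mulVec_add {k : X → ℂ} (hk : BddMeas k) (ξ η : L2 μ) :
    mulVec k (ξ + η) = mulVec k ξ + mulVec k η := by
  refine Lp.ext ?_
  filter_upwards [mulVec_apply hk (ξ + η), mulVec_apply hk ξ, mulVec_apply hk η,
    Lp.coeFn_add ξ η, Lp.coeFn_add (mulVec k ξ) (mulVec k η)] with x h1 h2 h3 h4 h5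
  rw [h1, h5, Pi.add_apply, h2, h3, h4, Pi.add_apply, mul_add]

theorem mulVec_smul {k : X → ℂ} (hk : BddMeas k) (c : ℂ) (ξ : L2 μ) :
    mulVec k (c • ξ) = c • mulVec k ξ := by
  refine Lp.ext ?_
  filter_upwards [mulVec_apply hk (c • ξ), mulVec_apply hk ξ,
    Lp.coeFn_smul c ξ, Lp.coeFn_smul c (mulVec k ξ)] with x h1 h2 h4 h5
  rw [h1, h5, Pi.smul_apply, h2, h4, Pi.smul_apply, smul_eq_mul, smul_eq_mul, mul_left_comm]

theorem norm_mulVec_le {k : X → ℂ} (hk : Measurable k) {C : ℝ} (hC : ∀ x, ‖k x‖ ≤ C)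
    (ξ : L2 μ) : ‖mulVec k ξ‖ ≤ C * ‖ξ‖ := by
  refine Lp.norm_le_mul_norm_of_ae_le_mul ?_
  filter_upwards [mulVec_apply ⟨hk, C, hC⟩ ξ] with x hx
  rw [hx, norm_mul]
  gcongr
  exact hC x

theorem mulVec_add_left {k k' : X → ℂ} (hk : BddMeas k) (hk' : BddMeas k') (ξ : L2 μ)
    (hkk : BddMeas fun x => k x + k' x) :
    mulVec (fun x => k x + k' x) ξ = mulVec k ξ + mulVec k' ξ := by
  refine Lp.ext ?_
  filter_upwards [mulVec_apply hkk ξ, mulVec_apply hk ξ, mulVec_apply hk' ξ,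
    Lp.coeFn_add (mulVec k ξ) (mulVec k' ξ)] with x h1 h2 h3 h5
  rw [h1, h5, Pi.add_apply, h2, h3, add_mul]

theorem enorm_sq_L2 {E : Type*} [NormedAddCommGroup E] {Z : Type*} [MeasurableSpace Z]
    {ν : Measure Z} (F : Lp E 2 ν) : ‖F‖ₑ ^ 2 = ∫⁻ z, ‖F z‖ₑ ^ 2 ∂ν := by
  rw [Lp.enorm_def, eLpNorm_eq_lintegral_rpow_enorm_toReal (by simp) (by simp),
    ← ENNReal.rpow_natCast, ← ENNReal.rpow_mul]
  simp

theorem tendsto_of_enorm_sq {E ι : Type*} [NormedAddCommGroup E] {l : Filter ι} {v : ι → E} {w : E}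
    (h : Filter.Tendsto (fun n => ‖v n - w‖ₑ ^ 2) l (𝓝 0)) : Filter.Tendsto v l (𝓝 w) := by
  rw [tendsto_iff_edist_tendsto_0]
  have h1 := (ENNReal.continuous_rpow_const (y := 1 / 2)).tendsto 0 |>.comp h
  simp only [ENNReal.zero_rpow_of_pos (show (0 : ℝ) < 1 / 2 by norm_num)] at h1
  refine h1.congr fun n => ?_
  rw [Function.comp_apply, ← ENNReal.rpow_natCast, ← ENNReal.rpow_mul, edist_eq_enorm_sub]
  simp

theorem tendsto_mulVec {k : ℕ → X → ℂ} {k' : X → ℂ} (hk : ∀ n, Measurable (k n))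
    (hk' : Measurable k') {C : ℝ} (hC : ∀ n x, ‖k n x‖ ≤ C) (hC' : ∀ x, ‖k' x‖ ≤ C)
    (h : ∀ x, Filter.Tendsto (fun n => k n x) Filter.atTop (𝓝 (k' x))) (ξ : L2 μ) :
    Filter.Tendsto (fun n => mulVec (k n) ξ) Filter.atTop (𝓝 (mulVec k' ξ)) := by
  refine tendsto_of_enorm_sq ?_
  have h1 : ∀ n, ‖mulVec (k n) ξ - mulVec k' ξ‖ₑ ^ 2 =
      ∫⁻ x, ‖(k n x - k' x) * ξ x‖ₑ ^ 2 ∂μ := by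
    intro n
    rw [enorm_sq_L2]
    refine lintegral_congr_ae ?_
    filter_upwards [mulVec_apply ⟨hk n, C, hC n⟩ ξ, mulVec_apply ⟨hk', C, hC'⟩ ξ,
      Lp.coeFn_sub (mulVec (k n) ξ) (mulVec k' ξ)] with x h2 h3 h4
    rw [h4, Pi.sub_apply, h2, h3, sub_mul]
  simp only [h1]
  have h0 : (0 : ℝ≥0∞) = ∫⁻ _, 0 ∂μ := by simp
  rw [h0]
  refine tendsto_lintegral_of_dominated_convergence'
    (fun x => ENNReal.ofReal (2 * C) ^ 2 * ‖ξ x‖ₑ ^ 2) (fun n => ?_) (fun n => ?_) ?_ ?_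
  · exact ((((hk n).sub hk').aestronglyMeasurable.mul
      (Lp.aestronglyMeasurable ξ)).enorm).pow_const 2
  · refine Filter.Eventually.of_forall fun x => ?_
    change ‖(k n x - k' x) * ξ x‖ₑ ^ 2 ≤ ENNReal.ofReal (2 * C) ^ 2 * ‖ξ x‖ₑ ^ 2
    rw [enorm_mul, mul_pow]
    gcongr
    rw [← ofReal_norm]
    refine ENNReal.ofReal_le_ofReal ((norm_sub_le _ _).trans ?_)
    linarith [hC n x, hC' x]
  · rw [lintegral_const_mul' _ _ (ENNReal.pow_ne_top ENNReal.ofReal_ne_top), ← enorm_sq_L2]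
    exact ENNReal.mul_ne_top (ENNReal.pow_ne_top ENNReal.ofReal_ne_top)
      (ENNReal.pow_ne_top enorm_ne_top)
  · refine Filter.Eventually.of_forall fun x => ?_
    have h2 : Filter.Tendsto (fun n => (k n x - k' x) * ξ x) Filter.atTop (𝓝 0) := by
      have := ((h x).sub_const (k' x)).mul_const (ξ x)
      simpa using this
    have h3 := (ENNReal.continuous_pow 2).tendsto _ |>.comp h2.enorm
    simpa [Function.comp_def] using h3

theorem BddMeas.indicator {Z : Type*} [MeasurableSpace Z] {A : Set Z} (hA : MeasurableSet A) :
    BddMeas (A.indicator fun _ => (1 : ℂ)) :=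
  ⟨measurable_const.indicator hA, 1, fun p => by
    by_cases h : p ∈ A <;> simp [h]⟩

/-- As `L²(X)` need not be separable, weak measurability would not be enough. Rectangles give
functions with at most two values, and a π-λ argument reaches all measurable sets. -/
theorem stronglyMeasurable_mulVec_indicator {A : Set (Ω × X)} (hA : MeasurableSet A) (ξ : L2 μ) :
    StronglyMeasurable fun ω => mulVec (fun x => A.indicator (fun _ => (1 : ℂ)) (ω, x)) ξ := by
  induction A, hA using MeasurableSpace.induction_on_inter generateFrom_prod.symm
    isPiSystem_prod with
  | empty =>
    refine stronglyMeasurable_const' fun ω ω' => ?_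
    simp
  | basic A hA =>
    obtain ⟨s, hs, t, ht, rfl⟩ := hA
    have h : (fun ω => mulVec (fun x => (s ×ˢ t).indicator (fun _ => (1 : ℂ)) (ω, x)) ξ) =
        s.indicator fun _ => mulVec (t.indicator fun _ => (1 : ℂ)) ξ := by
      funext ω
      by_cases hω : ω ∈ s
      · rw [Set.indicator_of_mem hω]
        congr 1
        funext x
        by_cases hx : x ∈ t <;> simp [hω, hx]
      · rw [Set.indicator_of_notMem hω]
        have h0 : (fun x => (s ×ˢ t).indicator (fun _ => (1 : ℂ)) (ω, x)) = fun _ => 0 := by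
          funext x
          simp [hω]
        rw [h0, ← norm_le_zero_iff]
        simpa using norm_mulVec_le (C := 0) (measurable_const (a := (0 : ℂ)))
          (fun x : X => by simp) ξ
    rw [h]
    exact stronglyMeasurable_const.indicator hs
  | compl A hA ih =>
    have h : (fun ω => mulVec (fun x => Aᶜ.indicator (fun _ => (1 : ℂ)) (ω, x)) ξ) =
        fun ω => ξ - mulVec (fun x => A.indicator (fun _ => (1 : ℂ)) (ω, x)) ξ := by
      funext ω
      refine Lp.ext ?_
      filter_upwards [mulVec_apply ((BddMeas.indicator hA).slice ω) ξ,
        mulVec_apply ((BddMeas.indicator hA.compl).slice ω) ξ,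
        Lp.coeFn_sub ξ (mulVec (fun x => A.indicator (fun _ => (1 : ℂ)) (ω, x)) ξ)] with x h1 h2 h3
      rw [h2, h3, Pi.sub_apply, h1]
      by_cases hx : (ω, x) ∈ A <;> simp [hx]
    rw [h]
    exact stronglyMeasurable_const.sub ih
  | iUnion A hd hA ih =>
    -- By disjointness finite unions are sums; the countable union is then a pointwise limit by
    -- dominated convergence in `L²(X)`.
    have hsum : ∀ N : ℕ, StronglyMeasurable fun ω => mulVec
        (fun x => (⋃ n ∈ Finset.range N, A n).indicator (fun _ => (1 : ℂ)) (ω, x)) ξ := by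
      intro N
      induction N with
      | zero =>
        refine stronglyMeasurable_const' fun ω ω' => ?_
        simp
      | succ N ihN =>
        convert ihN.add (ih N) using 1
        funext ω
        have hm : MeasurableSet (⋃ n ∈ Finset.range N, A n) :=
          Finset.measurableSet_biUnion _ fun n _ => hA n
        have hm' : MeasurableSet (⋃ n ∈ Finset.range (N + 1), A n) :=
          Finset.measurableSet_biUnion _ fun n _ => hA n
        have h : ∀ p, (⋃ n ∈ Finset.range (N + 1), A n).indicator (fun _ => (1 : ℂ)) p =
            (⋃ n ∈ Finset.range N, A n).indicator (fun _ => (1 : ℂ)) p +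
              (A N).indicator (fun _ => (1 : ℂ)) p := by
          intro p
          have hdis : p ∈ A N → p ∉ ⋃ n ∈ Finset.range N, A n := by
            intro h1 h2
            simp only [Set.mem_iUnion, Finset.mem_range] at h2
            obtain ⟨n, hn, h2⟩ := h2
            exact Set.disjoint_left.1 (hd hn.ne) h2 h1
          have hmem : p ∈ (⋃ n ∈ Finset.range (N + 1), A n) ↔
              p ∈ (⋃ n ∈ Finset.range N, A n) ∨ p ∈ A N := by
            simp only [Set.mem_iUnion, Finset.mem_range, Nat.lt_succ_iff_lt_or_eq]
            constructor
            · rintro ⟨n, h1 | rfl, h2⟩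
              · exact Or.inl ⟨n, h1, h2⟩
              · exact Or.inr h2
            · rintro (⟨n, h1, h2⟩ | h2)
              · exact ⟨n, Or.inl h1, h2⟩
              · exact ⟨N, Or.inr rfl, h2⟩
          by_cases h1 : p ∈ A N
          · rw [Set.indicator_of_mem (hmem.2 (Or.inr h1)), Set.indicator_of_notMem (hdis h1),
              Set.indicator_of_mem h1, zero_add]
          · by_cases h2 : p ∈ ⋃ n ∈ Finset.range N, A n
            · rw [Set.indicator_of_mem (hmem.2 (Or.inl h2)), Set.indicator_of_mem h2,
                Set.indicator_of_notMem h1, add_zero]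
            · rw [Set.indicator_of_notMem (fun h3 => (hmem.1 h3).elim h2 h1),
                Set.indicator_of_notMem h2, Set.indicator_of_notMem h1, add_zero]
        have hfun : (fun x => (⋃ n ∈ Finset.range (N + 1), A n).indicator
            (fun _ => (1 : ℂ)) (ω, x)) =
            fun x => (⋃ n ∈ Finset.range N, A n).indicator (fun _ => (1 : ℂ)) (ω, x) +
              (A N).indicator (fun _ => (1 : ℂ)) (ω, x) := funext fun x => h (ω, x)
        rw [hfun]
        refine mulVec_add_left ((BddMeas.indicator hm).slice ω) ((BddMeas.indicator (hA N)).slice ω)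
          ξ ?_
        rw [← hfun]
        exact (BddMeas.indicator hm').slice ω
    refine stronglyMeasurable_of_tendsto Filter.atTop hsum (tendsto_pi_nhds.2 fun ω => ?_)
    have hb : ∀ (B : Set (Ω × X)) (x : X), ‖B.indicator (fun _ => (1 : ℂ)) (ω, x)‖ ≤ 1 := by
      intro B x
      by_cases h : (ω, x) ∈ B <;> simp [h]
    refine tendsto_mulVec (C := 1) (fun N => ?_) ?_ (fun N x => hb _ x) (fun x => hb _ x) ?_ ξ
    · exact ((BddMeas.indicator (Finset.measurableSet_biUnion _ fun n _ => hA n)).slice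
        ω).measurable
    · exact ((BddMeas.indicator (MeasurableSet.iUnion hA)).slice ω).measurable
    · intro x
      exact ((tendsto_indicator_biUnion_finset A (fun _ => (1 : ℂ)) (ω, x)).comp
        Filter.tendsto_finset_range).mono_right (pure_le_nhds _)

theorem mulVec_const_mul_left {k : X → ℂ} (hk : BddMeas k) (c : ℂ) (ξ : L2 μ) :
    mulVec (fun x => c * k x) ξ = c • mulVec k ξ := by
  obtain ⟨C, hC⟩ := hk.bounded
  have hck : BddMeas fun x => c * k x := ⟨hk.measurable.const_mul c, ‖c‖ * C, fun x => by
    rw [norm_mul]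
    gcongr
    exact hC x⟩
  refine Lp.ext ?_
  filter_upwards [mulVec_apply hck ξ, mulVec_apply hk ξ, Lp.coeFn_smul c (mulVec k ξ)]
    with x h1 h2 h3
  rw [h1, h3, Pi.smul_apply, h2, smul_eq_mul, mul_assoc]

theorem BddMeas.simpleFunc {Z : Type*} [MeasurableSpace Z] (f : SimpleFunc Z ℂ) : BddMeas f :=
  ⟨f.measurable, by
    obtain ⟨C, hC⟩ := f.exists_forall_norm_le
    exact ⟨C, hC⟩⟩

theorem stronglyMeasurable_mulVec_simpleFunc (f : SimpleFunc (Ω × X) ℂ) (ξ : L2 μ) :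
    StronglyMeasurable fun ω => mulVec (fun x => f (ω, x)) ξ := by
  induction f using SimpleFunc.induction with
  | const c hs =>
    rename_i s
    have h : (fun ω => mulVec (fun x => (SimpleFunc.piecewise s hs (SimpleFunc.const _ c)
        (SimpleFunc.const _ 0)) (ω, x)) ξ) =
        fun ω => c • mulVec (fun x => s.indicator (fun _ => (1 : ℂ)) (ω, x)) ξ := by
      funext ω
      rw [← mulVec_const_mul_left ((BddMeas.indicator hs).slice ω)]
      congr 1
      funext x
      by_cases hx : (ω, x) ∈ s <;> simp [hx]
    rw [h]
    exact (stronglyMeasurable_mulVec_indicator hs ξ).const_smul c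
  | add _ hf hg =>
    rename_i f g _
    convert hf.add hg using 1
    funext ω
    exact mulVec_add_left ((BddMeas.simpleFunc f).slice ω) ((BddMeas.simpleFunc g).slice ω) ξ
      ((BddMeas.simpleFunc (f + g)).slice ω)

theorem stronglyMeasurable_mulVec {k : Ω × X → ℂ} (hk : BddMeas k) (ξ : L2 μ) :
    StronglyMeasurable fun ω => mulVec (fun x => k (ω, x)) ξ := by
  obtain ⟨C, hC⟩ := hk.bounded
  have hs := hk.measurable.stronglyMeasurable
  refine stronglyMeasurable_of_tendsto Filter.atTop
    (fun n => stronglyMeasurable_mulVec_simpleFunc (hs.approxBounded C n) ξ)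
    (tendsto_pi_nhds.2 fun ω => ?_)
  -- The bound `C` may be negative when there is no point at all, whereas the approximation lemma
  -- asks for `0 ≤ C`.
  have h0 : 0 ≤ C ∨ IsEmpty (Ω × X) := by
    rcases isEmpty_or_nonempty (Ω × X) with h | ⟨⟨p⟩⟩
    · exact Or.inr h
    · exact Or.inl ((norm_nonneg _).trans (hC p))
  rcases h0 with h0 | h0
  · refine tendsto_mulVec (C := C) (fun n => ?_) (hk.slice ω).measurable (fun n x => ?_)
      (fun x => hC _) (fun x => ?_) ξ
    · exact ((BddMeas.simpleFunc (hs.approxBounded C n)).slice ω).measurable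
    · exact hs.norm_approxBounded_le h0 n (ω, x)
    · exact hs.tendsto_approxBounded_of_norm_le (hC _)
  · have : IsEmpty X := ⟨fun x => h0.elim (ω, x)⟩
    refine tendsto_mulVec (C := C) (fun n => ?_) (hk.slice ω).measurable (fun n x => this.elim x)
      (fun x => hC _) (fun x => this.elim x) ξ
    exact ((BddMeas.simpleFunc (hs.approxBounded C n)).slice ω).measurable

theorem stronglyMeasurable_mulVec_comp {k : Ω × X → ℂ} (hk : BddMeas k) {F : Ω → L2 μ}
    (hF : StronglyMeasurable F) : StronglyMeasurable fun ω => mulVec (fun x => k (ω, x)) (F ω) := by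
  obtain ⟨C, hC⟩ := hk.bounded
  have hsimple : ∀ f : SimpleFunc Ω (L2 μ),
      StronglyMeasurable fun ω => mulVec (fun x => k (ω, x)) (f ω) := by
    intro f
    induction f using SimpleFunc.induction with
    | const ξ hs =>
      rename_i s
      have h : (fun ω => mulVec (fun x => k (ω, x)) ((SimpleFunc.piecewise s hs
          (SimpleFunc.const _ ξ) (SimpleFunc.const _ 0)) ω)) =
          s.indicator fun ω => mulVec (fun x => k (ω, x)) ξ := by
        funext ω
        by_cases hω : ω ∈ s
        · simp [hω]
        · have := mulVec_smul (hk.slice ω) 0 (0 : L2 μ)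
          rw [zero_smul, zero_smul] at this
          simp [hω, this]
      rw [h]
      exact (stronglyMeasurable_mulVec hk ξ).indicator hs
    | add _ hf hg =>
      convert hf.add hg using 1
      funext ω
      exact mulVec_add (hk.slice ω) _ _
  refine stronglyMeasurable_of_tendsto Filter.atTop (fun n => hsimple (hF.approx n))
    (tendsto_pi_nhds.2 fun ω => ?_)
  let A : L2 μ →L[ℂ] L2 μ := LinearMap.mkContinuous
    { toFun := mulVec fun x => k (ω, x)
      map_add' := mulVec_add (hk.slice ω)
      map_smul' := mulVec_smul (hk.slice ω) } C
    fun ξ => norm_mulVec_le (hk.slice ω).measurable (fun x => hC _) ξ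
  exact (A.continuous.tendsto _).comp (hF.tendsto_approx ω)

theorem ae_norm_mulVec_le {k : Ω × X → ℂ} (hk : Measurable k) {C : ℝ} (hC : ∀ p, ‖k p‖ ≤ C)
    (F : L2L2 P μ) : ∀ᵐ ω ∂P, ‖mulVec (fun x => k (ω, x)) (F ω)‖ ≤ C * ‖F ω‖ :=
  Filter.Eventually.of_forall fun ω => norm_mulVec_le (hk.comp measurable_prodMk_left)
    (fun _ => hC _) (F ω)

theorem memLp_mulVec {k : Ω × X → ℂ} (hk : BddMeas k) (F : L2L2 P μ) :
    MemLp (fun ω => mulVec (fun x => k (ω, x)) (F ω)) 2 P := by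
  obtain ⟨C, hC⟩ := hk.bounded
  exact (Lp.memLp F).of_le_mul
    (stronglyMeasurable_mulVec_comp hk (Lp.stronglyMeasurable F)).aestronglyMeasurable
    (ae_norm_mulVec_le hk.measurable hC F)

theorem exists_multOp (P : Measure Ω) (μ : Measure X) {k : Ω × X → ℂ} (hk : BddMeas k) :
    ∃ A : Bd (L2L2 P μ), ∀ F, A F =ᵐ[P] fun ω => mulVec (fun x => k (ω, x)) (F ω) := by
  obtain ⟨C, hC⟩ := hk.bounded
  refine ⟨LinearMap.mkContinuous
    { toFun := fun F => (memLp_mulVec hk F).toLp _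
      map_add' := fun F G => ?_
      map_smul' := fun c F => ?_ } C fun F => ?_, fun F => (memLp_mulVec hk F).coeFn_toLp⟩
  · rw [← MemLp.toLp_add]
    refine MemLp.toLp_congr _ _ ?_
    filter_upwards [Lp.coeFn_add F G] with ω hω
    rw [hω, Pi.add_apply, mulVec_add (hk.slice ω)]
    rfl
  · rw [RingHom.id_apply, ← MemLp.toLp_const_smul]
    refine MemLp.toLp_congr _ _ ?_
    filter_upwards [Lp.coeFn_smul c F] with ω hω
    rw [hω, Pi.smul_apply, mulVec_smul (hk.slice ω)]
    rfl
  · refine Lp.norm_le_mul_norm_of_ae_le_mul ?_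
    filter_upwards [(memLp_mulVec hk F).coeFn_toLp, ae_norm_mulVec_le hk.measurable hC F]
      with ω h1 h2
    change ‖((memLp_mulVec hk F).toLp _ : L2L2 P μ) ω‖ ≤ _
    rw [h1]
    exact h2

variable (P μ) in
/-- The operator of multiplication by a bounded measurable function of `(ω, x)`. -/
def multOp {k : Ω × X → ℂ} (hk : BddMeas k) : Bd (L2L2 P μ) := (exists_multOp P μ hk).choose

theorem multOp_apply {k : Ω × X → ℂ} (hk : BddMeas k) (F : L2L2 P μ) :
    multOp P μ hk F =ᵐ[P] fun ω => mulVec (fun x => k (ω, x)) (F ω) :=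
  (exists_multOp P μ hk).choose_spec F

theorem multOp_apply_ae {k : Ω × X → ℂ} (hk : BddMeas k) (F : L2L2 P μ) :
    ∀ᵐ ω ∂P, ∀ᵐ x ∂μ, multOp P μ hk F ω x = k (ω, x) * F ω x := by
  filter_upwards [multOp_apply hk F] with ω hω
  rw [hω]
  exact mulVec_apply (hk.slice ω) (F ω)

theorem L2L2_ext {F G : L2L2 P μ} (h : ∀ᵐ ω ∂P, ∀ᵐ x ∂μ, F ω x = G ω x) : F = G :=
  Lp.ext (h.mono fun _ hω => Lp.ext hω)

theorem BddMeas.conj {k : Ω × X → ℂ} (hk : BddMeas k) :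
    BddMeas fun p => (starRingEnd ℂ) (k p) :=
  ⟨Complex.continuous_conj.measurable.comp hk.measurable, hk.bounded.imp fun C h p => by
    rw [RCLike.norm_conj]; exact h p⟩

theorem star_multOp {k : Ω × X → ℂ} (hk : BddMeas k) :
    star (multOp P μ hk) = multOp P μ hk.conj := by
  rw [ContinuousLinearMap.star_eq_adjoint]
  symm
  rw [ContinuousLinearMap.eq_adjoint_iff]
  intro F G
  rw [L2.inner_def, L2.inner_def]
  refine integral_congr_ae ?_
  filter_upwards [multOp_apply_ae hk G, multOp_apply_ae hk.conj F] with ω h1 h2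
  rw [L2.inner_def, L2.inner_def]
  refine integral_congr_ae ?_
  filter_upwards [h1, h2] with x h1 h2
  rw [h1, h2, RCLike.inner_apply, RCLike.inner_apply, map_mul, RCLike.conj_conj]
  ring

theorem BddMeas.mul {k k' : Ω × X → ℂ} (hk : BddMeas k) (hk' : BddMeas k') :
    BddMeas fun p => k p * k' p := by
  obtain ⟨C, hC⟩ := hk.bounded
  obtain ⟨C', hC'⟩ := hk'.bounded
  refine ⟨hk.measurable.mul hk'.measurable, C * C', fun p => ?_⟩
  rw [norm_mul]
  exact mul_le_mul (hC p) (hC' p) (norm_nonneg _) ((norm_nonneg _).trans (hC p))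

theorem multOp_mul {k k' : Ω × X → ℂ} (hk : BddMeas k) (hk' : BddMeas k') :
    multOp P μ hk * multOp P μ hk' = multOp P μ (hk.mul hk') := by
  refine ContinuousLinearMap.ext fun F => L2L2_ext ?_
  filter_upwards [multOp_apply_ae hk (multOp P μ hk' F), multOp_apply_ae hk' F,
    multOp_apply_ae (hk.mul hk') F] with ω h1 h2 h3
  filter_upwards [h1, h2, h3] with x h1 h2 h3
  change multOp P μ hk (multOp P μ hk' F) ω x = _
  rw [h1, h2, h3, mul_assoc]

theorem multOp_eq_one {k : Ω × X → ℂ} (hk : BddMeas k)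
    (h : ∀ᵐ ω ∂P, ∀ᵐ x ∂μ, k (ω, x) = 1) : multOp P μ hk = 1 := by
  refine ContinuousLinearMap.ext fun F => L2L2_ext ?_
  filter_upwards [multOp_apply_ae hk F, h] with ω h1 h2
  filter_upwards [h1, h2] with x h1 h2
  rw [h1, h2, one_mul]
  rfl

theorem multOp_mem [IsFiniteMeasure P] {k : Ω × X → ℂ} (hk : BddMeas k) :
    multOp P μ hk ∈ (tensorVN P μ).toStarSubalgebra := by
  refine mem_tensorVN_iff.2 fun f => ContinuousLinearMap.ext fun F => Lp.ext ?_
  filter_upwards [mulOp_apply f (multOp P μ hk F), multOp_apply hk F,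
    multOp_apply hk (mulOp μ f F), mulOp_apply f F] with ω h1 h2 h3 h4
  change mulOp μ f (multOp P μ hk F) ω = multOp P μ hk (mulOp μ f F) ω
  rw [h1, h2, h3, h4, mulVec_smul (hk.slice ω)]

end Mult

/-! ### Jointly measurable versions of Gaussian fields -/

section JointVersion

variable {G : Type*} [NormedAddCommGroup G] [InnerProductSpace ℝ G] {P : Measure (G → ℝ)}

namespace IsIsonormalLaw

theorem lintegral_enorm_sub_sq (hP : IsIsonormalLaw P) (g g' : G) :
    ∫⁻ ω, ‖ω g - ω g'‖ₑ ^ 2 ∂P = ENNReal.ofReal (‖g - g'‖ ^ 2) := by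
  have h1 : ∫⁻ ω, ‖ω g - ω g'‖ₑ ^ 2 ∂P =
      ∫⁻ ω, ENNReal.ofReal (ω (g - g') * ω (g - g')) ∂P := by
    refine lintegral_congr_ae ?_
    filter_upwards [hP.aelinear.sub g g'] with ω hω
    rw [hω, ← ofReal_norm, ← ENNReal.ofReal_pow (norm_nonneg _), ← sq, Real.norm_eq_abs, sq_abs]
  rw [h1, ← ofReal_integral_eq_lintegral_ofReal, hP.integral_mul, real_inner_self_eq_norm_sq]
  · exact (hP.memLp (g - g')).integrable_mul (hP.memLp (g - g'))
  · exact Filter.Eventually.of_forall fun ω => mul_self_nonneg _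

/-- The process is an isometry into `L²`, so the squared errors have integrals at most `4⁻ⁿ`. Their
sum is integrable, hence almost surely finite, and its terms tend to zero. -/
theorem ae_tendsto_of_norm_sub_le (hP : IsIsonormalLaw P) {b : ℕ → G} {a : G}
    (h : ∀ n, ‖b n - a‖ ≤ (1 / 2) ^ n) :
    ∀ᵐ ω ∂P, Filter.Tendsto (fun n => ω (b n)) Filter.atTop (𝓝 (ω a)) := by
  have hm : ∀ n, Measurable fun ω : G → ℝ => ‖ω (b n) - ω a‖ₑ ^ 2 := fun n =>
    ((measurable_pi_apply (b n)).sub (measurable_pi_apply a)).enorm.pow_const 2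
  have h1 : ∫⁻ ω, ∑' n, ‖ω (b n) - ω a‖ₑ ^ 2 ∂P ≠ ∞ := by
    rw [lintegral_tsum fun n => (hm n).aemeasurable]
    have h2 : ∑' n, ∫⁻ ω, ‖ω (b n) - ω a‖ₑ ^ 2 ∂P ≤
        ∑' n : ℕ, ENNReal.ofReal ((1 / 4) ^ n) := by
      refine ENNReal.tsum_le_tsum fun n => ?_
      rw [hP.lintegral_enorm_sub_sq]
      refine ENNReal.ofReal_le_ofReal ((pow_le_pow_left₀ (norm_nonneg _) (h n) 2).trans_eq ?_)
      rw [← pow_mul, mul_comm, pow_mul]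
      norm_num
    refine (h2.trans_lt ?_).ne
    rw [← ENNReal.ofReal_tsum_of_nonneg (fun n => by positivity)
      (summable_geometric_of_lt_one (by norm_num) (by norm_num))]
    exact ENNReal.ofReal_lt_top
  filter_upwards [ae_lt_top' (AEMeasurable.tsum fun n => (hm n).aemeasurable) h1] with ω hω
  exact tendsto_of_enorm_sq (ENNReal.tendsto_atTop_zero_of_tsum_ne_top hω.ne)

variable {X : Type*} [MeasurableSpace X] {μ : Measure X}

/-- Evaluating `ω` at `a x` involves uncountably many coordinates, so joint measurability is not
automatic. Replace `a x` by the first point of a dense sequence of its range within `2⁻ⁿ`: the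
approximants are jointly measurable and, for almost every `x`, converge almost surely. -/
theorem exists_jointVersion (hP : IsIsonormalLaw P) {a : X → G}
    (ha : AEStronglyMeasurable a μ) :
    ∃ Z : (G → ℝ) × X → ℝ, Measurable Z ∧ ∀ᵐ x ∂μ, ∀ᵐ ω ∂P, Z (ω, x) = ω (a x) := by
  classical
  rcases isEmpty_or_nonempty X with hX | hX
  · exact ⟨fun _ => 0, measurable_const, Filter.Eventually.of_forall fun x => hX.elim x⟩
  obtain ⟨a', ha', haa⟩ := ha
  have hne : (Set.range a').Nonempty := Set.range_nonempty a'
  obtain ⟨c, hc, hcd⟩ := ha'.isSeparable_range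
  have hcn : c.Nonempty := by
    by_contra h
    rw [Set.not_nonempty_iff_eq_empty] at h
    rw [h, closure_empty] at hcd
    exact hne.not_subset_empty hcd
  obtain ⟨q, rfl⟩ := hc.exists_eq_range hcn
  have hex : ∀ (n : ℕ) (x : X), ∃ j, ‖q j - a' x‖ < (1 / 2) ^ n := by
    intro n x
    obtain ⟨_, ⟨j, rfl⟩, hj⟩ := Metric.mem_closure_iff.1 (hcd ⟨x, rfl⟩) ((1 / 2) ^ n)
      (by positivity)
    exact ⟨j, by rwa [← dist_eq_norm, dist_comm]⟩
  have hfind : ∀ n, Measurable fun x => Nat.find (hex n x) := fun n =>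
    measurable_find (hex n) fun j =>
      (stronglyMeasurable_const.sub ha').norm.measurable measurableSet_Iio
  have hY : ∀ n, Measurable fun p : (G → ℝ) × X => p.1 (q (Nat.find (hex n p.2))) := by
    intro n
    have h1 : Measurable fun p : (G → ℝ) × ℕ => p.1 (q p.2) :=
      measurable_from_prod_countable_left fun j => measurable_pi_apply (q j)
    exact h1.comp (measurable_fst.prodMk ((hfind n).comp measurable_snd))
  -- The upper limit is measurable everywhere, and equals the limit wherever there is one.
  refine ⟨fun p => Filter.limsup (fun n => p.1 (q (Nat.find (hex n p.2)))) Filter.atTop,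
    Measurable.limsup hY, ?_⟩
  filter_upwards [haa] with x hx
  filter_upwards [hP.ae_tendsto_of_norm_sub_le fun n => (Nat.find_spec (hex n x)).le] with ω hω
  rw [hx]
  exact hω.limsup_eq

end IsIsonormalLaw

end JointVersion

/-! ### The group of automorphisms defined by a flow and a cocycle -/

section Cocycle

variable {Ω : Type*} [MeasurableSpace Ω] {X : Type*} [MeasurableSpace X]

/-- A measure preserving flow on `Ω`, with a unimodular cocycle depending on a parameter in `X`. -/
structure IsCocycle (P : Measure Ω) (μ : Measure X) (θ : ℝ → Ω → Ω) (k : ℝ → Ω × X → ℂ) :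
    Prop where
  measurePreserving : ∀ t, MeasurePreserving (θ t) P P
  flow_add : ∀ s t ω, θ t (θ s ω) = θ (s + t) ω
  measurable : ∀ t, Measurable (k t)
  norm : ∀ t p, ‖k t p‖ = 1
  add : ∀ s t, ∀ᵐ ω ∂P, ∀ᵐ x ∂μ, k (s + t) (ω, x) = k s (ω, x) * k t (θ s ω, x)

namespace IsCocycle

variable {P : Measure Ω} {μ : Measure X} {θ : ℝ → Ω → Ω} {k : ℝ → Ω × X → ℂ}

theorem bddMeas (h : IsCocycle P μ θ k) (t : ℝ) : BddMeas (k t) :=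
  ⟨h.measurable t, 1, fun p => (h.norm t p).le⟩

/-- The operator of composition with the flow. -/
def flowOp (h : IsCocycle P μ θ k) (t : ℝ) : Bd (L2L2 P μ) :=
  (Lp.compMeasurePreservingₗᵢ ℂ (θ t) (h.measurePreserving t)).toContinuousLinearMap

theorem flowOp_apply (h : IsCocycle P μ θ k) (t : ℝ) (F : L2L2 P μ) :
    h.flowOp t F =ᵐ[P] fun ω => F (θ t ω) :=
  Lp.coeFn_compMeasurePreserving F (h.measurePreserving t)

theorem star_flowOp_mul_flowOp (h : IsCocycle P μ θ k) (t : ℝ) :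
    star (h.flowOp t) * h.flowOp t = 1 :=
  ContinuousLinearMap.norm_map_iff_adjoint_comp_self _ |>.1
    (Lp.compMeasurePreservingₗᵢ ℂ (θ t) (h.measurePreserving t)).norm_map

/-- Multiplication by the cocycle. -/
def phaseOp (h : IsCocycle P μ θ k) (t : ℝ) : Bd (L2L2 P μ) := multOp P μ (h.bddMeas t)

theorem star_phaseOp_mul_phaseOp (h : IsCocycle P μ θ k) (t : ℝ) :
    star (h.phaseOp t) * h.phaseOp t = 1 := by
  rw [phaseOp, star_multOp, multOp_mul]
  refine multOp_eq_one _ (Filter.Eventually.of_forall fun ω => Filter.Eventually.of_forall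
    fun x => ?_)
  rw [← Complex.normSq_eq_conj_mul_self, Complex.normSq_eq_norm_sq, h.norm]
  simp

theorem phaseOp_mul_star_phaseOp (h : IsCocycle P μ θ k) (t : ℝ) :
    h.phaseOp t * star (h.phaseOp t) = 1 := by
  rw [phaseOp, star_multOp, multOp_mul]
  refine multOp_eq_one _ (Filter.Eventually.of_forall fun ω => Filter.Eventually.of_forall
    fun x => ?_)
  rw [Complex.mul_conj, Complex.normSq_eq_norm_sq, h.norm]
  simp

/-- The unitary operator implementing the automorphism at time `t`. -/
def implOp (h : IsCocycle P μ θ k) (t : ℝ) : Bd (L2L2 P μ) := h.phaseOp t * h.flowOp t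

theorem star_implOp_mul_implOp (h : IsCocycle P μ θ k) (t : ℝ) :
    star (h.implOp t) * h.implOp t = 1 := by
  rw [implOp, star_mul, mul_assoc, ← mul_assoc (star (h.phaseOp t)), h.star_phaseOp_mul_phaseOp,
    one_mul, h.star_flowOp_mul_flowOp]

theorem implOp_apply (h : IsCocycle P μ θ k) (t : ℝ) (F : L2L2 P μ) :
    ∀ᵐ ω ∂P, ∀ᵐ x ∂μ, h.implOp t F ω x = k t (ω, x) * F (θ t ω) x := by
  filter_upwards [multOp_apply_ae (h.bddMeas t) (h.flowOp t F), h.flowOp_apply t F] with ω h1 h2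
  filter_upwards [h1] with x h1
  rw [← h2]
  exact h1

/-- The cocycle identity is exactly the condition making "compose with the flow, then multiply by
the phase" multiplicative in time. -/
theorem implOp_add (h : IsCocycle P μ θ k) (s t : ℝ) :
    h.implOp (s + t) = h.implOp s * h.implOp t := by
  refine ContinuousLinearMap.ext fun F => L2L2_ext ?_
  filter_upwards [h.implOp_apply (s + t) F, h.implOp_apply s (h.implOp t F),
    (h.measurePreserving s).quasiMeasurePreserving.ae (h.implOp_apply t F), h.add s t]
    with ω h1 h2 h3 h4
  filter_upwards [h1, h2, h3, h4] with x h1 h2 h3 h4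
  change _ = h.implOp s (h.implOp t F) ω x
  rw [h1, h2, h3, h4, h.flow_add, mul_assoc]

/-- An idempotent isometry is the identity, so nothing has to be assumed on the cocycle or the flow
at time `0`. -/
theorem implOp_zero (h : IsCocycle P μ θ k) : h.implOp 0 = 1 := by
  have h1 := h.implOp_add 0 0
  rw [add_zero] at h1
  calc h.implOp 0 = star (h.implOp 0) * h.implOp 0 * h.implOp 0 := by
        rw [h.star_implOp_mul_implOp, one_mul]
    _ = 1 := by rw [mul_assoc, ← h1, h.star_implOp_mul_implOp]

theorem implOp_mul_neg (h : IsCocycle P μ θ k) (t : ℝ) : h.implOp t * h.implOp (-t) = 1 := by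
  rw [← h.implOp_add, add_neg_cancel, h.implOp_zero]

theorem implOp_neg_mul (h : IsCocycle P μ θ k) (t : ℝ) : h.implOp (-t) * h.implOp t = 1 := by
  rw [← h.implOp_add, neg_add_cancel, h.implOp_zero]

theorem star_implOp (h : IsCocycle P μ θ k) (t : ℝ) : star (h.implOp t) = h.implOp (-t) := by
  rw [← mul_one (star (h.implOp t)), ← h.implOp_mul_neg t, ← mul_assoc, h.star_implOp_mul_implOp,
    one_mul]

theorem norm_implOp_apply (h : IsCocycle P μ θ k) (t : ℝ) (F : L2L2 P μ) :
    ‖h.implOp t F‖ = ‖F‖ :=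
  ContinuousLinearMap.norm_map_iff_adjoint_comp_self _ |>.2 (h.star_implOp_mul_implOp t) F

theorem implOp_mul_mulOp (h : IsCocycle P μ θ k) (t : ℝ) (f : Lp ℂ ∞ P) :
    h.implOp t * mulOp μ f =
      mulOp μ (Lp.compMeasurePreserving (θ t) (h.measurePreserving t) f) * h.implOp t := by
  refine ContinuousLinearMap.ext fun F => L2L2_ext ?_
  filter_upwards [h.implOp_apply t F, h.implOp_apply t (mulOp μ f F),
    (h.measurePreserving t).quasiMeasurePreserving.ae (mulOp_apply f F),
    mulOp_apply (Lp.compMeasurePreserving (θ t) (h.measurePreserving t) f) (h.implOp t F),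
    Lp.coeFn_compMeasurePreserving f (h.measurePreserving t)] with ω h1 h2 h3 h4 h5
  change ∀ᵐ x ∂μ, h.implOp t (mulOp μ f F) ω x = mulOp μ _ (h.implOp t F) ω x
  rw [h4, h5]
  rw [h3] at h2
  filter_upwards [h1, h2, Lp.coeFn_smul (f (θ t ω)) (F (θ t ω)),
    Lp.coeFn_smul ((f ∘ θ t) ω) (h.implOp t F ω)] with x h1 h2 h6 h7
  rw [h2, h6, h7, Pi.smul_apply, Pi.smul_apply, h1, smul_eq_mul, smul_eq_mul, mul_left_comm]
  rfl

theorem flowOp_mul_ampOp (h : IsCocycle P μ θ k) (t : ℝ) (z : Bd (L2 μ)) :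
    h.flowOp t * ampOp P z = ampOp P z * h.flowOp t := by
  refine ContinuousLinearMap.ext fun F => Lp.ext ?_
  filter_upwards [h.flowOp_apply t (ampOp P z F), h.flowOp_apply t F,
    ampOp_apply z (h.flowOp t F),
    (h.measurePreserving t).quasiMeasurePreserving.ae (ampOp_apply z F)] with ω h1 h2 h3 h4
  change h.flowOp t (ampOp P z F) ω = ampOp P z (h.flowOp t F) ω
  rw [h1, h3, h2, h4]

theorem flowOp_eq (h : IsCocycle P μ θ k) (t : ℝ) :
    h.flowOp t = star (h.phaseOp t) * h.implOp t := by
  rw [implOp, ← mul_assoc, h.star_phaseOp_mul_phaseOp, one_mul]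

theorem conj_conj (h : IsCocycle P μ θ k) (s t : ℝ) (m : Bd (L2L2 P μ)) :
    h.implOp s * (h.implOp t * m * h.implOp (-t)) * h.implOp (-s) =
      h.implOp (s + t) * m * h.implOp (-(s + t)) := by
  rw [neg_add_rev, h.implOp_add, h.implOp_add]
  simp only [mul_assoc]

theorem conj_zero (h : IsCocycle P μ θ k) (m : Bd (L2L2 P μ)) :
    h.implOp 0 * m * h.implOp (-0) = m := by
  rw [neg_zero, h.implOp_zero, one_mul, mul_one]

theorem norm_implOp_le (h : IsCocycle P μ θ k) (t : ℝ) : ‖h.implOp t‖ ≤ 1 :=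
  ContinuousLinearMap.opNorm_le_bound _ zero_le_one fun F => by
    rw [h.norm_implOp_apply, one_mul]

variable [IsProbabilityMeasure P]

theorem star_flowOp_constEmb (h : IsCocycle P μ θ k) (t : ℝ) (ξ : L2 μ) :
    star (h.flowOp t) (constEmb P μ ξ) = constEmb P μ ξ := by
  have h1 : h.flowOp t (constEmb P μ ξ) = constEmb P μ ξ := by
    refine Lp.ext ?_
    filter_upwards [h.flowOp_apply t (constEmb P μ ξ), constEmb_apply (P := P) ξ,
      (h.measurePreserving t).quasiMeasurePreserving.ae (constEmb_apply (P := P) ξ)]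
      with ω h1 h2 h3
    rw [h1, h2, h3]
  have h2 := DFunLike.congr_fun (h.star_flowOp_mul_flowOp t) (constEmb P μ ξ)
  change star (h.flowOp t) (h.flowOp t (constEmb P μ ξ)) = constEmb P μ ξ at h2
  rwa [h1] at h2

/-- The implementing unitaries carry `f ⊗ 1` to `(f ∘ θ_t) ⊗ 1`. They normalise `L^∞(Ω) ⊗ 1`, and
therefore its commutant `M`. -/
theorem conj_mem (h : IsCocycle P μ θ k) (t : ℝ) {m : Bd (L2L2 P μ)}
    (hm : m ∈ (tensorVN P μ).toStarSubalgebra) :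
    h.implOp t * m * h.implOp (-t) ∈ (tensorVN P μ).toStarSubalgebra := by
  rw [mem_tensorVN_iff] at hm ⊢
  intro f
  have h1 := h.implOp_mul_mulOp (-t) f
  set f' := Lp.compMeasurePreserving (θ (-t)) (h.measurePreserving (-t)) f
  have h2 : mulOp μ f * h.implOp t = h.implOp t * mulOp μ f' := by
    calc mulOp μ f * h.implOp t
        = h.implOp t * h.implOp (-t) * mulOp μ f * h.implOp t := by rw [h.implOp_mul_neg, one_mul]
      _ = h.implOp t * (h.implOp (-t) * mulOp μ f) * h.implOp t := by simp only [mul_assoc]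
      _ = h.implOp t * mulOp μ f' * (h.implOp (-t) * h.implOp t) := by
        rw [h1]
        simp only [mul_assoc]
      _ = h.implOp t * mulOp μ f' := by rw [h.implOp_neg_mul, mul_one]
  calc mulOp μ f * (h.implOp t * m * h.implOp (-t))
      = mulOp μ f * h.implOp t * m * h.implOp (-t) := by simp only [mul_assoc]
    _ = h.implOp t * (mulOp μ f' * m) * h.implOp (-t) := by
      rw [h2]
      simp only [mul_assoc]
    _ = h.implOp t * m * (mulOp μ f' * h.implOp (-t)) := by
      rw [(hm f').eq]
      simp only [mul_assoc]
    _ = h.implOp t * m * h.implOp (-t) * mulOp μ f := by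
      rw [← h1]
      simp only [mul_assoc]

/-- The automorphism of `L^∞(Ω) ⊗̄ B(L²(X))` at time `t`. -/
def auto (h : IsCocycle P μ θ k) (t : ℝ) : Elt (tensorVN P μ) ≃⋆ₐ[ℂ] Elt (tensorVN P μ) where
  toFun m := ⟨h.implOp t * m * h.implOp (-t), h.conj_mem t m.2⟩
  invFun m := ⟨h.implOp (-t) * m * h.implOp (- -t), h.conj_mem (-t) m.2⟩
  left_inv m := Subtype.ext <| by
    change h.implOp (-t) * (h.implOp t * m * h.implOp (-t)) * h.implOp (- -t) = m
    rw [h.conj_conj, neg_add_cancel, h.conj_zero]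
  right_inv m := Subtype.ext <| by
    change h.implOp t * (h.implOp (-t) * m * h.implOp (- -t)) * h.implOp (-t) = m
    rw [h.conj_conj, add_neg_cancel, h.conj_zero]
  map_mul' m n := Subtype.ext <| by
    change h.implOp t * ((m : Bd (L2L2 P μ)) * n) * h.implOp (-t) =
      h.implOp t * m * h.implOp (-t) * (h.implOp t * n * h.implOp (-t))
    rw [mul_assoc (h.implOp t * m : Bd (L2L2 P μ)), ← mul_assoc (h.implOp (-t)),
      ← mul_assoc (h.implOp (-t)), h.implOp_neg_mul, one_mul]
    simp only [mul_assoc]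
  map_add' m n := Subtype.ext <| by
    change h.implOp t * ((m : Bd (L2L2 P μ)) + n) * h.implOp (-t) =
      h.implOp t * m * h.implOp (-t) + h.implOp t * n * h.implOp (-t)
    rw [mul_add, add_mul]
  map_star' m := Subtype.ext <| by
    change h.implOp t * star (m : Bd (L2L2 P μ)) * h.implOp (-t) =
      star (h.implOp t * m * h.implOp (-t))
    rw [star_mul, star_mul, h.star_implOp, h.star_implOp, neg_neg, mul_assoc]
  map_smul' c m := Subtype.ext <| by
    change h.implOp t * (c • (m : Bd (L2L2 P μ))) * h.implOp (-t) =
      c • (h.implOp t * m * h.implOp (-t))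
    rw [mul_smul_comm, smul_mul_assoc]

/-- Multiplication by the cocycle, as an element of `L^∞(Ω) ⊗̄ B(L²(X))`. -/
def phase (h : IsCocycle P μ θ k) (t : ℝ) : Elt (tensorVN P μ) :=
  ⟨h.phaseOp t, multOp_mem (h.bddMeas t)⟩

theorem star_phase_mul_phase (h : IsCocycle P μ θ k) (t : ℝ) : star (h.phase t) * h.phase t = 1 :=
  Subtype.ext (h.star_phaseOp_mul_phaseOp t)

theorem phase_mul_star_phase (h : IsCocycle P μ θ k) (t : ℝ) : h.phase t * star (h.phase t) = 1 :=
  Subtype.ext (h.phaseOp_mul_star_phaseOp t)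

theorem auto_mulElt (h : IsCocycle P μ θ k) (t : ℝ) (f : Lp ℂ ∞ P) :
    h.auto t (mulElt μ f) =
      mulElt μ (Lp.compMeasurePreserving (θ t) (h.measurePreserving t) f) := by
  refine Subtype.ext ?_
  change h.implOp t * mulOp μ f * h.implOp (-t) = mulOp μ _
  rw [h.implOp_mul_mulOp, mul_assoc, h.implOp_mul_neg, mul_one]

/-- Composition with the flow commutes with `1 ⊗ z`, so only the phase is left in the conjugation.
-/
theorem auto_ampHom (h : IsCocycle P μ θ k) (t : ℝ) (z : Bd (L2 μ)) :
    h.auto t (ampHom P μ z) = h.phase t * ampHom P μ z * star (h.phase t) := by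
  refine Subtype.ext ?_
  change h.implOp t * ampOp P z * h.implOp (-t) = h.phaseOp t * ampOp P z * star (h.phaseOp t)
  have h1 : h.implOp t * ampOp P z = h.phaseOp t * ampOp P z * star (h.phaseOp t) * h.implOp t := by
    rw [mul_assoc _ (star (h.phaseOp t)), ← h.flowOp_eq, mul_assoc, ← h.flowOp_mul_ampOp, implOp,
      mul_assoc]
  rw [h1, mul_assoc, h.implOp_mul_neg, mul_one]

/-- Split the automorphism. Conjugation by the flow operator fixes the constants `1 ⊗ ξ` and so
leaves `𝔼` unchanged; conjugation by the phase, a unitary of `M`, preserves the trace. -/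
theorem tensorTrace_auto (h : IsCocycle P μ θ k) (t : ℝ) (m : Elt (tensorVN P μ))
    (hm : 0 ≤ (m : Bd (L2L2 P μ))) : tensorTrace P μ (h.auto t m) = tensorTrace P μ m := by
  set n : Elt (tensorVN P μ) := star (h.phase t) * h.auto t m * h.phase t with hn
  have hn' : (n : Bd (L2L2 P μ)) = h.flowOp t * m * star (h.flowOp t) := by
    rw [h.flowOp_eq, star_mul, star_star, h.star_implOp]
    change star (h.phaseOp t) * (h.implOp t * m * h.implOp (-t)) * h.phaseOp t = _
    simp only [mul_assoc]
  have hn0 : 0 ≤ (n : Bd (L2L2 P μ)) := by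
    rw [hn']
    exact star_right_conjugate_nonneg hm _
  have h1 : h.auto t m = h.phase t * n * star (h.phase t) := by
    rw [hn, ← mul_assoc, ← mul_assoc, h.phase_mul_star_phase, one_mul, mul_assoc,
      h.phase_mul_star_phase, mul_one]
  have h2 : meanExp P μ n = meanExp P μ m := by
    refine ContinuousLinearMap.ext fun ξ => ext_inner_left ℂ fun η => ?_
    rw [meanExp_apply, meanExp_apply, hn']
    change ⟪constEmb P μ η, h.flowOp t ((m : Bd (L2L2 P μ))
      (star (h.flowOp t) (constEmb P μ ξ)))⟫_ℂ = _
    rw [h.star_flowOp_constEmb, ← ContinuousLinearMap.adjoint_inner_left,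
      ← ContinuousLinearMap.star_eq_adjoint, h.star_flowOp_constEmb]
  rw [h1, tensorTrace_conj _ _ (h.star_phase_mul_phase t) hn0, tensorTrace, h2, tensorTrace]

theorem continuous_auto (h : IsCocycle P μ θ k) (t : ℝ) :
    Continuous[weakStarVN (tensorVN P μ), weakStarVN (tensorVN P μ)] (h.auto t) := by
  let _ := weakStar (L2L2 P μ)
  let _ := weakStarVN (tensorVN P μ)
  refine continuous_induced_rng.2 ?_
  exact (continuous_weakStar_comp (h.implOp t) (h.implOp (-t))).comp continuous_induced_dom

theorem isTracePreservingGroup_auto (h : IsCocycle P μ θ k)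
    (hc : ∀ F, Continuous fun t => h.implOp t F) :
    IsTracePreservingGroup (tensorVN P μ) (tensorTrace P μ) h.auto where
  zero m := Subtype.ext (h.conj_zero m)
  add s t m := Subtype.ext (h.conj_conj s t m).symm
  normal := h.continuous_auto
  continuous m := by
    refine continuous_induced_rng.2 ?_
    have h1 := continuous_weakStar_conj (A := h.implOp) (m := (m : Bd (L2L2 P μ)))
      (fun F => by simpa only [h.star_implOp, Function.comp_def] using (hc F).comp continuous_neg)
      h.norm_implOp_le
    simp only [h.star_implOp] at h1
    exact h1
  trace := h.tensorTrace_auto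

end IsCocycle

end Cocycle

/-! ### Weakly measurable maps with values in a Hilbert space -/

section Pettis

variable {H : Type*} [NormedAddCommGroup H] [InnerProductSpace ℝ H]

theorem _root_.Orthonormal.countable_index {ι : Type*} [TopologicalSpace.SeparableSpace H]
    {b : ι → H} (hb : Orthonormal ℝ b) : Countable ι := by
  refine Pairwise.countable_of_isOpen_disjoint (s := fun i => Metric.ball (b i) (1 / 2))
    (fun i j hij => ?_) (fun _ => Metric.isOpen_ball) (fun i => ⟨b i, by simp⟩)
  refine Metric.ball_disjoint_ball ?_
  have h1 : ‖b i - b j‖ ^ 2 = 2 := by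
    rw [norm_sub_sq_real, hb.1, hb.1, hb.2 hij]
    norm_num
  rw [dist_eq_norm]
  nlinarith [norm_nonneg (b i - b j)]

/-- Expand `α x` in a Hilbert basis. Separability makes the basis countable, so that limits along
finite subsets preserve strong measurability. -/
theorem stronglyMeasurable_of_inner [CompleteSpace H] [TopologicalSpace.SeparableSpace H]
    {X : Type*} [MeasurableSpace X] {α : X → H} (hα : ∀ h : H, Measurable fun x => ⟪h, α x⟫_ℝ) :
    StronglyMeasurable α := by
  obtain ⟨w, b, -⟩ := exists_hilbertBasis ℝ H
  have := b.orthonormal.countable_index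
  refine stronglyMeasurable_of_tendsto Filter.atTop
    (f := fun (s : Finset w) x => ∑ i ∈ s, ⟪b i, α x⟫_ℝ • b i) (fun s => ?_)
    (tendsto_pi_nhds.2 fun x => ?_)
  · exact Finset.stronglyMeasurable_fun_sum _ fun i _ =>
      (hα (b i)).stronglyMeasurable.smul_const (b i)
  · have := b.hasSum_repr (α x)
    simp only [b.repr_apply_apply] at this
    exact this

/-- Project onto the closed span of `s`, which is separable: the projection of `α` is strongly
measurable there and agrees with `α` almost everywhere. -/
theorem aestronglyMeasurable_of_inner [CompleteSpace H] {X : Type*} [MeasurableSpace X]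
    {μ : Measure X} {α : X → H} (hα : ∀ h : H, Measurable fun x => ⟪α x, h⟫_ℝ)
    (hsep : ∃ s : Set H, TopologicalSpace.IsSeparable s ∧ ∀ᵐ x ∂μ, α x ∈ s) :
    AEStronglyMeasurable α μ := by
  obtain ⟨s, hs, hαs⟩ := hsep
  let V : Submodule ℝ H := (Submodule.span ℝ s).topologicalClosure
  have hV : IsClosed (V : Set H) := Submodule.isClosed_topologicalClosure _
  have : CompleteSpace V := hV.completeSpace_coe
  have : TopologicalSpace.SeparableSpace V := by
    have h1 : TopologicalSpace.IsSeparable (V : Set H) := (hs.span (R := ℝ)).closure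
    exact h1.separableSpace
  have h1 : StronglyMeasurable fun x => V.orthogonalProjectionOnto (α x) := by
    refine stronglyMeasurable_of_inner fun v => ?_
    simp only [Submodule.inner_orthogonalProjectionOnto_eq_of_mem_left]
    simpa only [real_inner_comm] using hα v
  refine ⟨_, V.subtypeL.continuous.comp_stronglyMeasurable h1, ?_⟩
  filter_upwards [hαs] with x hx
  have h2 : α x ∈ V := Submodule.le_topologicalClosure _ (Submodule.subset_span hx)
  exact congrArg Subtype.val (V.orthogonalProjectionOnto_mem_subspace_eq_self ⟨α x, h2⟩).symm

end Pettis

/-! ### The shift on `L²(ℝ, H)` -/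

section Shift

variable {H : Type*} [NormedAddCommGroup H]

theorem shift_apply (t : ℝ) (g : Lp H 2 (volume : Measure ℝ)) :
    shift t g =ᵐ[volume] fun s => g (s - t) :=
  Lp.coeFn_compMeasurePreserving g (measurePreserving_sub_right volume t)

theorem shift_shift (s t : ℝ) (g : Lp H 2 (volume : Measure ℝ)) :
    shift s (shift t g) = shift (s + t) g := by
  refine Lp.ext ?_
  filter_upwards [shift_apply s (shift t g), shift_apply (s + t) g,
    (measurePreserving_sub_right volume s).quasiMeasurePreserving.ae (shift_apply t g)]
    with r h1 h2 h3
  rw [h1, h2, h3, sub_sub]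

theorem norm_shift (t : ℝ) (g : Lp H 2 (volume : Measure ℝ)) : ‖shift t g‖ = ‖g‖ :=
  Lp.norm_compMeasurePreserving g (measurePreserving_sub_right volume t)

theorem continuous_shift (g : Lp H 2 (volume : Measure ℝ)) : Continuous fun t => shift t g := by
  let c : ℝ → C(ℝ, ℝ) := fun t => ⟨fun s => s - t, by fun_prop⟩
  have hc : Continuous c :=
    ContinuousMap.continuous_of_continuous_uncurry _ (by
      change Continuous fun p : ℝ × ℝ => p.2 - p.1
      fun_prop)
  exact Continuous.compMeasurePreservingLp (f := fun _ => g) (g := c) continuous_const hc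
    (fun t => measurePreserving_sub_right volume t) (by simp)

/-- The difference of the indicator functions of `[0, t]` and `[t, 0]`. -/
def timeInd (t s : ℝ) : ℝ :=
  (Set.Icc 0 t).indicator (fun _ => 1) s - (Set.Icc t 0).indicator (fun _ => 1) s

/-- As a difference of two Heaviside functions, the signed indicator telescopes for all signs of the
times. The endpoints are excluded because the intervals are closed. -/
theorem timeInd_eq {t r : ℝ} (h0 : r ≠ 0) (h1 : r ≠ t) :
    timeInd t r = (if 0 < r then 1 else 0) - (if t < r then 1 else 0) := by
  simp only [timeInd, Set.indicator, Set.mem_Icc]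
  rcases lt_or_gt_of_ne h0 with h0 | h0 <;> rcases lt_or_gt_of_ne h1 with h1 | h1 <;>
    simp [h0, h1, h0.le, h1.le, h0.not_ge, h1.not_ge, h0.not_gt, h1.not_gt]

theorem timeInd_add {s t r : ℝ} (h0 : r ≠ 0) (h1 : r ≠ s) (h2 : r ≠ s + t) :
    timeInd (s + t) r = timeInd s r + timeInd t (r - s) := by
  rw [timeInd_eq h0 h2, timeInd_eq h0 h1, timeInd_eq (sub_ne_zero.2 h1) fun h => h2 (by linarith)]
  simp only [lt_sub_iff_add_lt', add_zero]
  ring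

theorem norm_timeVec_of_nonneg {t : ℝ} (ht : 0 ≤ t) (h : H) :
    ‖timeVec t h‖ = √t * ‖h‖ := by
  have h0 : indicatorConstLp 2 (measurableSet_Icc (a := t) (b := (0 : ℝ)))
      (measure_Icc_lt_top (μ := volume)).ne h = 0 := by
    rw [← norm_eq_zero, norm_indicatorConstLp (by simp) (by simp)]
    simp [ht]
  rw [timeVec, h0, sub_zero, norm_indicatorConstLp (by simp) (by simp), mul_comm]
  simp [ht, Real.sqrt_eq_rpow]

variable [InnerProductSpace ℝ H]

/-- The shift as a linear isometry. -/
def shiftₗᵢ (t : ℝ) : Lp H 2 (volume : Measure ℝ) →ₗᵢ[ℝ] Lp H 2 (volume : Measure ℝ) :=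
  Lp.compMeasurePreservingₗᵢ ℝ (fun s : ℝ => s - t) (measurePreserving_sub_right volume t)

theorem timeVec_apply (t : ℝ) (h : H) :
    timeVec t h =ᵐ[volume] fun s => timeInd t s • h := by
  filter_upwards [Lp.coeFn_sub
      (indicatorConstLp 2 (measurableSet_Icc (a := (0 : ℝ)) (b := t)) measure_Icc_lt_top.ne h)
      (indicatorConstLp 2 (measurableSet_Icc (a := t) (b := (0 : ℝ))) measure_Icc_lt_top.ne h),
    indicatorConstLp_coeFn (p := 2) (hs := measurableSet_Icc (a := (0 : ℝ)) (b := t))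
      (hμs := (measure_Icc_lt_top (μ := volume)).ne) (c := h),
    indicatorConstLp_coeFn (p := 2) (hs := measurableSet_Icc (a := t) (b := (0 : ℝ)))
      (hμs := (measure_Icc_lt_top (μ := volume)).ne) (c := h)] with s h1 h2 h3
  rw [timeVec, h1, Pi.sub_apply, h2, h3, timeInd, sub_smul]
  simp only [Set.indicator]
  split_ifs <;> simp

/-- The increment over `[s, s+t]` is the shifted increment over `[0, t]`. This is the additive
cocycle relation from which the group law is built. -/
theorem timeVec_add (s t : ℝ) (h : H) :
    timeVec (s + t) h = timeVec s h + shift s (timeVec t h) := by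
  refine Lp.ext ?_
  filter_upwards [timeVec_apply (s + t) h, timeVec_apply s h, shift_apply s (timeVec t h),
    (measurePreserving_sub_right volume s).quasiMeasurePreserving.ae (timeVec_apply t h),
    Lp.coeFn_add (timeVec s h) (shift s (timeVec t h)),
    Measure.ae_ne volume (0 : ℝ), Measure.ae_ne volume s, Measure.ae_ne volume (s + t)]
    with r h1 h2 h3 h4 h5 h6 h7 h8
  rw [h1, h5, Pi.add_apply, h2, h3, h4, timeInd_add h6 h7 h8, add_smul]

/-- `timeVec` as a linear map. -/
def timeVecₗ (t : ℝ) : H →ₗ[ℝ] Lp H 2 (volume : Measure ℝ) where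
  toFun := timeVec t
  map_add' h h' := by
    refine Lp.ext ?_
    filter_upwards [timeVec_apply t h, timeVec_apply t h', timeVec_apply t (h + h'),
      Lp.coeFn_add (timeVec t h) (timeVec t h')] with s h1 h2 h3 h4
    rw [h3, h4, Pi.add_apply, h1, h2, smul_add]
  map_smul' c h := by
    refine Lp.ext ?_
    filter_upwards [timeVec_apply t h, timeVec_apply t (c • h),
      Lp.coeFn_smul c (timeVec t h)] with s h1 h3 h4
    rw [h3, RingHom.id_apply, h4, Pi.smul_apply, h1, smul_comm]

theorem timeVec_sub (t : ℝ) (h h' : H) : timeVec t (h - h') = timeVec t h - timeVec t h' :=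
  map_sub (timeVecₗ t) h h'

/-- For negative times, the cocycle relation at `t + (-t) = 0` writes the vector as minus a shift of
the one at time `-t`. -/
theorem norm_timeVec (t : ℝ) (h : H) : ‖timeVec t h‖ = √|t| * ‖h‖ := by
  rcases le_total 0 t with ht | ht
  · rw [norm_timeVec_of_nonneg ht, abs_of_nonneg ht]
  · have h1 := timeVec_add t (-t) h
    have h2 : timeVec 0 h = 0 := by
      rw [← norm_eq_zero, norm_timeVec_of_nonneg le_rfl]
      simp
    rw [add_neg_cancel, h2] at h1
    rw [eq_neg_of_add_eq_zero_left h1.symm, norm_neg, norm_shift,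
      norm_timeVec_of_nonneg (neg_nonneg.2 ht), abs_of_nonpos ht]

theorem continuous_timeVec_right (t : ℝ) : Continuous fun h : H => timeVec t h :=
  ((timeVecₗ t).mkContinuous (√|t|) fun h => (norm_timeVec t h).le).continuous

theorem norm_timeVec_sub (s t : ℝ) (h : H) :
    ‖timeVec t h - timeVec s h‖ = √|t - s| * ‖h‖ := by
  have h1 := timeVec_add s (t - s) h
  rw [add_sub_cancel] at h1
  rw [h1, add_sub_cancel_left, norm_shift, norm_timeVec]

theorem continuous_timeVec (h : H) : Continuous fun t => timeVec t h := by
  refine continuous_iff_continuousAt.2 fun s => ?_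
  rw [ContinuousAt, tendsto_iff_norm_sub_tendsto_zero]
  simp only [norm_timeVec_sub]
  have h1 : Continuous fun t : ℝ => √|t - s| * ‖h‖ := by fun_prop
  simpa using h1.tendsto s

end Shift

/-! ### The Gaussian cocycle -/

section GaussianCocycle

/-- The class of `exp(i W(g))` in `L²(Ω)`. -/
def expTwo {G : Type*} {P : Measure (G → ℝ)} [IsFiniteMeasure P] (g : G) : Lp ℂ 2 P :=
  MemLp.toLp (fun ω => Complex.exp (Complex.I * (ω g : ℂ)))
    (MemLp.of_bound (measurable_exp_I_eval g).aestronglyMeasurable 1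
      (Filter.Eventually.of_forall fun ω => by rw [mul_comm, Complex.norm_exp_ofReal_mul_I]))

theorem coeFn_expTwo {G : Type*} {P : Measure (G → ℝ)} [IsFiniteMeasure P] (g : G) :
    expTwo (P := P) g =ᵐ[P] fun ω => Complex.exp (Complex.I * (ω g : ℂ)) :=
  MemLp.coeFn_toLp _

variable {H : Type*} [NormedAddCommGroup H] [InnerProductSpace ℝ H]
  {X : Type*} {α : X → H} {P : Measure (Lp H 2 (volume : Measure ℝ) → ℝ)}

/-- The action of the shift on the paths of the isonormal process. -/
def pathShift (t : ℝ) (ω : Lp H 2 (volume : Measure ℝ) → ℝ) : Lp H 2 (volume : Measure ℝ) → ℝ :=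
  fun g => ω (shift t g)

/-- `√2 W_t(α_x) = W(phaseVec α t x)`. -/
def phaseVec (α : X → H) (t : ℝ) (x : X) : Lp H 2 (volume : Measure ℝ) := √2 • timeVec t (α x)

theorem phaseVec_add (s t : ℝ) (x : X) :
    phaseVec α (s + t) x = phaseVec α s x + shift s (phaseVec α t x) := by
  have h1 : shift s (phaseVec α t x) = √2 • shift s (timeVec t (α x)) :=
    map_smul (shiftₗᵢ s) _ _
  rw [h1, phaseVec, phaseVec, timeVec_add, smul_add]

theorem continuous_phaseVec (x : X) : Continuous fun t => phaseVec α t x :=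
  (continuous_const_smul (√2)).comp (continuous_timeVec (α x))

/-- The factor `√2` is chosen to cancel the `1/2` in the Gaussian characteristic function. -/
theorem norm_phaseVec_sub_sq {t : ℝ} (ht : 0 ≤ t) (x y : X) :
    ‖phaseVec α t x - phaseVec α t y‖ ^ 2 / 2 = t * ‖α x - α y‖ ^ 2 := by
  rw [phaseVec, phaseVec, ← smul_sub, ← timeVec_sub, norm_smul, norm_timeVec_of_nonneg ht, mul_pow,
    mul_pow, Real.sq_sqrt ht, Real.norm_eq_abs, sq_abs, Real.sq_sqrt (by norm_num)]
  ring

variable [MeasurableSpace X] {μ : Measure X}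

namespace IsIsonormalLaw

theorem aestronglyMeasurable_phaseVec (hα : AEStronglyMeasurable α μ) (t : ℝ) :
    AEStronglyMeasurable (phaseVec α t) μ :=
  ((continuous_timeVec_right t).comp_aestronglyMeasurable hα).const_smul (√2)

/-- A jointly measurable version of `(ω, x) ↦ √2 W_t(α_x)(ω)`. -/
def phaseField (hP : IsIsonormalLaw P) (hα : AEStronglyMeasurable α μ) (t : ℝ) :
    (Lp H 2 (volume : Measure ℝ) → ℝ) × X → ℝ :=
  (hP.exists_jointVersion (aestronglyMeasurable_phaseVec hα t)).choose

theorem measurable_phaseField (hP : IsIsonormalLaw P) (hα : AEStronglyMeasurable α μ) (t : ℝ) :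
    Measurable (hP.phaseField hα t) :=
  (hP.exists_jointVersion (aestronglyMeasurable_phaseVec hα t)).choose_spec.1

theorem phaseField_ae (hP : IsIsonormalLaw P) (hα : AEStronglyMeasurable α μ) (t : ℝ) :
    ∀ᵐ x ∂μ, ∀ᵐ ω ∂P, hP.phaseField hα t (ω, x) = ω (phaseVec α t x) :=
  (hP.exists_jointVersion (aestronglyMeasurable_phaseVec hα t)).choose_spec.2

/-- A jointly measurable version of `(ω, x) ↦ exp(√2 i W_t(α_x)(ω))`. -/
def phaseFun (hP : IsIsonormalLaw P) (hα : AEStronglyMeasurable α μ) (t : ℝ)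
    (p : (Lp H 2 (volume : Measure ℝ) → ℝ) × X) : ℂ :=
  Complex.exp (Complex.I * (hP.phaseField hα t p : ℂ))

theorem measurable_phaseFun (hP : IsIsonormalLaw P) (hα : AEStronglyMeasurable α μ) (t : ℝ) :
    Measurable (hP.phaseFun hα t) :=
  Complex.measurable_exp.comp
    ((Complex.measurable_ofReal.comp (hP.measurable_phaseField hα t)).const_mul Complex.I)

theorem norm_phaseFun (hP : IsIsonormalLaw P) (hα : AEStronglyMeasurable α μ) (t : ℝ)
    (p : (Lp H 2 (volume : Measure ℝ) → ℝ) × X) : ‖hP.phaseFun hα t p‖ = 1 := by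
  rw [phaseFun, mul_comm, Complex.norm_exp_ofReal_mul_I]

theorem phaseFun_ae (hP : IsIsonormalLaw P) (hα : AEStronglyMeasurable α μ) (t : ℝ) :
    ∀ᵐ x ∂μ, ∀ᵐ ω ∂P, hP.phaseFun hα t (ω, x) =
      Complex.exp (Complex.I * (ω (phaseVec α t x) : ℂ)) := by
  filter_upwards [hP.phaseField_ae hα t] with x hx
  filter_upwards [hx] with ω hω
  rw [phaseFun, hω]

theorem measurePreserving_pathShift [IsProbabilityMeasure P] (hP : IsIsonormalLaw P) (t : ℝ) :
    MeasurePreserving (pathShift t) P P :=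
  hP.measurePreserving_comp (shiftₗᵢ t)

/-- For fixed `x` the identity holds almost surely, by `phaseVec_add` and linearity of the process.
Joint measurability allows the two "almost every" to be exchanged. -/
theorem isCocycle [IsProbabilityMeasure P] [SFinite μ] (hP : IsIsonormalLaw P)
    (hα : AEStronglyMeasurable α μ) : IsCocycle P μ pathShift (hP.phaseFun hα) where
  measurePreserving := hP.measurePreserving_pathShift
  flow_add s t ω := funext fun g => by
    change ω (shift s (shift t g)) = ω (shift (s + t) g)
    rw [shift_shift]
  measurable := hP.measurable_phaseFun hα
  norm := hP.norm_phaseFun hα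
  add s t := by
    have hm : Measurable fun p : (Lp H 2 (volume : Measure ℝ) → ℝ) × X =>
        hP.phaseFun hα s p * hP.phaseFun hα t (pathShift s p.1, p.2) :=
      (hP.measurable_phaseFun hα s).mul ((hP.measurable_phaseFun hα t).comp
        (((hP.measurePreserving_pathShift s).measurable.comp measurable_fst).prodMk
          measurable_snd))
    have hms := measurableSet_eq_fun (hP.measurable_phaseFun hα (s + t)) hm
    refine (Measure.ae_ae_comm hms).2 ?_
    filter_upwards [hP.phaseFun_ae hα (s + t), hP.phaseFun_ae hα s, hP.phaseFun_ae hα t]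
      with x h1 h2 h3
    filter_upwards [h1, h2, (hP.measurePreserving_pathShift s).quasiMeasurePreserving.ae h3,
      hP.aelinear.add (phaseVec α s x) (shift s (phaseVec α t x))] with ω h1 h2 h3 h4
    rw [h1, h2, h3, phaseVec_add, h4, ← Complex.exp_add, pathShift]
    congr 1
    push_cast
    ring

/-- The exponentials are total in complex `L²(Ω)`, as a function orthogonal to all of them vanishes.
-/
theorem expTwo_induction [IsProbabilityMeasure P] (hP : IsIsonormalLaw P)
    (S : Submodule ℂ (Lp ℂ 2 P)) (hS : IsClosed (S : Set (Lp ℂ 2 P)))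
    (h : ∀ g, expTwo g ∈ S) (f : Lp ℂ 2 P) : f ∈ S := by
  have : CompleteSpace S := hS.completeSpace_coe
  have hbot : Sᗮ = ⊥ := by
    refine (Submodule.eq_bot_iff _).2 fun f hf => ?_
    have hf1 : Integrable f P := (Lp.memLp f).integrable (by norm_num)
    refine Lp.ext ((hP.ae_eq_zero_of_integral_exp hf1 fun g => ?_).trans
      (Lp.coeFn_zero _ _ _).symm)
    have h1 := (Submodule.mem_orthogonal S f).1 hf (expTwo (-g)) (h (-g))
    rw [L2.inner_def] at h1
    rw [← h1]
    refine integral_congr_ae ?_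
    filter_upwards [coeFn_expTwo (P := P) (-g), hP.aelinear.neg g] with ω h2 h3
    rw [h2, h3, RCLike.inner_apply, ← Complex.exp_conj]
    congr 2
    simp
  rw [Submodule.orthogonal_eq_bot_iff] at hbot
  rw [hbot]
  trivial

theorem lintegral_enorm_exp_sub_sq_le (hP : IsIsonormalLaw P) (g g' : Lp H 2 (volume : Measure ℝ)) :
    ∫⁻ ω, ‖Complex.exp (Complex.I * (ω g : ℂ)) - Complex.exp (Complex.I * (ω g' : ℂ))‖ₑ ^ 2 ∂P ≤
      ENNReal.ofReal (‖g - g'‖ ^ 2) := by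
  rw [← hP.lintegral_enorm_sub_sq]
  refine lintegral_mono fun ω => ?_
  have : ‖Complex.exp (Complex.I * (ω g : ℂ)) - Complex.exp (Complex.I * (ω g' : ℂ))‖ₑ ≤
      ‖ω g - ω g'‖ₑ := by
    rw [← ofReal_norm, ← ofReal_norm]
    exact ENNReal.ofReal_le_ofReal (norm_exp_I_sub_le _ _)
  gcongr

/-- The image of `exp(i W(g)) ⊗ ξ` under the implementing unitary is the product of `ξ` with this
function. -/
def movedFun (hP : IsIsonormalLaw P) (hα : AEStronglyMeasurable α μ)
    (g : Lp H 2 (volume : Measure ℝ)) (t : ℝ) (p : (Lp H 2 (volume : Measure ℝ) → ℝ) × X) : ℂ :=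
  hP.phaseFun hα t p * Complex.exp (Complex.I * (p.1 (shift t g) : ℂ))

theorem measurable_movedFun (hP : IsIsonormalLaw P) (hα : AEStronglyMeasurable α μ)
    (g : Lp H 2 (volume : Measure ℝ)) (t : ℝ) : Measurable (hP.movedFun hα g t) :=
  (hP.measurable_phaseFun hα t).mul ((measurable_exp_I_eval (shift t g)).comp measurable_fst)

theorem norm_movedFun (hP : IsIsonormalLaw P) (hα : AEStronglyMeasurable α μ)
    (g : Lp H 2 (volume : Measure ℝ)) (t : ℝ) (p : (Lp H 2 (volume : Measure ℝ) → ℝ) × X) :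
    ‖hP.movedFun hα g t p‖ = 1 := by
  rw [movedFun, norm_mul, hP.norm_phaseFun, mul_comm Complex.I, Complex.norm_exp_ofReal_mul_I,
    one_mul]

theorem movedFun_ae (hP : IsIsonormalLaw P) (hα : AEStronglyMeasurable α μ)
    (g : Lp H 2 (volume : Measure ℝ)) (t : ℝ) :
    ∀ᵐ x ∂μ, ∀ᵐ ω ∂P, hP.movedFun hα g t (ω, x) =
      Complex.exp (Complex.I * (ω (phaseVec α t x + shift t g) : ℂ)) := by
  filter_upwards [hP.phaseFun_ae hα t] with x hx
  filter_upwards [hx, hP.aelinear.add (phaseVec α t x) (shift t g)] with ω h1 h2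
  rw [movedFun, h1, h2, ← Complex.exp_add]
  congr 1
  push_cast
  ring

theorem implOp_tens_expTwo [IsProbabilityMeasure P] [SFinite μ] (hP : IsIsonormalLaw P)
    (hα : AEStronglyMeasurable α μ) (g : Lp H 2 (volume : Measure ℝ)) (t : ℝ) (ξ : L2 μ) :
    ∀ᵐ ω ∂P, ∀ᵐ x ∂μ, (hP.isCocycle hα).implOp t (tens P μ ξ (expTwo g)) ω x =
      hP.movedFun hα g t (ω, x) * ξ x := by
  filter_upwards [(hP.isCocycle hα).implOp_apply t (tens P μ ξ (expTwo g)),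
    (hP.measurePreserving_pathShift t).quasiMeasurePreserving.ae (tens_apply ξ (expTwo (P := P) g)),
    (hP.measurePreserving_pathShift t).quasiMeasurePreserving.ae (coeFn_expTwo (P := P) g)]
    with ω h1 h2 h3
  rw [h2, h3] at h1
  filter_upwards [h1, Lp.coeFn_smul (Complex.exp (Complex.I * (pathShift t ω g : ℂ))) ξ]
    with x h1 h4
  rw [h1, h4, Pi.smul_apply, smul_eq_mul, movedFun, pathShift, mul_assoc]

/-- Tonelli puts the integral over `Ω` inside. For fixed `x` it can then be compared with a distance
in `L²(ℝ, H)`. -/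
theorem enorm_implOp_tens_sub_sq [IsProbabilityMeasure P] [SFinite μ] (hP : IsIsonormalLaw P)
    (hα : AEStronglyMeasurable α μ) (g : Lp H 2 (volume : Measure ℝ)) (s t : ℝ) (ξ : L2 μ) :
    ‖(hP.isCocycle hα).implOp t (tens P μ ξ (expTwo g)) -
        (hP.isCocycle hα).implOp s (tens P μ ξ (expTwo g))‖ₑ ^ 2 =
      ∫⁻ x, (∫⁻ ω, ‖hP.movedFun hα g t (ω, x) - hP.movedFun hα g s (ω, x)‖ₑ ^ 2 ∂P) *
        ‖ξ x‖ₑ ^ 2 ∂μ := by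
  have hD : Measurable fun p : (Lp H 2 (volume : Measure ℝ) → ℝ) × X =>
      ‖hP.movedFun hα g t p - hP.movedFun hα g s p‖ₑ ^ 2 :=
    ((hP.measurable_movedFun hα g t).sub (hP.measurable_movedFun hα g s)).enorm.pow_const 2
  have hξ : Measurable fun x => ‖ξ x‖ₑ ^ 2 :=
    (Lp.stronglyMeasurable ξ).measurable.enorm.pow_const 2
  set F := tens P μ ξ (expTwo g)
  have h1 : ‖(hP.isCocycle hα).implOp t F - (hP.isCocycle hα).implOp s F‖ₑ ^ 2 =
      ∫⁻ ω, ∫⁻ x, ‖hP.movedFun hα g t (ω, x) - hP.movedFun hα g s (ω, x)‖ₑ ^ 2 *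
        ‖ξ x‖ₑ ^ 2 ∂μ ∂P := by
    rw [enorm_sq_L2]
    refine lintegral_congr_ae ?_
    filter_upwards [hP.implOp_tens_expTwo hα g t ξ, hP.implOp_tens_expTwo hα g s ξ,
      Lp.coeFn_sub ((hP.isCocycle hα).implOp t F) ((hP.isCocycle hα).implOp s F)] with ω h2 h3 h4
    rw [h4, Pi.sub_apply, enorm_sq_L2]
    refine lintegral_congr_ae ?_
    filter_upwards [h2, h3, Lp.coeFn_sub ((hP.isCocycle hα).implOp t F ω)
      ((hP.isCocycle hα).implOp s F ω)] with x h2 h3 h4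
    rw [h4, Pi.sub_apply, h2, h3, ← sub_mul, enorm_mul, mul_pow]
  rw [h1, lintegral_lintegral_swap (hD.mul (hξ.comp measurable_snd)).aemeasurable]
  refine lintegral_congr fun x => ?_
  exact lintegral_mul_const _ (hD.comp measurable_prodMk_right)

/-- For almost every `x` the inner integral is at most the squared distance between the vectors
`phaseVec α t x + shift t g` at the two times, which tends to zero; `4|ξ|²` dominates. -/
theorem continuous_implOp_tens_expTwo [IsProbabilityMeasure P] [SFinite μ] (hP : IsIsonormalLaw P)
    (hα : AEStronglyMeasurable α μ) (g : Lp H 2 (volume : Measure ℝ)) (ξ : L2 μ) :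
    Continuous fun t => (hP.isCocycle hα).implOp t (tens P μ ξ (expTwo g)) := by
  refine continuous_iff_continuousAt.2 fun s => tendsto_of_enorm_sq ?_
  simp only [hP.enorm_implOp_tens_sub_sq hα]
  have h0 : (0 : ℝ≥0∞) = ∫⁻ _, 0 ∂μ := by simp
  rw [h0]
  -- Sequences are needed: the version of the phase, hence the exceptional null set in `x`, depends
  -- on the time.
  refine Filter.tendsto_of_seq_tendsto fun u hu => ?_
  refine tendsto_lintegral_of_dominated_convergence' (fun x => 2 ^ 2 * ‖ξ x‖ₑ ^ 2) (fun n => ?_)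
    (fun n => ?_) ?_ ?_
  · have hD : Measurable fun p : (Lp H 2 (volume : Measure ℝ) → ℝ) × X =>
        ‖hP.movedFun hα g (u n) p - hP.movedFun hα g s p‖ₑ ^ 2 :=
      ((hP.measurable_movedFun hα g (u n)).sub (hP.measurable_movedFun hα g s)).enorm.pow_const 2
    exact (hD.lintegral_prod_left'.mul
      ((Lp.stronglyMeasurable ξ).measurable.enorm.pow_const 2)).aemeasurable
  · refine Filter.Eventually.of_forall fun x => ?_
    refine mul_le_mul_left ?_ _
    have h1 : ∀ ω, ‖hP.movedFun hα g (u n) (ω, x) - hP.movedFun hα g s (ω, x)‖ₑ ^ 2 ≤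
        (2 : ℝ≥0∞) ^ 2 := by
      intro ω
      refine pow_le_pow_left' ?_ 2
      rw [← ofReal_norm]
      refine ENNReal.ofReal_le_of_le_toReal ((norm_sub_le _ _).trans ?_)
      rw [hP.norm_movedFun, hP.norm_movedFun]
      norm_num
    refine (lintegral_mono h1).trans ?_
    simp
  · rw [lintegral_const_mul' _ _ (by simp), ← enorm_sq_L2]
    exact ENNReal.mul_ne_top (by simp) (ENNReal.pow_ne_top enorm_ne_top)
  · have hall : ∀ᵐ x ∂μ, ∀ n, ∀ᵐ ω ∂P, hP.movedFun hα g (u n) (ω, x) =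
        Complex.exp (Complex.I * (ω (phaseVec α (u n) x + shift (u n) g) : ℂ)) :=
      ae_all_iff.2 fun n => hP.movedFun_ae hα g (u n)
    filter_upwards [hall, hP.movedFun_ae hα g s] with x h1 h2
    have h3 : Filter.Tendsto (fun n => ∫⁻ ω, ‖hP.movedFun hα g (u n) (ω, x) -
        hP.movedFun hα g s (ω, x)‖ₑ ^ 2 ∂P) Filter.atTop (𝓝 0) := by
      have hc : Continuous fun t => ENNReal.ofReal (‖(phaseVec α t x + shift t g) -
          (phaseVec α s x + shift s g)‖ ^ 2) :=
        ENNReal.continuous_ofReal.comp (((((continuous_phaseVec x).add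
          (continuous_shift g)).sub continuous_const).norm).pow 2)
      have h4 := (hc.tendsto s).comp hu
      simp only [sub_self, norm_zero, ne_eq, OfNat.ofNat_ne_zero, not_false_eq_true, zero_pow,
        ENNReal.ofReal_zero] at h4
      refine tendsto_of_tendsto_of_tendsto_of_le_of_le tendsto_const_nhds h4
        (fun _ => zero_le) (fun n => ?_)
      refine le_trans (le_of_eq (lintegral_congr_ae ?_)) (hP.lintegral_enorm_exp_sub_sq_le _ _)
      filter_upwards [h1 n, h2] with ω h1 h2
      rw [h1, h2]
    have h5 := ENNReal.Tendsto.mul_const h3 (b := ‖ξ x‖ₑ ^ 2)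
      (Or.inr (ENNReal.pow_ne_top enorm_ne_top))
    simpa using h5

end IsIsonormalLaw

/-- Contractivity makes the orbits of nearby vectors uniformly close, and uniform limits of
continuous functions are continuous. -/
theorem isClosed_setOf_continuous_apply {E Z : Type*} [NormedAddCommGroup E] [NormedSpace ℂ E]
    [TopologicalSpace Z] {A : Z → E →L[ℂ] E} (hA : ∀ t, ‖A t‖ ≤ 1) :
    IsClosed {F : E | Continuous fun t => A t F} := by
  refine isClosed_of_closure_subset fun F hF => ?_
  refine continuous_of_uniform_approx_of_continuous fun u hu => ?_
  obtain ⟨ε, hε, hεu⟩ := Metric.mem_uniformity_dist.1 hu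
  obtain ⟨G, hG, hFG⟩ := Metric.mem_closure_iff.1 hF ε hε
  refine ⟨fun t => A t G, hG, fun t => hεu ?_⟩
  rw [dist_eq_norm, ← map_sub]
  refine ((A t).le_of_opNorm_le (hA t) _).trans_lt ?_
  rwa [one_mul, ← dist_eq_norm]

/-! ### Strong continuity of the unitary group, and its link with the process. -/

namespace IsIsonormalLaw

theorem continuous_implOp [IsProbabilityMeasure P] [SFinite μ] (hP : IsIsonormalLaw P)
    (hα : AEStronglyMeasurable α μ) (F : L2L2 P μ) :
    Continuous fun t => (hP.isCocycle hα).implOp t F := by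
  have hcl := isClosed_setOf_continuous_apply (hP.isCocycle hα).norm_implOp_le
  have h1 : ∀ (ξ : L2 μ) (f : Lp ℂ 2 P),
      Continuous fun t => (hP.isCocycle hα).implOp t (tens P μ ξ f) := by
    intro ξ f
    let S : Submodule ℂ (Lp ℂ 2 P) :=
      { carrier := {f | Continuous fun t => (hP.isCocycle hα).implOp t (tens P μ ξ f)}
        add_mem' := fun {f g} hf hg => by
          change Continuous _
          simp only [map_add]
          exact Continuous.add hf hg
        zero_mem' := by
          change Continuous _
          simpa only [map_zero] using continuous_const
        smul_mem' := fun c f hf => by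
          change Continuous _
          simp only [map_smul]
          exact Continuous.const_smul hf c }
    exact hP.expTwo_induction S (hcl.preimage (tens P μ ξ).continuous)
      (fun g => hP.continuous_implOp_tens_expTwo hα g ξ) f
  refine L2L2_induction (motive := fun F => Continuous fun t => (hP.isCocycle hα).implOp t F)
    (fun ξ s hs => h1 ξ _) (fun F G hF hG => ?_) hcl F
  simp only [map_add]
  exact hF.add hG

theorem compMeasurePreserving_expI [IsProbabilityMeasure P] (hP : IsIsonormalLaw P) (t : ℝ)
    (g : Lp H 2 (volume : Measure ℝ)) :
    Lp.compMeasurePreserving (pathShift t) (hP.measurePreserving_pathShift t)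
      (expI (hP.process g)) = expI (hP.process (shift t g)) := by
  have h0 : ∀ g, expI (hP.process g) =ᵐ[P] fun ω => Complex.exp (Complex.I * (ω g : ℂ)) := by
    intro g
    refine (MemLp.coeFn_toLp _).trans ?_
    filter_upwards [hP.coeFn_process g] with ω hω
    rw [hω]
  refine Lp.ext ?_
  filter_upwards [Lp.coeFn_compMeasurePreserving (expI (hP.process g))
    (hP.measurePreserving_pathShift t), h0 (shift t g),
    (hP.measurePreserving_pathShift t).quasiMeasurePreserving.ae (h0 g)] with ω h1 h2 h3
  rw [h1, h2, Function.comp_apply, h3, pathShift]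

theorem isGaussianMult_phase [IsProbabilityMeasure P] [SFinite μ] (hP : IsIsonormalLaw P)
    (hα : AEStronglyMeasurable α μ) (t : ℝ) :
    IsGaussianMult μ hP.process α t ((hP.isCocycle hα).phase t : Bd (L2L2 P μ)) := by
  refine ⟨hP.phaseFun hα t, hP.measurable_phaseFun hα t, ?_,
    multOp_apply_ae ((hP.isCocycle hα).bddMeas t)⟩
  filter_upwards [hP.phaseFun_ae hα t] with x hx
  filter_upwards [hx, hP.coeFn_process (timeVec t (α x)),
    hP.aelinear.smul (√2) (timeVec t (α x))] with ω h1 h2 h3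
  rw [h1, h2, phaseVec, h3]
  congr 1
  push_cast
  ring

end IsIsonormalLaw

end GaussianCocycle

/-! ### Kernels of Hilbert–Schmidt operators -/

section KernelTheory

variable {X : Type*} [MeasurableSpace X] {μ : Measure X} [SigmaFinite μ]

theorem memLp_tensKer (u v : L2 μ) :
    MemLp (fun p : X × X => u p.1 * (starRingEnd ℂ) (v p.2)) 2 (μ.prod μ) := by
  have hm : AEStronglyMeasurable (fun p : X × X => u p.1 * (starRingEnd ℂ) (v p.2))
      (μ.prod μ) :=
    (Lp.aestronglyMeasurable u).comp_fst.mul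
      (Complex.continuous_conj.comp_aestronglyMeasurable (Lp.aestronglyMeasurable v)).comp_snd
  refine ⟨hm, ?_⟩
  rw [eLpNorm_lt_top_iff_lintegral_rpow_enorm_lt_top (by simp) (by simp)]
  have h1 : ∀ p : X × X, ‖u p.1 * (starRingEnd ℂ) (v p.2)‖ₑ ^ (2 : ℝ≥0∞).toReal =
      ‖u p.1‖ₑ ^ 2 * ‖v p.2‖ₑ ^ 2 := by
    intro p
    rw [enorm_mul, RCLike.enorm_conj, ENNReal.toReal_ofNat, ENNReal.rpow_ofNat, mul_pow]
  simp only [h1]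
  rw [lintegral_prod_mul ((Lp.aestronglyMeasurable u).enorm.pow_const 2)
    ((Lp.aestronglyMeasurable v).enorm.pow_const 2), ← enorm_sq_L2, ← enorm_sq_L2]
  exact ENNReal.mul_lt_top (ENNReal.pow_lt_top enorm_lt_top) (ENNReal.pow_lt_top enorm_lt_top)

/-- The kernel `u(x) conj v(y)`. -/
def tensKer (u v : L2 μ) : Lp ℂ 2 (μ.prod μ) := (memLp_tensKer u v).toLp _

theorem tensKer_apply (u v : L2 μ) :
    tensKer u v =ᵐ[μ.prod μ] fun p => u p.1 * (starRingEnd ℂ) (v p.2) :=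
  (memLp_tensKer u v).coeFn_toLp

theorem inner_tensKer (u v : L2 μ) (f : Lp ℂ 2 (μ.prod μ)) :
    ⟪tensKer u v, f⟫_ℂ =
      ∫ p, f p * ((starRingEnd ℂ) (u p.1) * v p.2) ∂μ.prod μ := by
  rw [L2.inner_def]
  refine integral_congr_ae ?_
  filter_upwards [tensKer_apply u v] with p hp
  rw [hp, RCLike.inner_apply, map_mul, RCLike.conj_conj]

theorem integrable_kernel (u v : L2 μ) (f : Lp ℂ 2 (μ.prod μ)) :
    Integrable (fun p => f p * ((starRingEnd ℂ) (u p.1) * v p.2)) (μ.prod μ) := by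
  refine (L2.integrable_inner (𝕜 := ℂ) (tensKer u v) f).congr ?_
  filter_upwards [tensKer_apply u v] with p hp
  rw [hp, RCLike.inner_apply, map_mul, RCLike.conj_conj]

/-- Matrix coefficients of `K_f` are inner products of `f` with elementary kernels, which reduces
Hilbert–Schmidt operators to the geometry of `L²(X × X)`. -/
theorem inner_kernelOp (f : Lp ℂ 2 (μ.prod μ)) (ξ η : L2 μ) :
    ⟪η, kernelOp f ξ⟫_ℂ = ⟪tensKer η ξ, f⟫_ℂ := by
  rw [inner_tensKer, integral_prod _ (integrable_kernel η ξ f), L2.inner_def]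
  refine integral_congr_ae ?_
  filter_upwards [kernelOp_apply f ξ] with x hx
  rw [hx, RCLike.inner_apply, ← integral_mul_const]
  refine integral_congr_ae (Filter.Eventually.of_forall fun y => ?_)
  change f (x, y) * ξ y * _ = f (x, y) * (_ * ξ y)
  ring

theorem inner_tensKer_tensKer (u v u' v' : L2 μ) :
    ⟪tensKer u v, tensKer u' v'⟫_ℂ = ⟪u, u'⟫_ℂ * ⟪v', v⟫_ℂ := by
  rw [L2.inner_def (𝕜 := ℂ) u, L2.inner_def (𝕜 := ℂ) v', ← integral_prod_mul, inner_tensKer]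
  refine integral_congr_ae ?_
  filter_upwards [tensKer_apply u' v'] with p hp
  rw [hp, RCLike.inner_apply, RCLike.inner_apply]
  ring

theorem kernelOp_tensKer (u v : L2 μ) :
    kernelOp (tensKer u v) = InnerProductSpace.rankOne ℂ u v := by
  refine ContinuousLinearMap.ext fun ξ => ext_inner_left ℂ fun η => ?_
  rw [inner_kernelOp, inner_tensKer_tensKer, InnerProductSpace.rankOne_apply, inner_smul_right,
    mul_comm]

/-- On a box of finite measure `f` is integrable, and indicators of rectangles show that its
integral over every rectangle vanishes. A π-λ argument and σ-finiteness then give `f = 0`. -/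
theorem eq_zero_of_inner_tensKer {f : Lp ℂ 2 (μ.prod μ)}
    (h : ∀ u v : L2 μ, ⟪tensKer u v, f⟫_ℂ = 0) : f = 0 := by
  have hSm : ∀ n, MeasurableSet (spanningSets μ n ×ˢ spanningSets μ n) := fun n =>
    (measurableSet_spanningSets μ n).prod (measurableSet_spanningSets μ n)
  have hrect : ∀ n (A B : Set X), MeasurableSet A → MeasurableSet B →
      ∫ p in A ×ˢ B, (spanningSets μ n ×ˢ spanningSets μ n).indicator f p ∂μ.prod μ = 0 := by
    intro n A B hA hB
    have hfin : ∀ A : Set X, μ (A ∩ spanningSets μ n) ≠ ∞ := fun A =>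
      ((measure_mono Set.inter_subset_right).trans_lt (measure_spanningSets_lt_top μ n)).ne
    have hAS := hA.inter (measurableSet_spanningSets μ n)
    have hBS := hB.inter (measurableSet_spanningSets μ n)
    have h1 := h (indicatorConstLp 2 hAS (hfin A) (1 : ℂ)) (indicatorConstLp 2 hBS (hfin B) (1 : ℂ))
    rw [inner_tensKer] at h1
    rw [← h1, ← integral_indicator (hA.prod hB)]
    refine integral_congr_ae ?_
    filter_upwards [Measure.quasiMeasurePreserving_fst.ae (indicatorConstLp_coeFn (p := 2)
        (hs := hAS) (hμs := hfin A) (c := (1 : ℂ))),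
      Measure.quasiMeasurePreserving_snd.ae (indicatorConstLp_coeFn (p := 2)
        (hs := hBS) (hμs := hfin B) (c := (1 : ℂ)))] with p h2 h3
    rw [h2, h3]
    by_cases hA : p.1 ∈ A <;> by_cases hB : p.2 ∈ B <;> by_cases hAn : p.1 ∈ spanningSets μ n <;>
      by_cases hBn : p.2 ∈ spanningSets μ n <;> simp [Set.indicator, hA, hB, hAn, hBn]
  have hintg : ∀ n, Integrable ((spanningSets μ n ×ˢ spanningSets μ n).indicator f) (μ.prod μ) := by
    intro n
    rw [integrable_indicator_iff (hSm n)]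
    have hfin : (μ.prod μ) (spanningSets μ n ×ˢ spanningSets μ n) < ∞ := by
      rw [Measure.prod_prod]
      exact ENNReal.mul_lt_top (measure_spanningSets_lt_top μ n) (measure_spanningSets_lt_top μ n)
    have : IsFiniteMeasure ((μ.prod μ).restrict (spanningSets μ n ×ˢ spanningSets μ n)) :=
      ⟨by rwa [Measure.restrict_apply_univ]⟩
    exact ((Lp.memLp f).restrict _).integrable (by norm_num)
  have hall : ∀ n (C : Set (X × X)), MeasurableSet C →
      ∫ p in C, (spanningSets μ n ×ˢ spanningSets μ n).indicator f p ∂μ.prod μ = 0 := by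
    intro n C hC
    induction C, hC using MeasurableSpace.induction_on_inter generateFrom_prod.symm
      isPiSystem_prod with
    | empty => simp
    | basic C hC =>
      obtain ⟨A, hA, B, hB, rfl⟩ := hC
      exact hrect n A B hA hB
    | compl C hC ih =>
      have h1 := integral_add_compl hC (hintg n)
      -- The whole space is a rectangle, so the total integral vanishes and complements follow.
      have h2 := hrect n Set.univ Set.univ MeasurableSet.univ MeasurableSet.univ
      rw [Set.univ_prod_univ, setIntegral_univ] at h2
      rw [ih, h2, zero_add] at h1
      exact h1
    | iUnion C hd hC ih =>
      rw [integral_iUnion hC hd (hintg n).integrableOn]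
      simp [ih]
  have hz : ∀ n, (spanningSets μ n ×ˢ spanningSets μ n).indicator f =ᵐ[μ.prod μ] 0 := fun n =>
    (hintg n).ae_eq_zero_of_forall_setIntegral_eq_zero fun C hC _ => hall n C hC
  refine Lp.ext ?_
  filter_upwards [ae_all_iff.2 hz, Lp.coeFn_zero ℂ 2 (μ.prod μ)] with p hp h0
  rw [h0]
  have hmono := monotone_spanningSets μ
  have h1 := hp (max (spanningSetsIndex μ p.1) (spanningSetsIndex μ p.2))
  rwa [Set.indicator_of_mem] at h1
  exact ⟨hmono (le_max_left _ _) (mem_spanningSetsIndex μ p.1),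
    hmono (le_max_right _ _) (mem_spanningSetsIndex μ p.2)⟩

theorem orthonormal_tensKer_basis :
    Orthonormal ℂ fun q : basisIndex (L2 μ) × basisIndex (L2 μ) =>
      tensKer (basis (L2 μ) q.2) (basis (L2 μ) q.1) := by
  classical
  rw [orthonormal_iff_ite]
  intro q r
  rw [inner_tensKer_tensKer, orthonormal_iff_ite.1 (basis (L2 μ)).orthonormal,
    orthonormal_iff_ite.1 (basis (L2 μ)).orthonormal]
  by_cases h1 : q.1 = r.1 <;> by_cases h2 : q.2 = r.2 <;>
    simp [Prod.ext_iff, h1, h2, eq_comm]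

theorem eq_of_inner_basis {K : Type*} [NormedAddCommGroup K] [InnerProductSpace ℂ K]
    [CompleteSpace K] {a b : Bd K}
    (h : ∀ i j, ⟪basis K j, a (basis K i)⟫_ℂ = ⟪basis K j, b (basis K i)⟫_ℂ) : a = b := by
  refine ContinuousLinearMap.ext_on
    (Submodule.dense_iff_topologicalClosure_eq_top.2 (basis K).dense_span) ?_
  rintro _ ⟨i, rfl⟩
  rw [← sub_eq_zero]
  refine hilbertBasis_eq_zero (basis K) fun j => ?_
  rw [inner_sub_right, h, sub_self]

theorem kernelOp_eq_zero {f : Lp ℂ 2 (μ.prod μ)} (h : kernelOp f = 0) : f = 0 :=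
  eq_zero_of_inner_tensKer fun u v => by rw [← inner_kernelOp, h]; simp

variable (μ) in
/-- The Hilbert basis of `L²(X × X)` associated with a Hilbert basis of `L²(X)`. -/
def kernelBasis : HilbertBasis (basisIndex (L2 μ) × basisIndex (L2 μ)) ℂ (Lp ℂ 2 (μ.prod μ)) :=
  HilbertBasis.mkOfOrthogonalEqBot orthonormal_tensKer_basis <| by
    refine (Submodule.eq_bot_iff _).2 fun f hf => kernelOp_eq_zero (eq_of_inner_basis fun i j => ?_)
    rw [inner_kernelOp, (Submodule.mem_orthogonal _ _).1 hf _
      (Submodule.subset_span ⟨(i, j), rfl⟩)]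
    simp

theorem inner_kernelBasis (q : basisIndex (L2 μ) × basisIndex (L2 μ)) (f : Lp ℂ 2 (μ.prod μ)) :
    ⟪kernelBasis μ q, f⟫_ℂ = ⟪basis (L2 μ) q.2, kernelOp f (basis (L2 μ) q.1)⟫_ℂ := by
  rw [inner_kernelOp, kernelBasis, HilbertBasis.coe_mkOfOrthogonalEqBot]

/-- Parseval in `L²(X × X)` for the product basis, summed first over one index, is Parseval for each
vector `K_f e_i`. -/
theorem hasSum_inner_kernelOp (f g : Lp ℂ 2 (μ.prod μ)) :
    HasSum (fun i => ⟪kernelOp f (basis (L2 μ) i), kernelOp g (basis (L2 μ) i)⟫_ℂ) ⟪f, g⟫_ℂ := by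
  refine ((kernelBasis μ).hasSum_inner_mul_inner f g).prod_fiberwise fun i => ?_
  convert (basis (L2 μ)).hasSum_inner_mul_inner (kernelOp f (basis (L2 μ) i))
    (kernelOp g (basis (L2 μ) i)) using 1
  funext j
  rw [inner_kernelBasis, ← inner_conj_symm f, inner_kernelBasis, inner_conj_symm]

theorem hsInner_kernelOp (f g : Lp ℂ 2 (μ.prod μ)) :
    hsInner (kernelOp f) (kernelOp g) = ⟪f, g⟫_ℂ :=
  (hasSum_inner_kernelOp f g).tsum_eq

theorem isHilbertSchmidt_kernelOp (f : Lp ℂ 2 (μ.prod μ)) : IsHilbertSchmidt (kernelOp f) := by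
  have h1 := (hasSum_inner_kernelOp f f).summable
  simp only [inner_self_eq_norm_sq_to_K] at h1
  have h2 := Complex.hasSum_re h1.hasSum
  refine h2.summable.congr fun i => ?_
  norm_cast

/-- The matrix coefficients of `a` are square-summable, so they are the coordinates of a kernel in
the product basis. -/
theorem exists_eq_kernelOp {a : Bd (L2 μ)} (ha : IsHilbertSchmidt a) :
    ∃ f : Lp ℂ 2 (μ.prod μ), a = kernelOp f := by
  have h1 : ∀ i, HasSum (fun j => ‖⟪basis (L2 μ) j, a (basis (L2 μ) i)⟫_ℂ‖ ^ 2)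
      (‖a (basis (L2 μ) i)‖ ^ 2) := by
    intro i
    have h2 := Complex.hasSum_re ((basis (L2 μ)).hasSum_inner_mul_inner (a (basis (L2 μ) i))
      (a (basis (L2 μ) i)))
    rw [inner_self_eq_norm_sq_to_K] at h2
    convert h2 using 1
    · funext j
      rw [← inner_conj_symm (a (basis (L2 μ) i)), ← Complex.normSq_eq_conj_mul_self,
        Complex.normSq_eq_norm_sq, Complex.ofReal_re]
    · norm_cast
  have h2 : Summable fun q : basisIndex (L2 μ) × basisIndex (L2 μ) =>
      ‖⟪basis (L2 μ) q.2, a (basis (L2 μ) q.1)⟫_ℂ‖ ^ 2 := by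
    refine (summable_prod_of_nonneg fun q => by positivity).2 ⟨fun i => (h1 i).summable, ?_⟩
    simp only [(h1 _).tsum_eq]
    exact ha
  have h3 : Memℓp (fun q : basisIndex (L2 μ) × basisIndex (L2 μ) =>
      ⟪basis (L2 μ) q.2, a (basis (L2 μ) q.1)⟫_ℂ) 2 := by
    refine memℓp_gen ?_
    simpa using h2
  refine ⟨(kernelBasis μ).repr.symm ⟨_, h3⟩, eq_of_inner_basis fun i j => ?_⟩
  rw [← inner_kernelBasis (i, j), ← (kernelBasis μ).repr_apply_apply,
    LinearIsometryEquiv.apply_symm_apply]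

end KernelTheory

/-! ### Complete positivity of compressions -/

section CompletePositivity

variable {K L : Type*} [NormedAddCommGroup K] [InnerProductSpace ℂ K] [CompleteSpace K]
  [NormedAddCommGroup L] [InnerProductSpace ℂ L] [CompleteSpace L]

/-- The square root `q` of `d m d` satisfies `(q(1-d))* (q(1-d)) = (1-d) d m d (1-d) = 0`, so it is
supported under the projection `d`. -/
theorem sqrt_mul_eq_of_conj {A : Type*} [CStarAlgebra A] [PartialOrder A] [StarOrderedRing A]
    {d m : A} (hd : star d = d) (hdd : d * d = d) (hm : 0 ≤ m) :
    ∃ q : A, star q = q ∧ q * q = d * m * d ∧ d * q = q := by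
  have hN : 0 ≤ d * m * d := by
    have := star_left_conjugate_nonneg hm d
    rwa [hd] at this
  set q := CFC.sqrt (d * m * d)
  have hq : star q = q := (CFC.sqrt_nonneg _).isSelfAdjoint
  have hqq : q * q = d * m * d := CFC.sqrt_mul_sqrt_self _ hN
  refine ⟨q, hq, hqq, ?_⟩
  have h1 : star (q * (1 - d)) * (q * (1 - d)) = 0 := by
    rw [star_mul, hq, mul_assoc, ← mul_assoc q, hqq, mul_assoc (d * m), mul_sub, hdd, mul_one,
      sub_self, mul_zero, mul_zero]
  have h2 : q * (1 - d) = 0 := CStarRing.star_mul_self_eq_zero_iff _ |>.1 h1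
  have h3 := congrArg star h2
  rw [star_mul, hq, star_sub, star_one, hd, star_zero, sub_mul, one_mul, sub_eq_zero] at h3
  exact h3.symm

/-- With `p = CC*` and `D` the diagonal matrix of `p`, compressing `M` or `DMD` gives the same
matrix. The square root `q` of `DMD` satisfies `Dq = q`, so its compression, multiplied on the left
by the adjoint, gives back the compression of `M`. -/
theorem nonneg_map_compression (C : L →L[ℂ] K) (hC : C.adjoint ∘L C = 1) {n : ℕ}
    {M : CStarMatrix (Fin n) (Fin n) (Bd K)} (hM : 0 ≤ M) :
    0 ≤ M.map fun m => (C.adjoint ∘L m ∘L C : Bd L) := by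
  set p : Bd K := C ∘L C.adjoint with hp
  have hps : star p = p := by
    rw [ContinuousLinearMap.star_eq_adjoint, hp, ContinuousLinearMap.adjoint_comp,
      ContinuousLinearMap.adjoint_adjoint]
  have hpC : p ∘L C = C := by
    rw [hp, ContinuousLinearMap.comp_assoc, hC]
    rfl
  have hCp : C.adjoint ∘L p = C.adjoint := by
    rw [hp, ← ContinuousLinearMap.comp_assoc, hC]
    rfl
  have hpp : p * p = p := by
    change (C ∘L C.adjoint) ∘L p = p
    rw [ContinuousLinearMap.comp_assoc, hCp]
  let D : CStarMatrix (Fin n) (Fin n) (Bd K) := CStarMatrix.ofMatrix (Matrix.diagonal fun _ => p)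
  have hDl : ∀ (N : CStarMatrix (Fin n) (Fin n) (Bd K)) i j, (D * N) i j = p * N i j :=
    fun N i j => Matrix.diagonal_mul _ _ _ _
  have hDr : ∀ (N : CStarMatrix (Fin n) (Fin n) (Bd K)) i j, (N * D) i j = N i j * p :=
    fun N i j => Matrix.mul_diagonal _ _ _ _
  have hD : star D = D := by
    change CStarMatrix.ofMatrix (Matrix.conjTranspose (Matrix.diagonal fun _ => p)) = _
    rw [Matrix.diagonal_conjTranspose]
    change CStarMatrix.ofMatrix (Matrix.diagonal fun _ => star p) = _
    rw [hps]
  have hDD : D * D = D := by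
    change CStarMatrix.ofMatrix (Matrix.diagonal (fun _ => p) * Matrix.diagonal (fun _ => p)) = _
    rw [Matrix.diagonal_mul_diagonal, hpp]
  obtain ⟨q, hq, hqq, hDq⟩ := sqrt_mul_eq_of_conj hD hDD hM
  have hpq : ∀ i j, p * q i j = q i j := fun i j => by rw [← hDl, hDq]
  have key : M.map (fun m => (C.adjoint ∘L m ∘L C : Bd L)) =
      star (q.map fun m => (C.adjoint ∘L m ∘L C : Bd L)) *
        q.map fun m => (C.adjoint ∘L m ∘L C : Bd L) := by
    ext1 i j
    -- The projection `CC*` appearing between the two factors fixes the entries of `q` and can be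
    -- dropped.
    have h1 : ∀ l, star (C.adjoint ∘L q l i ∘L C : Bd L) * (C.adjoint ∘L q l j ∘L C : Bd L) =
        C.adjoint ∘L (star (q l i) * q l j) ∘L C := by
      intro l
      rw [ContinuousLinearMap.star_eq_adjoint, ContinuousLinearMap.adjoint_comp,
        ContinuousLinearMap.adjoint_comp, ContinuousLinearMap.adjoint_adjoint]
      refine ContinuousLinearMap.ext fun ξ => ?_
      have h3 : C (C.adjoint (q l j (C ξ))) = q l j (C ξ) := DFunLike.congr_fun (hpq l j) (C ξ)
      change C.adjoint ((q l i).adjoint (C (C.adjoint (q l j (C ξ))))) =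
        C.adjoint ((q l i).adjoint (q l j (C ξ)))
      rw [h3]
    have h2 : ∑ l, star (q l i) * q l j = p * M i j * p := by
      rw [← hDl, ← hDr, ← hqq, CStarMatrix.mul_apply]
      refine Finset.sum_congr rfl fun l _ => ?_
      rw [← CStarMatrix.star_apply, hq]
    rw [CStarMatrix.mul_apply]
    simp only [CStarMatrix.star_apply, CStarMatrix.map_apply, h1]
    refine ContinuousLinearMap.ext fun ξ => ?_
    have h4 : p (C ξ) = C ξ := DFunLike.congr_fun hpC ξ
    have h5 : ∀ η, C.adjoint (p η) = C.adjoint η := DFunLike.congr_fun hCp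
    have h6 := congrArg (fun a : Bd K => C.adjoint (a (C ξ))) h2
    change C.adjoint ((∑ l, star (q l i) * q l j : Bd K) (C ξ)) =
      C.adjoint (p (M i j (p (C ξ)))) at h6
    rw [h4, h5, sum_apply, map_sum] at h6
    rw [sum_apply]
    exact h6.symm
  rw [key]
  exact star_mul_self_nonneg _

/-- A compression of a unital `*`-homomorphism is completely positive. -/
theorem isCompletelyPositive_of_compression (C : L →L[ℂ] K) (hC : C.adjoint ∘L C = 1)
    (π : Bd L →⋆ₐ[ℂ] Bd K) {T : Bd L →L[ℂ] Bd L} (hT : ∀ z, T z = C.adjoint ∘L π z ∘L C) :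
    IsCompletelyPositive T := by
  refine ⟨⟨T, fun k M hM => ?_⟩, fun z => rfl⟩
  have h1 : M.map (T : Bd L →ₗ[ℂ] Bd L) =
      (M.map π).map fun m => (C.adjoint ∘L m ∘L C : Bd L) := by
    ext1 i j
    exact hT _
  rw [h1]
  refine nonneg_map_compression C hC ?_
  exact CompletelyPositiveMapClass.map_cstarMatrix_nonneg' π k M hM

end CompletePositivity

/-! ### The dilated Schur multipliers -/

section Dilation

namespace IsCocycle

variable {Ω : Type*} [MeasurableSpace Ω] {X : Type*} [MeasurableSpace X]
  {P : Measure Ω} {μ : Measure X} {θ : ℝ → Ω → Ω} {k : ℝ → Ω × X → ℂ} [IsProbabilityMeasure P]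

/-- The representation `z ↦ U_t (1 ⊗ z)` of `B(L²(X))`. -/
def rep (h : IsCocycle P μ θ k) (t : ℝ) : Bd (L2 μ) →⋆ₐ[ℂ] Bd (L2L2 P μ) :=
  (tensorVN P μ).toStarSubalgebra.subtype.comp
    (((h.auto t : Elt (tensorVN P μ) →⋆ₐ[ℂ] Elt (tensorVN P μ))).comp (ampHom P μ))

/-- The operator `𝔼 U_t J` on `B(L²(X))`. -/
def expect (h : IsCocycle P μ θ k) (t : ℝ) : Bd (L2 μ) →L[ℂ] Bd (L2 μ) :=
  LinearMap.mkContinuous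
    { toFun := fun z => (constEmb P μ).adjoint ∘L h.rep t z ∘L constEmb P μ
      map_add' := fun z w => by
        rw [map_add, ContinuousLinearMap.add_comp, ContinuousLinearMap.comp_add]
      map_smul' := fun c z => by
        rw [map_smul, ContinuousLinearMap.smul_comp, ContinuousLinearMap.comp_smul]
        rfl }
    (‖(constEmb P μ).adjoint‖ * ‖constEmb P μ‖) fun z => by
      refine (ContinuousLinearMap.opNorm_comp_le _ _).trans ?_
      rw [mul_assoc]
      refine mul_le_mul_of_nonneg_left ?_ (norm_nonneg _)
      refine (ContinuousLinearMap.opNorm_comp_le _ _).trans ?_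
      rw [mul_comm]
      exact mul_le_mul_of_nonneg_left (NonUnitalStarAlgHom.norm_apply_le (h.rep t) z)
        (norm_nonneg _)

theorem expect_apply (h : IsCocycle P μ θ k) (t : ℝ) (z : Bd (L2 μ)) :
    h.expect t z = meanExp P μ (h.auto t (ampHom P μ z)) := rfl

theorem expect_one (h : IsCocycle P μ θ k) (t : ℝ) : h.expect t 1 = 1 := by
  rw [expect_apply, map_one, map_one, ← map_one (ampHom P μ), meanExp_ampHom]

theorem isCompletelyPositive_expect (h : IsCocycle P μ θ k) (t : ℝ) :
    IsCompletelyPositive (h.expect t) :=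
  isCompletelyPositive_of_compression (constEmb P μ)
    (ContinuousLinearMap.ext adjoint_constEmb_comp) (h.rep t) fun _ => rfl

theorem continuous_expect (h : IsCocycle P μ θ k) (t : ℝ) :
    Continuous[weakStar (L2 μ), weakStar (L2 μ)] (h.expect t) := by
  let _ := weakStar (L2 μ)
  let _ := weakStarVN (tensorVN P μ)
  exact continuous_meanExp.comp ((h.continuous_auto t).comp continuous_ampHom)

theorem star_phaseOp_constEmb_apply (h : IsCocycle P μ θ k) (t : ℝ) (ξ : L2 μ) :
    star (h.phaseOp t) (constEmb P μ ξ) =ᵐ[P]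
      fun ω => mulVec (fun x => (starRingEnd ℂ) (k t (ω, x))) ξ := by
  rw [phaseOp, star_multOp]
  filter_upwards [multOp_apply (h.bddMeas t).conj (constEmb P μ ξ), constEmb_apply (P := P) ξ]
    with ω h1 h2
  rw [h1, h2]

/-- Shows `𝔼 U_t J` as the average over `ω` of conjugations by unitary diagonal operators. -/
theorem inner_expect (h : IsCocycle P μ θ k) (t : ℝ) (z : Bd (L2 μ)) (ξ η : L2 μ) :
    ⟪η, h.expect t z ξ⟫_ℂ =
      ∫ ω, ⟪mulVec (fun x => (starRingEnd ℂ) (k t (ω, x))) η,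
        z (mulVec (fun x => (starRingEnd ℂ) (k t (ω, x))) ξ)⟫_ℂ ∂P := by
  rw [expect_apply, meanExp_apply, h.auto_ampHom]
  change ⟪constEmb P μ η, h.phaseOp t (ampOp P z (star (h.phaseOp t) (constEmb P μ ξ)))⟫_ℂ = _
  rw [← ContinuousLinearMap.adjoint_inner_left, ← ContinuousLinearMap.star_eq_adjoint,
    L2.inner_def]
  refine integral_congr_ae ?_
  filter_upwards [h.star_phaseOp_constEmb_apply t η, h.star_phaseOp_constEmb_apply t ξ,
    ampOp_apply z (star (h.phaseOp t) (constEmb P μ ξ))] with ω h1 h2 h3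
  rw [h3, h1, h2]

variable [SigmaFinite μ]

/-- For fixed `ω`, conjugating by the phase multiplies the kernel by `k_t(ω, x) conj k_t(ω, y)`. The
phases being unimodular, Fubini lets this factor be averaged first. -/
theorem inner_expect_kernelOp (h : IsCocycle P μ θ k) {t : ℝ} {φ : X × X → ℂ}
    (hφ : ∀ᵐ p ∂μ.prod μ, ∫ ω, k t (ω, p.1) * (starRingEnd ℂ) (k t (ω, p.2)) ∂P = φ p)
    (f : Lp ℂ 2 (μ.prod μ)) (ξ η : L2 μ) :
    ⟪η, h.expect t (kernelOp f) ξ⟫_ℂ =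
      ∫ p, φ p * (f p * ((starRingEnd ℂ) (η p.1) * ξ p.2)) ∂μ.prod μ := by
  set g : X × X → ℂ := fun p => f p * ((starRingEnd ℂ) (η p.1) * ξ p.2) with hg
  have hgi : Integrable g (μ.prod μ) := integrable_kernel η ξ f
  have hkm : Measurable fun q : Ω × (X × X) =>
      k t (q.1, q.2.1) * (starRingEnd ℂ) (k t (q.1, q.2.2)) :=
    ((h.measurable t).comp (measurable_fst.prodMk (measurable_fst.comp measurable_snd))).mul
      (Complex.continuous_conj.measurable.comp ((h.measurable t).comp
        (measurable_fst.prodMk (measurable_snd.comp measurable_snd))))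
  have hintg : Integrable (fun q : Ω × (X × X) =>
      k t (q.1, q.2.1) * (starRingEnd ℂ) (k t (q.1, q.2.2)) * g q.2) (P.prod (μ.prod μ)) := by
    refine (hgi.comp_snd P).bdd_mul (c := 1) hkm.aestronglyMeasurable
      (Filter.Eventually.of_forall fun q => ?_)
    rw [norm_mul, RCLike.norm_conj, h.norm, h.norm, one_mul]
  have h1 : ⟪η, h.expect t (kernelOp f) ξ⟫_ℂ =
      ∫ ω, ∫ p, k t (ω, p.1) * (starRingEnd ℂ) (k t (ω, p.2)) * g p ∂μ.prod μ ∂P := by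
    rw [inner_expect]
    refine integral_congr_ae (Filter.Eventually.of_forall fun ω => ?_)
    change ⟪_, kernelOp f _⟫_ℂ = _
    rw [inner_kernelOp, inner_tensKer]
    refine integral_congr_ae ?_
    filter_upwards [Measure.quasiMeasurePreserving_fst.ae
        (mulVec_apply ((h.bddMeas t).conj.slice ω) η),
      Measure.quasiMeasurePreserving_snd.ae
        (mulVec_apply ((h.bddMeas t).conj.slice ω) ξ)] with p h2 h3
    rw [h2, h3, map_mul, RCLike.conj_conj, hg]
    ring
  rw [h1, integral_integral_swap hintg]
  refine integral_congr_ae ?_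
  filter_upwards [hφ] with p hp
  rw [integral_mul_const, hp]

theorem isSchurMultiplier_expect (h : IsCocycle P μ θ k) {t : ℝ} {φ : X × X → ℂ}
    (hφ : ∀ᵐ p ∂μ.prod μ, ∫ ω, k t (ω, p.1) * (starRingEnd ℂ) (k t (ω, p.2)) ∂P = φ p)
    (hm : MemLp φ ∞ (μ.prod μ)) : IsSchurMultiplier φ (h.expect t) where
  memLp := hm
  normal := h.continuous_expect t
  apply_kernelOp f := by
    refine ContinuousLinearMap.ext fun ξ => ext_inner_left ℂ fun η => ?_
    rw [h.inner_expect_kernelOp hφ, inner_kernelOp, inner_tensKer]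
    refine integral_congr_ae ?_
    filter_upwards [Lp.coeFn_lpSMul (r := 2) (hm.toLp φ) f, hm.coeFn_toLp] with p h1 h2
    rw [h1, Pi.smul_apply', h2, smul_eq_mul, mul_assoc]

end IsCocycle

/-! ### Properties of Schur multipliers read on their symbols. -/

section Schur

variable {X : Type*} [MeasurableSpace X] {μ : Measure X} [SigmaFinite μ]

/-- Every Hilbert–Schmidt operator is some `K_f`, and on `L²(X × X)` the map `T` is multiplication
by a real function. -/
theorem IsSchurMultiplier.isSelfAdjointOnHS {φ : X × X → ℂ} {T : Bd (L2 μ) →L[ℂ] Bd (L2 μ)}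
    (hT : IsSchurMultiplier φ T) (hφ : ∀ p, (starRingEnd ℂ) (φ p) = φ p) :
    IsSelfAdjointOnHS T := by
  intro a b ha hb
  obtain ⟨f, rfl⟩ := exists_eq_kernelOp ha
  obtain ⟨g, rfl⟩ := exists_eq_kernelOp hb
  rw [hT.apply_kernelOp, hT.apply_kernelOp]
  refine ⟨isHilbertSchmidt_kernelOp _, ?_⟩
  rw [hsInner_kernelOp, hsInner_kernelOp, L2.inner_def, L2.inner_def]
  refine integral_congr_ae ?_
  filter_upwards [Lp.coeFn_lpSMul (r := 2) (hT.memLp.toLp φ) f,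
    Lp.coeFn_lpSMul (r := 2) (hT.memLp.toLp φ) g, hT.memLp.coeFn_toLp] with p h1 h2 h3
  rw [h1, h2, Pi.smul_apply', Pi.smul_apply', h3, smul_eq_mul, smul_eq_mul, RCLike.inner_apply,
    RCLike.inner_apply, map_mul, hφ]
  ring

/-- Composing measurable Schur multipliers amounts to multiplying their symbols. -/
theorem IsSchurMultiplier.comp_apply {φ φ' ψ : X × X → ℂ} {S S' T : Bd (L2 μ) →L[ℂ] Bd (L2 μ)}
    (hS : IsSchurMultiplier φ S) (hS' : IsSchurMultiplier φ' S') (hT : IsSchurMultiplier ψ T)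
    (h : ∀ p, ψ p = φ p * φ' p) (z : Bd (L2 μ)) : T z = S (S' z) := by
  have h1 : (T : Bd (L2 μ) →ₗ[ℂ] Bd (L2 μ)) = (S ∘L S' : Bd (L2 μ) →L[ℂ] Bd (L2 μ)) := by
    refine eq_of_eq_rankOne hT.normal ?_ fun u v => ?_
    · let _ := weakStar (L2 μ)
      exact hS.normal.comp hS'.normal
    · rw [← kernelOp_tensKer]
      change T _ = S (S' _)
      rw [hT.apply_kernelOp, hS'.apply_kernelOp, hS.apply_kernelOp]
      congr 1
      refine Lp.ext ?_
      filter_upwards [Lp.coeFn_lpSMul (r := 2) (hT.memLp.toLp ψ) (tensKer u v),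
        Lp.coeFn_lpSMul (r := 2) (hS'.memLp.toLp φ') (tensKer u v),
        Lp.coeFn_lpSMul (r := 2) (hS.memLp.toLp φ)
          (hS'.memLp.toLp φ' • tensKer u v : Lp ℂ 2 (μ.prod μ)),
        hT.memLp.coeFn_toLp, hS.memLp.coeFn_toLp, hS'.memLp.coeFn_toLp] with p h1 h2 h3 h4 h5 h6
      rw [h1, h3, Pi.smul_apply', Pi.smul_apply', h2, Pi.smul_apply', h4, h5, h6, h, mul_smul]
  exact DFunLike.congr_fun h1 z

end Schur

/-! ### The Gaussian symbol. -/

section Gaussian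

variable {H : Type*} [NormedAddCommGroup H] [InnerProductSpace ℝ H]
  {X : Type*} [MeasurableSpace X] {μ : Measure X} {α : X → H}
  {P : Measure (Lp H 2 (volume : Measure ℝ) → ℝ)}

theorem memLp_symbol {H : Type*} [NormedAddCommGroup H] {α : X → H} [SFinite μ]
    (hα : AEStronglyMeasurable α μ) {t : ℝ} (ht : 0 ≤ t) :
    MemLp (fun p : X × X => ((Real.exp (-t * ‖α p.1 - α p.2‖ ^ 2) : ℝ) : ℂ)) ∞ (μ.prod μ) := by
  refine memLp_top_of_bound ?_ 1 (Filter.Eventually.of_forall fun p => ?_)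
  · have h1 : Continuous fun h : H => ((Real.exp (-t * ‖h‖ ^ 2) : ℝ) : ℂ) := by fun_prop
    exact h1.comp_aestronglyMeasurable (hα.comp_fst.sub hα.comp_snd)
  · rw [Complex.norm_real, Real.norm_eq_abs, Real.abs_exp, Real.exp_le_one_iff]
    have : 0 ≤ t * ‖α p.1 - α p.2‖ ^ 2 := by positivity
    linarith

/-- The product of phases is the exponential of `i` times the process at a difference of two
vectors, whose mean is given by the Gaussian characteristic function. -/
theorem IsIsonormalLaw.integral_phaseFun_mul_conj [SFinite μ] (hP : IsIsonormalLaw P)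
    (hα : AEStronglyMeasurable α μ) {t : ℝ} (ht : 0 ≤ t) :
    ∀ᵐ p ∂μ.prod μ, ∫ ω, hP.phaseFun hα t (ω, p.1) *
        (starRingEnd ℂ) (hP.phaseFun hα t (ω, p.2)) ∂P =
      ((Real.exp (-t * ‖α p.1 - α p.2‖ ^ 2) : ℝ) : ℂ) := by
  filter_upwards [Measure.quasiMeasurePreserving_fst.ae (hP.phaseFun_ae hα t),
    Measure.quasiMeasurePreserving_snd.ae (hP.phaseFun_ae hα t)] with p h1 h2
  have h3 : ∫ ω, hP.phaseFun hα t (ω, p.1) * (starRingEnd ℂ) (hP.phaseFun hα t (ω, p.2)) ∂P =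
      ∫ ω, Complex.exp (Complex.I * (ω (phaseVec α t p.1 - phaseVec α t p.2) : ℂ)) ∂P := by
    refine integral_congr_ae ?_
    filter_upwards [h1, h2, hP.aelinear.sub (phaseVec α t p.1) (phaseVec α t p.2)] with ω h1 h2 h3
    rw [h1, h2, h3, ← Complex.exp_conj, ← Complex.exp_add]
    congr 1
    simp only [map_mul, Complex.conj_I, Complex.conj_ofReal]
    push_cast
    ring
  rw [h3, hP.integral_exp, norm_phaseVec_sub_sq ht]
  push_cast
  ring_nf

end Gaussian

end Dilation

end SchurDilation

end

theorem mainTheorem1 {X : Type u} [MeasurableSpace X] (μ : Measure X)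
    [SigmaFinite μ]
    {H : Type v} [NormedAddCommGroup H] [InnerProductSpace ℝ H] [CompleteSpace H]
    (α : X → H) (hα : ∀ h : H, Measurable fun x => inner ℝ (α x) h)
    (hsep : ∃ s : Set H, TopologicalSpace.IsSeparable s ∧ ∀ᵐ x ∂μ, α x ∈ s) :
    ∃ T : ℝ≥0 → (Bd (L2 μ) →L[ℂ]
        Bd (L2 μ)),
      -- the Schur multipliers with symbols `exp(-t ‖α_x - α_y‖²)`
      (∀ t : ℝ≥0, IsSchurMultiplier
        (fun p : X × X => ((Real.exp (-(t : ℝ) * ‖α p.1 - α p.2‖ ^ 2) : ℝ) : ℂ)) (T t)) ∧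
      IsWeakStarSemigroup T ∧
      (∀ t, IsSelfAdjointOnHS (T t) ∧ T t 1 = 1 ∧
        IsCompletelyPositive (T t)) ∧
      -- the dilation on `M = L^∞(Ω) ⊗̄ B(L²(X))`
      ∃ (Ω : Type v) (_ : MeasurableSpace Ω) (P : Measure Ω)
        (_ : IsProbabilityMeasure P)
        (U : ℝ → (Elt (tensorVN P μ) ≃⋆ₐ[ℂ]
          Elt (tensorVN P μ)))
        (J : Bd (L2 μ) →⋆ₐ[ℂ]
          Elt (tensorVN P μ)),
        IsInjectiveVN (tensorVN P μ) ∧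
        IsNSFTrace (tensorVN P μ) (tensorTrace P μ) ∧
        IsTracePreservingGroup (tensorVN P μ)
          (tensorTrace P μ) U ∧
        (∀ z, (J z : Bd (L2L2 P μ)) = ampOp P z) ∧
        IsTracePreservingEmbedding (tensorVN P μ)
          (tensorTrace P μ) J ∧
        IsConditionalExpectation (tensorVN P μ)
          (tensorTrace P μ) J (meanExp P μ) ∧
        (∀ (t : ℝ≥0) (z), T t z = meanExp P μ (U t (J z))) ∧
        -- the group is built from an isonormal process
        ∃ W : Lp H 2 (volume : Measure ℝ) →ₗ[ℝ]
            (Ω →ₘ[P] ℝ),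
          IsIsonormal W ∧
          (∀ (t : ℝ) (g), U t (mulElt μ (expI (W g))) =
            mulElt μ (expI (W (shift t g)))) ∧
          ∀ t : ℝ, ∃ V ∈ unitary (Elt (tensorVN P μ)),
            IsGaussianMult μ W α t V ∧
            ∀ z, U t (J z) = V * J z * star V := by
  have hm := aestronglyMeasurable_of_inner hα hsep
  obtain ⟨P, hprob, hP⟩ := exists_isIsonormalLaw (Lp H 2 (volume : Measure ℝ))
  have hK := hP.isCocycle hm
  have hS : ∀ t : ℝ≥0, IsSchurMultiplier
      (fun p : X × X => ((Real.exp (-(t : ℝ) * ‖α p.1 - α p.2‖ ^ 2) : ℝ) : ℂ)) (hK.expect t) :=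
    fun t => hK.isSchurMultiplier_expect (hP.integral_phaseFun_mul_conj hm t.2)
      (memLp_symbol hm t.2)
  have hU := hK.isTracePreservingGroup_auto (hP.continuous_implOp hm)
  refine ⟨fun t => hK.expect t, hS, ⟨fun z => ?_, fun s t z => ?_, fun t => (hS t).normal,
    fun z => ?_⟩, fun t => ⟨(hS t).isSelfAdjointOnHS fun p => Complex.conj_ofReal _,
      hK.expect_one t, hK.isCompletelyPositive_expect t⟩,
    (Lp H 2 (volume : Measure ℝ) → ℝ), inferInstance, P, hprob, hK.auto, ampHom P μ,
    isInjectiveVN_tensorVN P μ, isNSFTrace_tensorTrace P μ, hU, fun z => rfl,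
    isTracePreservingEmbedding_ampHom P μ, isConditionalExpectation_meanExp P μ, fun t z => rfl,
    hP.process, hP.isIsonormal_process, fun t g => ?_, fun t => ⟨hK.phase t, ?_,
      hP.isGaussianMult_phase hm t, hK.auto_ampHom t⟩⟩
  · rw [hK.expect_apply, NNReal.coe_zero, hU.zero, meanExp_ampHom]
  -- The expectation is not multiplicative, so the group law of `U` does not directly give this. The
  -- exponential form of the symbols does.
  · refine (hS s).comp_apply (hS t) (hS (s + t)) (fun p => ?_) z
    rw [← Complex.ofReal_mul, ← Real.exp_add]
    congr 2
    push_cast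
    ring
  · let _ := weakStar (L2 μ)
    let _ := weakStarVN (tensorVN P μ)
    exact continuous_meanExp.comp ((hU.continuous (ampHom P μ z)).comp NNReal.continuous_coe)
  · rw [hK.auto_mulElt, hP.compMeasurePreserving_expI]
  · exact Unitary.mem_iff.2 ⟨hK.star_phase_mul_phase t, hK.phase_mul_star_phase t⟩
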